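/- **Definitions.** An SDDM matrix is a real symmetric nonsingular matrix $A$ with $A_{ij}\le 0$ for $i\ne j$ and $A_{ii}\ge\sum_{j\neq i}|A_{ij}|$ for all $i$. A symmetric matrix $A$ is $\alpha$-strongly diagonally dominant if $A_{ii}\ge(1+\alpha)\sum_{j\ne i}|A_{ij}|$ for all $i$. We write $A\approx_\epsilon B$ if $e^{\epsilon}B\succcurlyeq A\succcurlyeq e^{-\epsilon}B$ in the Loewner order, $\mathrm{Sc}(M,F)=M_{CC}-M_{CF}M_{FF}^{-1}M_{FC}$ for the Schur complement of a set $F$ of rows with complement $C$, and $\|x\|_A=(x^TAx)^{1/2}$. A vector $\tilde x$ is an $\epsilon$-approximate solution of $Ax=b$ if $\|\tilde x-A^{-1}b\|_A\le\epsilon\|A^{-1}b\|_A$. Put $\lg x=\max(1,\log x)$. A *vertex sparsifier chain* of an SDDM matrix $M^{(0)}$ with last size at most $s$ consists of SDDM matrices $M^{(1)},\dots,M^{(d)}$ ($d\ge1$), sets $F_1,\dots,F_{d-1}$ and parameters $\alpha_i\ge4$ ($1\le i<d$), $0<\epsilon_i\le\frac12$ ($0\le i<d$), such that $M^{(1)}\approx_{\epsilon_0}M^{(0)}$;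 for $1\le i<d$, $F_i$ is a subset of the rows of $M^{(i)}$, $M^{(i)}_{F_iF_i}$ is $\alpha_i$-strongly diagonally dominant and $M^{(i+1)}\approx_{\epsilon_i}\mathrm{Sc}(M^{(i)},F_i)$; and $M^{(d)}$ has dimension at most $s$. It is an *$\eta$-vertex sparsifier chain of depth $D$ and work $W$* if $2\sum_{i=0}^{d-1}\epsilon_i\le\eta$, $\sum_{i=1}^{d-1}m_i\log_{\alpha_i}\epsilon_i^{-1}\le W$ and $\sum_{i=1}^{d-1}(\log n)\log_{\alpha_i}\epsilon_i^{-1}\le D$, where $m_i$ is the number of nonzero entries of $M^{(i)}$ and $n$ is the dimension of $M^{(0)}$. Computations are arithmetic circuits over $\mathbb R$ with gates $+,-,\times,/$ of fan-in two, unbounded fan-out and rational constants; *work* is the number of gates and *depth* the length of a longest path. For $s\in\mathbb N$ and reals $\kappa>0$, $c_1,c_2$, call a chain of an $n$-dimensional SDDM matrix *$(s,\kappa,c_1,c_2)$-good* if it is a $1$-vertex sparsifier chain of depth $c_1\lg^2 n\,\lg(\log n)$ and work $c_2n$, with last size at most $s$ and $\log_{\alpha_i}\epsilon_i^{-1}\ge\kappa$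 for all $1\le i<d$ (with $\log 0=0$). **Theorem.** 1. There are constants $s$, $\kappa>0$, $c_1$, $c_2$ such that every SDDM matrix, of any dimension $n$, has an $(s,\kappa,c_1,c_2)$-good chain. That is, every SDDM matrix of dimension $n$ has a $1$-vertex sparsifier chain of depth $O(\log^2 n\log\log n)$ and work $O(n)$. 2. For all $s$, $\kappa>0$, $c_1$, $c_2$ there is a constant $C$ such that the following holds. Let $M$ be an SDDM matrix of dimension $n$ with $m$ nonzero entries, given with an $(s,\kappa,c_1,c_2)$-good chain, and let $0<\epsilon<1$. There is a circuit of work at most $C\,m\,\lg(1/\epsilon)$ and depth at most $C\,\lg^2 n\,\lg(\log n)\,\lg(1/\epsilon)$ that takes as inputs the entries of $M$, of the matrices of the chain and of a vector $b\in\mathbb R^n$, and, for every $b$, outputs an $\epsilon$-approximate solution of $Mx=b$ without dividing by zero. The circuit depends only on $n$, $\epsilon$, $d$, the sets $F_i$, the parameters $\alpha_i,\epsilon_i$ and the positions of the nonzero entries of $M$ and of the $M^{(i)}$: the same circuit works for every other SDDM matrix and chain (with last size at most $s$) that share these data. -/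

import Mathlib

noncomputable section

namespace SparseChol

open Finset

/-! ### Matrices -/

/-- `A` is diagonally dominant, symmetric, nonsingular, with non-positive off-diagonal entries. -/
structure IsSDDM {ι : Type} [Fintype ι] [DecidableEq ι] (A : Matrix ι ι ℝ) : Prop where
  symm : A.IsSymm
  dominant : ∀ i, ∑ j ∈ univ.erase i, |A i j| ≤ A i i
  offDiag_nonpos : ∀ i j, i ≠ j → A i j ≤ 0
  nonsingular : IsUnit A.det

/-- `A` is `α`-strongly diagonally dominant. -/
def IsStronglyDD {ι : Type} [Fintype ι] [DecidableEq ι] (α : ℝ) (A : Matrix ι ι ℝ) : Prop :=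
  A.IsSymm ∧ ∀ i, (1 + α) * ∑ j ∈ univ.erase i, |A i j| ≤ A i i

/-- `A ≈_ε B`, i.e. `e^ε B ≽ A ≽ e^{-ε} B` in the Loewner order. -/
def Approx {ι : Type} [Fintype ι] (ε : ℝ) (A B : Matrix ι ι ℝ) : Prop :=
  (Real.exp ε • B - A).PosSemidef ∧ (A - Real.exp (-ε) • B).PosSemidef

/-- The number of nonzero entries of a matrix. -/
def nnz {ι : Type} [Fintype ι] (A : Matrix ι ι ℝ) : ℕ :=
  #{p : ι × ι | A p.1 p.2 ≠ 0}

/-- The two matrices have their nonzero entries at the same positions. -/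
def SamePattern {ι : Type} (A B : Matrix ι ι ℝ) : Prop :=
  ∀ i j, A i j = 0 ↔ B i j = 0

/-- `‖x‖_A = (xᵀ A x)^{1/2}`. -/
def energyNorm {ι : Type} [Fintype ι] (A : Matrix ι ι ℝ) (x : ι → ℝ) : ℝ :=
  Real.sqrt (x ⬝ᵥ A.mulVec x)

/-- `y` is an `ε`-approximate solution of `A x = b`. -/
def IsApproxSolution {ι : Type} [Fintype ι] [DecidableEq ι]
    (ε : ℝ) (A : Matrix ι ι ℝ) (b y : ι → ℝ) : Prop :=
  energyNorm A (y - A⁻¹.mulVec b) ≤ ε * energyNorm A (A⁻¹.mulVec b)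

/-! ### Blocks and Schur complements

The rows of a matrix in a chain are indexed by a finite set `V`; for `F ⊆ V` the eliminated
rows are those in `F`, and the remaining ones are `C = V \ F`. -/

/-- The rows in `F`, as rows of a matrix indexed by `V`. -/
def fine {ι : Type} (V F : Finset ι) (v : {v : ↥V // (v : ι) ∈ F}) : ↥V := v.1

/-- The rows in `C = V \ F`, as rows of a matrix indexed by `V`. -/
def coarse {ι : Type} [DecidableEq ι] (V F : Finset ι) (v : ↥(V \ F)) : ↥V :=
  ⟨v.1, (mem_sdiff.1 v.2).1⟩

/-- The block `M_{FF}`. -/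
def blockFF {ι : Type} {V : Finset ι} (M : Matrix V V ℝ) (F : Finset ι) :
    Matrix {v : ↥V // (v : ι) ∈ F} {v : ↥V // (v : ι) ∈ F} ℝ :=
  M.submatrix (fine V F) (fine V F)

/-- The Schur complement `M_{CC} - M_{CF} M_{FF}⁻¹ M_{FC}`. -/
def schur {ι : Type} [DecidableEq ι] {V : Finset ι} (M : Matrix V V ℝ) (F : Finset ι) :
    Matrix ↥(V \ F) ↥(V \ F) ℝ :=
  M.submatrix (coarse V F) (coarse V F) -
    M.submatrix (coarse V F) (fine V F) * (blockFF M F)⁻¹ *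
      M.submatrix (fine V F) (coarse V F)

/-! ### Vertex sparsifier chains -/

/-- The data of a chain other than the matrices: the number `d` of matrices
`M⁽¹⁾, …, M⁽ᵈ⁾`, the eliminated sets `F₁, …, F_{d-1}`, and the parameters
`α₁, …, α_{d-1}` and `ε₀, …, ε_{d-1}`. Values of `F`, `α`, `ε` at other indices are irrelevant. -/
structure ChainShape (n : ℕ) where
  d : ℕ
  F : ℕ → Finset (Fin n)
  α : ℕ → ℝ
  ε : ℕ → ℝ

/-- The index set of `M⁽ⁱ⁾`: all of `Fin n` for `i = 0, 1`, and the set of rows that remain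
after the elimination of `Fᵢ` for `i + 1`. -/
def ChainShape.vertices {n : ℕ} (σ : ChainShape n) : ℕ → Finset (Fin n)
  | 0 => univ
  | 1 => univ
  | i + 2 => σ.vertices (i + 1) \ σ.F (i + 1)

/-- The matrices of a chain; `M i` is `M⁽ⁱ⁾`, and only `1 ≤ i ≤ d` is relevant. -/
abbrev ChainMatrices {n : ℕ} (σ : ChainShape n) : Type :=
  (i : ℕ) → Matrix (σ.vertices i) (σ.vertices i) ℝ

/-- A vertex sparsifier chain of the SDDM matrix `A`. The bound `s` on the size of the last
matrix makes `size O(1)` explicit. -/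
structure IsVertexSparsifierChain {n : ℕ} (s : ℕ) (A : Matrix (Fin n) (Fin n) ℝ)
    (σ : ChainShape n) (M : ChainMatrices σ) : Prop where
  sddm_input : IsSDDM A
  one_le_d : 1 ≤ σ.d
  four_le_α : ∀ i, 1 ≤ i → i < σ.d → 4 ≤ σ.α i
  ε_pos : ∀ i < σ.d, 0 < σ.ε i
  ε_le : ∀ i < σ.d, σ.ε i ≤ 1 / 2
  sddm : ∀ i, 1 ≤ i → i ≤ σ.d → IsSDDM (M i)
  F_subset : ∀ i, 1 ≤ i → i < σ.d → σ.F i ⊆ σ.vertices i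
  approx_input : Approx (σ.ε 0) ((M 1).submatrix (fun v => ⟨v, mem_univ v⟩)
    (fun v => ⟨v, mem_univ v⟩)) A
  approx_schur : ∀ i, i + 1 < σ.d →
    Approx (σ.ε (i + 1)) (M (i + 2)) (schur (M (i + 1)) (σ.F (i + 1)))
  stronglyDD : ∀ i, 1 ≤ i → i < σ.d → IsStronglyDD (σ.α i) (blockFF (M i) (σ.F i))
  size_last : #(σ.vertices σ.d) ≤ s

/-- The work `∑_{i=1}^{d-1} mᵢ log_{αᵢ} εᵢ⁻¹` of a chain. -/
def chainWork {n : ℕ} (σ : ChainShape n) (M : ChainMatrices σ) : ℝ :=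
  ∑ i ∈ Ico 1 σ.d, (nnz (M i) : ℝ) * Real.logb (σ.α i) (σ.ε i)⁻¹

/-- The depth `∑_{i=1}^{d-1} (log n) log_{αᵢ} εᵢ⁻¹` of a chain. -/
def chainDepth {n : ℕ} (σ : ChainShape n) : ℝ :=
  ∑ i ∈ Ico 1 σ.d, Real.log n * Real.logb (σ.α i) (σ.ε i)⁻¹

/-- An `η`-vertex sparsifier chain of `A` of depth `D` and work `W`. -/
structure IsVertexSparsifierChainWith {n : ℕ} (η D W : ℝ) (s : ℕ)
    (A : Matrix (Fin n) (Fin n) ℝ) (σ : ChainShape n) (M : ChainMatrices σ) : Prop where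
  chain : IsVertexSparsifierChain s A σ M
  error : 2 * ∑ i ∈ range σ.d, σ.ε i ≤ η
  work : chainWork σ M ≤ W
  depth : chainDepth σ ≤ D

/-! ### Arithmetic circuits: work and depth -/

/-- The four arithmetic operations. -/
inductive ArithOp
  | add | sub | mul | div

/-- The result of an arithmetic operation. -/
def ArithOp.eval : ArithOp → ℝ → ℝ → ℝ
  | add, x, y => x + y
  | sub, x, y => x - y
  | mul, x, y => x * y
  | div, x, y => x / y

/-- An operand: an input, a rational constant, or the result of one of the first `k` gates. -/
inductive Operand (I : Type) (k : ℕ)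
  | input (i : I)
  | const (q : ℚ)
  | gate (j : Fin k)

/-- The value of an operand, given the inputs and the results of the first `k` gates. -/
def Operand.eval {I : Type} {k : ℕ} (x : I → ℝ) (g : Fin k → ℝ) : Operand I k → ℝ
  | input i => x i
  | const q => q
  | gate j => g j

/-- The depth of an operand, given the depths of the first `k` gates. -/
def Operand.depth {I : Type} {k : ℕ} (g : Fin k → ℕ) : Operand I k → ℕ
  | input _ => 0
  | const _ => 0
  | gate j => g j

/-- A sequence of `k` gates with two operands each (which may be used any number of times). The
work is the number `k` of arithmetic operations. -/
inductive Gates (I : Type) : ℕ → Type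
  | nil : Gates I 0
  | snoc {k : ℕ} (c : Gates I k) (op : ArithOp) (a b : Operand I k) : Gates I (k + 1)

/-- The results of the gates on the input `x`. -/
def Gates.eval {I : Type} (x : I → ℝ) : {k : ℕ} → Gates I k → Fin k → ℝ
  | _, nil => Fin.elim0
  | _, snoc c op a b =>
      Fin.snoc (α := fun _ => ℝ) (c.eval x)
        (op.eval (a.eval x (c.eval x)) (b.eval x (c.eval x)))

/-- The depths of the gates: the length of the longest path from an input. -/
def Gates.depths {I : Type} : {k : ℕ} → Gates I k → Fin k → ℕ
  | _, nil => Fin.elim0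
  | _, snoc c _ a b =>
      Fin.snoc (α := fun _ => ℕ) c.depths (max (a.depth c.depths) (b.depth c.depths) + 1)

/-- On the input `x` no gate divides by zero. -/
def Gates.Defined {I : Type} (x : I → ℝ) : {k : ℕ} → Gates I k → Prop
  | _, nil => True
  | _, snoc c op _ b => c.Defined x ∧ (op = ArithOp.div → b.eval x (c.eval x) ≠ 0)

/-- An arithmetic circuit with inputs `I` and outputs `O`. -/
structure Circuit (I O : Type) where
  work : ℕ
  gates : Gates I work
  output : O → Operand I work

/-- The depth of a circuit: the largest depth of a gate. -/
def Circuit.depth {I O : Type} (c : Circuit I O) : ℕ :=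
  univ.sup c.gates.depths

/-- The outputs of a circuit. -/
def Circuit.eval {I O : Type} (c : Circuit I O) (x : I → ℝ) (o : O) : ℝ :=
  (c.output o).eval x (c.gates.eval x)

/-- The inputs of a solver that is given a chain: the entries of the right-hand side, of the
matrix of the system, and of the matrices of the chain. -/
inductive SolverInput {n : ℕ} (σ : ChainShape n) : Type
  | rhs (v : Fin n)
  | system (u v : Fin n)
  | chain (i : ℕ) (u v : σ.vertices i)

/-- The numerical values of the inputs. -/
def solverInput {n : ℕ} {σ : ChainShape n} (A : Matrix (Fin n) (Fin n) ℝ)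
    (M : ChainMatrices σ) (b : Fin n → ℝ) : SolverInput σ → ℝ
  | .rhs v => b v
  | .system u v => A u v
  | .chain i u v => M i u v

/-- `max(1, log x)`: the logarithm as it is meant inside an `O`-bound that is to hold for all
values of the parameters. -/
def lg (x : ℝ) : ℝ := max 1 (Real.log x)

end SparseChol

end

/-!
A good chain arises by repeating two steps. A coloring of the rows with five colors that minimizes
the weight of the monochromatic pairs has a color class `F` of at least a fifth of the rows whose
block is 4-strongly diagonally dominant. The Schur complement of `F` is again SDDM, and it is
replaced by a sparsifier with a linear number of entries, obtained by applying the barrier method of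
Batson, Spielman and Srivastava to the rank-one summands of its Laplacian decomposition. The sizes
decay geometrically, so errors proportional to `i⁻²` have bounded sum while the work, in which
`log i` multiplies the `i`-th size, stays linear.

Conversely, a chain is solved by block elimination at each level, with the strongly dominant block
inverted approximately by a few Jacobi iterations; the errors of the levels add up to a
preconditioner within a factor `e` of the matrix, and `O(log (1 / ε))` steps of iterative refinement
reach accuracy `ε`. All these operations are sums, products and divisions in an order that is
determined by the shape of the chain and the sparsity patterns. The divisors in the Jacobi
iterations are row sums of the strongly dominant blocks, and the last system, of bounded size, is
solved by Cramer's rule; positive definiteness makes all divisors nonzero.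
-/

namespace SparseChol

open Finset Matrix

/-! ### Quadratic forms -/

section QuadraticForms

variable {ι κ : Type*} [Fintype ι] [Fintype κ] {A : Matrix ι ι ℝ}

/-- The quadratic form `xᵀ A x`, in which the Loewner order and the energy norm are expressed. -/
def quadForm (A : Matrix ι ι ℝ) (x : ι → ℝ) : ℝ := x ⬝ᵥ A *ᵥ x

lemma quadForm_add (A B : Matrix ι ι ℝ) (x : ι → ℝ) :
    quadForm (A + B) x = quadForm A x + quadForm B x := by
  simp [quadForm, add_mulVec, dotProduct_add]

lemma quadForm_sub (A B : Matrix ι ι ℝ) (x : ι → ℝ) :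
    quadForm (A - B) x = quadForm A x - quadForm B x := by
  simp [quadForm, sub_mulVec, dotProduct_sub]

lemma quadForm_smul (c : ℝ) (A : Matrix ι ι ℝ) (x : ι → ℝ) :
    quadForm (c • A) x = c * quadForm A x := by
  simp [quadForm, smul_mulVec, dotProduct_smul]

lemma quadForm_zero (A : Matrix ι ι ℝ) : quadForm A 0 = 0 := by simp [quadForm]

lemma quadForm_one [DecidableEq ι] (x : ι → ℝ) : quadForm 1 x = x ⬝ᵥ x := by simp [quadForm]

lemma quadForm_sum {P : Type*} (s : Finset P) (B : P → Matrix ι ι ℝ) (x : ι → ℝ) :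
    quadForm (∑ p ∈ s, B p) x = ∑ p ∈ s, quadForm (B p) x := by
  simp [quadForm, sum_mulVec, dotProduct_sum]

lemma quadForm_transpose_mul_mul (A : Matrix ι ι ℝ) (T : Matrix ι κ ℝ) (x : κ → ℝ) :
    quadForm (Tᵀ * A * T) x = quadForm A (T *ᵥ x) := by
  simp only [quadForm, ← mulVec_mulVec]
  rw [dotProduct_mulVec, vecMul_transpose]

lemma quadForm_transpose_mul_self (T : Matrix ι κ ℝ) (x : κ → ℝ) :
    quadForm (Tᵀ * T) x = (T *ᵥ x) ⬝ᵥ (T *ᵥ x) := by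
  rw [quadForm, ← mulVec_mulVec, dotProduct_mulVec, vecMul_transpose]

lemma quadForm_mul_self (hA : A.IsSymm) (x : ι → ℝ) :
    quadForm (A * A) x = (A *ᵥ x) ⬝ᵥ (A *ᵥ x) := by
  rw [← quadForm_transpose_mul_self, hA.eq]

lemma quadForm_diagonal [DecidableEq ι] (d x : ι → ℝ) :
    quadForm (diagonal d) x = ∑ i, d i * x i ^ 2 := by
  simp only [quadForm, mulVec_diagonal, dotProduct]
  exact sum_congr rfl fun i _ => by ring

lemma quadForm_eq_sum (A : Matrix ι ι ℝ) (x : ι → ℝ) :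
    quadForm A x = ∑ i, ∑ j, A i j * (x i * x j) := by
  simp only [quadForm, mulVec, dotProduct, mul_sum]
  exact sum_congr rfl fun i _ => sum_congr rfl fun j _ => by ring

lemma quadForm_vecMulVec_self (v x : ι → ℝ) : quadForm (vecMulVec v v) x = (v ⬝ᵥ x) ^ 2 := by
  rw [quadForm, vecMulVec_mulVec, sq]
  simp [dotProduct_comm]

lemma quadForm_polarization (hA : A.IsSymm) (x y : ι → ℝ) :
    quadForm A (x + y) = quadForm A x + 2 * (x ⬝ᵥ A *ᵥ y) + quadForm A y := by
  have hswap : y ⬝ᵥ A *ᵥ x = x ⬝ᵥ A *ᵥ y := by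
    rw [dotProduct_comm, dotProduct_mulVec, ← mulVec_transpose, hA.eq]
  simp only [quadForm, mulVec_add, dotProduct_add, add_dotProduct, hswap]
  ring

lemma eq_of_quadForm_eq {B : Matrix ι ι ℝ} (hA : A.IsSymm) (hB : B.IsSymm)
    (h : ∀ x, quadForm A x = quadForm B x) : A = B := by
  classical
  ext i j
  have hpolar := h (Pi.single i 1 + Pi.single j 1)
  rw [quadForm_polarization hA, quadForm_polarization hB, h, h] at hpolar
  simp only [mulVec_single_one, single_one_dotProduct, col_apply] at hpolar
  linarith

omit [Fintype ι] in
lemma isHermitian_iff_isSymm : A.IsHermitian ↔ A.IsSymm := by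
  simp [Matrix.IsHermitian, Matrix.IsSymm, conjTranspose_eq_transpose_of_trivial]

lemma posSemidef_iff_quadForm : A.PosSemidef ↔ A.IsSymm ∧ ∀ x, 0 ≤ quadForm A x := by
  rw [posSemidef_iff_dotProduct_mulVec, isHermitian_iff_isSymm]
  simp [quadForm]

lemma posDef_iff_quadForm : A.PosDef ↔ A.IsSymm ∧ ∀ x, x ≠ 0 → 0 < quadForm A x := by
  rw [posDef_iff_dotProduct_mulVec, isHermitian_iff_isSymm]
  simp [quadForm]

omit [Fintype ι] in
lemma isSymm_of_posDef (h : A.PosDef) : A.IsSymm := isHermitian_iff_isSymm.1 h.isHermitian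

lemma quadForm_pos (h : A.PosDef) {x : ι → ℝ} (hx : x ≠ 0) : 0 < quadForm A x :=
  (posDef_iff_quadForm.1 h).2 x hx

lemma quadForm_nonneg (h : A.PosDef) (x : ι → ℝ) : 0 ≤ quadForm A x :=
  (posSemidef_iff_quadForm.1 h.posSemidef).2 x

lemma isUnit_det_of_posDef [DecidableEq ι] (h : A.PosDef) : IsUnit A.det :=
  (isUnit_iff_isUnit_det A).1 h.isUnit

lemma exists_orthogonal_diagonalization [DecidableEq ι] (hA : A.IsSymm) :
    ∃ (U : Matrix ι ι ℝ) (d : ι → ℝ), U * Uᵀ = 1 ∧ A = U * diagonal d * Uᵀ := by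
  have hA' : A.IsHermitian := isHermitian_iff_isSymm.2 hA
  refine ⟨hA'.eigenvectorUnitary, hA'.eigenvalues, ?_, ?_⟩
  · have := Unitary.coe_mul_star_self hA'.eigenvectorUnitary
    rwa [Unitary.coe_star, star_eq_conjTranspose, conjTranspose_eq_transpose_of_trivial] at this
  · have := hA'.spectral_theorem
    rwa [Unitary.conjStarAlgAut_apply, star_eq_conjTranspose,
      conjTranspose_eq_transpose_of_trivial] at this

open scoped MatrixOrder in
lemma exists_eq_transpose_mul_self [DecidableEq ι] (hA : A.PosDef) :
    ∃ R : Matrix ι ι ℝ, IsUnit R.det ∧ A = Rᵀ * R := by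
  obtain ⟨R, hR⟩ := CStarAlgebra.nonneg_iff_eq_star_mul_self.1 hA.posSemidef.nonneg
  rw [star_eq_conjTranspose, conjTranspose_eq_transpose_of_trivial] at hR
  have hdet := isUnit_det_of_posDef hA
  rw [hR, det_mul] at hdet
  exact ⟨R, isUnit_of_mul_isUnit_right hdet, hR⟩

theorem exists_simultaneous_diagonalization [DecidableEq ι] {L : Matrix ι ι ℝ}
    (hA : A.PosDef) (hL : L.IsSymm) :
    ∃ (T : Matrix ι ι ℝ) (d : ι → ℝ), IsUnit T.det ∧ A = Tᵀ * T ∧ L = Tᵀ * diagonal d * T := by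
  obtain ⟨R, hR, rfl⟩ := exists_eq_transpose_mul_self hA
  obtain ⟨U, d, hU, hUd⟩ := exists_orthogonal_diagonalization (A := R⁻¹ᵀ * L * R⁻¹) (by
    simp [Matrix.IsSymm, transpose_mul, hL.eq, Matrix.mul_assoc])
  have hRR : R⁻¹ * R = 1 := nonsing_inv_mul _ hR
  have hRRt : Rᵀ * R⁻¹ᵀ = 1 := by rw [← transpose_mul, hRR, transpose_one]
  have hUdet : IsUnit Uᵀ.det := by
    have := congrArg det hU
    rw [det_mul, det_one] at this
    exact det_transpose U ▸ IsUnit.of_mul_eq_one _ this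
  refine ⟨Uᵀ * R, d, det_mul Uᵀ R ▸ hUdet.mul hR, ?_, ?_⟩
  · rw [transpose_mul, transpose_transpose, Matrix.mul_assoc, ← Matrix.mul_assoc U, hU,
      Matrix.one_mul]
  · calc L = (Rᵀ * R⁻¹ᵀ) * L * (R⁻¹ * R) := by rw [hRR, hRRt, Matrix.one_mul, Matrix.mul_one]
      _ = Rᵀ * (R⁻¹ᵀ * L * R⁻¹) * R := by simp only [Matrix.mul_assoc]
      _ = (Uᵀ * R)ᵀ * diagonal d * (Uᵀ * R) := by
        rw [hUd]
        simp only [transpose_mul, transpose_transpose, Matrix.mul_assoc]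

end QuadraticForms

section Approximation

variable {ι κ : Type} [Fintype ι] [Fintype κ] {ε η : ℝ} {A B C : Matrix ι ι ℝ}

lemma approx_iff_quadForm (hA : A.IsSymm) (hB : B.IsSymm) :
    Approx ε A B ↔ ∀ x, quadForm A x ≤ Real.exp ε * quadForm B x ∧
      Real.exp (-ε) * quadForm B x ≤ quadForm A x := by
  have hupper : (Real.exp ε • B - A).IsSymm := (hB.smul _).sub hA
  have hlower : (A - Real.exp (-ε) • B).IsSymm := hA.sub (hB.smul _)
  simp only [Approx, posSemidef_iff_quadForm, hupper, hlower, true_and, quadForm_sub,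
    quadForm_smul, sub_nonneg, forall_and]

lemma Approx.submatrix (h : Approx ε A B) (f : κ → ι) :
    Approx ε (A.submatrix f f) (B.submatrix f f) :=
  ⟨h.1.submatrix f, h.2.submatrix f⟩

lemma Approx.trans (hAB : Approx ε A B) (hBC : Approx η B C) : Approx (ε + η) A C := by
  constructor
  · convert hAB.1.add (hBC.1.smul (Real.exp_pos ε).le) using 1
    rw [Real.exp_add, mul_smul, smul_sub]
    abel
  · convert hAB.2.add (hBC.2.smul (Real.exp_pos (-ε)).le) using 1
    rw [neg_add, Real.exp_add, mul_smul, smul_sub]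
    abel

lemma Approx.mono (hB : B.PosSemidef) (hAB : Approx ε A B) (hle : ε ≤ η) : Approx η A B := by
  constructor
  · convert hAB.1.add (hB.smul (sub_nonneg.2 (Real.exp_le_exp.2 hle))) using 1
    rw [sub_smul]
    abel
  · convert hAB.2.add (hB.smul (sub_nonneg.2 (Real.exp_le_exp.2 (neg_le_neg hle)))) using 1
    rw [sub_smul]
    abel

end Approximation

/-! ### SDDM matrices -/

section NonposOffDiagonal

variable {ι : Type*} {A : Matrix ι ι ℝ}

lemma laplacian_summand_nonneg (h : ∀ i j, i ≠ j → A i j ≤ 0) (x : ι → ℝ) (i j : ι) :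
    0 ≤ (-A i j) / 2 * (x i - x j) ^ 2 := by
  by_cases hij : i = j
  · simp [hij]
  · exact mul_nonneg (by linarith [h i j hij]) (sq_nonneg _)

variable [Fintype ι]

lemma quadForm_eq_laplacian (hA : A.IsSymm) (x : ι → ℝ) :
    quadForm A x =
      ∑ i, (∑ j, A i j) * x i ^ 2 + ∑ i, ∑ j, (-A i j) / 2 * (x i - x j) ^ 2 := by
  have hrow : ∑ i, ∑ j, A i j * x i ^ 2 = ∑ i, (∑ j, A i j) * x i ^ 2 :=
    sum_congr rfl fun i _ => by rw [sum_mul]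
  have hcol : ∑ i, ∑ j, A i j * x j ^ 2 = ∑ i, (∑ j, A i j) * x i ^ 2 := by
    rw [sum_comm, ← hrow]
    exact sum_congr rfl fun i _ => sum_congr rfl fun j _ => by rw [hA.apply]
  have hexpand : ∑ i, ∑ j, (-A i j) / 2 * (x i - x j) ^ 2 =
      ∑ i, ∑ j, A i j * (x i * x j) - (∑ i, ∑ j, A i j * x i ^ 2) / 2
        - (∑ i, ∑ j, A i j * x j ^ 2) / 2 := by
    simp only [sum_div, ← sum_sub_distrib]
    exact sum_congr rfl fun i _ => sum_congr rfl fun j _ => by ring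
  rw [hexpand, hcol, hrow, quadForm_eq_sum]
  ring

lemma sum_abs_erase_of_offDiag_nonpos [DecidableEq ι] (h : ∀ i j, i ≠ j → A i j ≤ 0) (i : ι) :
    ∑ j ∈ univ.erase i, |A i j| = A i i - ∑ j, A i j := by
  rw [← add_sum_erase univ (A i) (mem_univ i), sub_add_cancel_left, ← sum_neg_distrib]
  exact sum_congr rfl fun j hj => abs_of_nonpos (h i j (ne_of_mem_erase hj).symm)

theorem nonneg_of_mulVec_nonneg (h : A.PosDef) (hoff : ∀ i j, i ≠ j → A i j ≤ 0) {x : ι → ℝ}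
    (hx : ∀ i, 0 ≤ (A *ᵥ x) i) (i : ι) : 0 ≤ x i := by
  -- The negative part `y` of `x` satisfies `0 ≤ yᵀ A y ≤ - yᵀ A x ≤ 0`.
  set y : ι → ℝ := fun i => max (-x i) 0 with hy
  have hle : quadForm A y ≤ -(y ⬝ᵥ A *ᵥ x) := by
    simp only [quadForm, dotProduct, mulVec, mul_sum, ← sum_neg_distrib]
    refine sum_le_sum fun i _ => sum_le_sum fun j _ => ?_
    by_cases hij : i = j
    · subst hij
      simp only [hy]
      rcases le_total (-x i) 0 with hneg | hneg
      · simp [max_eq_right hneg]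
      · rw [max_eq_left hneg]; nlinarith
    · have hyi : 0 ≤ y i := le_max_right _ _
      have hyj : -x j ≤ y j := le_max_left _ _
      nlinarith [mul_nonneg hyi (sub_nonneg.2 (hoff i j hij))]
  have hnonneg : 0 ≤ y ⬝ᵥ A *ᵥ x := sum_nonneg fun i _ => mul_nonneg (le_max_right _ _) (hx i)
  have hy_zero : y = 0 := by
    by_contra hne
    linarith [quadForm_pos h hne]
  have hyi : max (-x i) 0 = 0 := congrFun hy_zero i
  linarith [le_max_left (-x i) 0]

end NonposOffDiagonal

section SDDM

variable {ι κ : Type} [Fintype ι] [DecidableEq ι] [Fintype κ] [DecidableEq κ] {A : Matrix ι ι ℝ}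

lemma IsSDDM.rowSum_nonneg (h : IsSDDM A) (i : ι) : 0 ≤ ∑ j, A i j := by
  have := h.dominant i
  rw [sum_abs_erase_of_offDiag_nonpos h.offDiag_nonpos] at this
  linarith

theorem IsSDDM.posDef (h : IsSDDM A) : A.PosDef := by
  have hpos : A.PosSemidef := by
    refine posSemidef_iff_quadForm.2 ⟨h.symm, fun x => ?_⟩
    rw [quadForm_eq_laplacian h.symm]
    exact add_nonneg (sum_nonneg fun i _ => mul_nonneg (h.rowSum_nonneg i) (sq_nonneg _))
      (sum_nonneg fun i _ => sum_nonneg fun j _ => laplacian_summand_nonneg h.offDiag_nonpos x i j)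
  exact hpos.posDef_iff_isUnit.2 ((isUnit_iff_isUnit_det A).2 h.nonsingular)

lemma isSDDM_of_posDef (h : A.PosDef) (hoff : ∀ i j, i ≠ j → A i j ≤ 0)
    (hrow : ∀ i, 0 ≤ ∑ j, A i j) : IsSDDM A where
  symm := isSymm_of_posDef h
  dominant i := by rw [sum_abs_erase_of_offDiag_nonpos hoff]; linarith [hrow i]
  offDiag_nonpos := hoff
  nonsingular := isUnit_det_of_posDef h

lemma IsSDDM.submatrix_equiv (h : IsSDDM A) (e : κ ≃ ι) : IsSDDM (A.submatrix e e) := by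
  refine isSDDM_of_posDef (h.posDef.submatrix e.injective)
    (fun i j hij => h.offDiag_nonpos _ _ (e.injective.ne hij)) fun i => ?_
  simpa only [submatrix_apply, e.sum_comp (A (e i))] using h.rowSum_nonneg (e i)

end SDDM

/-! ### Linear-size spectral sparsification by barrier functions -/

section Resolvents

variable {ι : Type*} [Fintype ι] [DecidableEq ι] {A : Matrix ι ι ℝ} {δ : ℝ}

omit [DecidableEq ι] in
lemma sq_dotProduct_mulVec_le (hA : A.PosDef) (x y : ι → ℝ) :
    (x ⬝ᵥ A *ᵥ y) ^ 2 ≤ quadForm A x * quadForm A y := by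
  classical
  obtain ⟨R, -, rfl⟩ := exists_eq_transpose_mul_self hA
  have hinner : x ⬝ᵥ (Rᵀ * R) *ᵥ y = (R *ᵥ x) ⬝ᵥ (R *ᵥ y) := by
    rw [← mulVec_mulVec, dotProduct_mulVec, vecMul_transpose]
  rw [hinner, quadForm_transpose_mul_self, quadForm_transpose_mul_self]
  simpa only [dotProduct, sq] using sum_mul_sq_le_sq_mul_sq univ (R *ᵥ x) (R *ᵥ y)

theorem inv_sub_smul_vecMulVec_self (hA : A.IsSymm) (hdet : IsUnit A.det) (v : ι → ℝ) {t : ℝ}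
    (ht : 1 - t * quadForm A⁻¹ v ≠ 0) :
    (A - t • vecMulVec v v)⁻¹ =
      A⁻¹ + (t / (1 - t * quadForm A⁻¹ v)) • vecMulVec (A⁻¹ *ᵥ v) (A⁻¹ *ᵥ v) := by
  unfold quadForm at ht ⊢
  set w := A⁻¹ *ᵥ v with hw
  have hAw : A *ᵥ w = v := by rw [hw, mulVec_mulVec, mul_nonsing_inv _ hdet, one_mulVec]
  have hvA : v ᵥ* A⁻¹ = w := by rw [hw, ← mulVec_transpose, transpose_nonsing_inv, hA.eq]
  apply inv_eq_right_inv
  rw [Matrix.mul_add, Matrix.sub_mul, Matrix.sub_mul, mul_nonsing_inv _ hdet]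
  simp only [Matrix.mul_smul, Matrix.smul_mul, mul_vecMulVec, vecMulVec_mul, hAw, hvA,
    smul_mulVec, vecMulVec_mulVec]
  ext i j
  simp only [Matrix.add_apply, Matrix.sub_apply, Matrix.smul_apply, vecMulVec_apply, smul_eq_mul,
    Pi.smul_apply, MulOpposite.smul_eq_mul_unop, MulOpposite.unop_op]
  field_simp
  ring

lemma trace_inv_sub_smul_vecMulVec_self (hA : A.PosDef) (v : ι → ℝ) {t : ℝ}
    (ht : 1 - t * quadForm A⁻¹ v ≠ 0) :
    (A - t • vecMulVec v v)⁻¹.trace =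
      A⁻¹.trace + t / (1 - t * quadForm A⁻¹ v) * quadForm (A⁻¹ * A⁻¹) v := by
  rw [inv_sub_smul_vecMulVec_self (isSymm_of_posDef hA) (isUnit_det_of_posDef hA) v ht, trace_add,
    trace_smul, trace_vecMulVec, smul_eq_mul, quadForm_mul_self (isSymm_of_posDef hA.inv)]

lemma posDef_sub_smul_vecMulVec_self (hA : A.PosDef) (v : ι → ℝ) {t : ℝ} (ht₀ : 0 ≤ t)
    (ht : t * quadForm A⁻¹ v < 1) : (A - t • vecMulVec v v).PosDef := by
  have hsymm : (vecMulVec v v).IsSymm := transpose_vecMulVec v v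
  refine posDef_iff_quadForm.2 ⟨(isSymm_of_posDef hA).sub (hsymm.smul t), fun x hx => ?_⟩
  rw [quadForm_sub, quadForm_smul, quadForm_vecMulVec_self]
  have hAv : A *ᵥ (A⁻¹ *ᵥ v) = v := by
    rw [mulVec_mulVec, mul_nonsing_inv _ (isUnit_det_of_posDef hA), one_mulVec]
  have hcauchy : (v ⬝ᵥ x) ^ 2 ≤ quadForm A x * quadForm A⁻¹ v := by
    have := sq_dotProduct_mulVec_le hA x (A⁻¹ *ᵥ v)
    rwa [hAv, quadForm, quadForm, hAv, dotProduct_comm x, dotProduct_comm _ v] at this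
  nlinarith [mul_le_mul_of_nonneg_left hcauchy ht₀, quadForm_pos hA hx]

omit [Fintype ι] in
lemma posDef_add_smul_one (hA : A.PosDef) (hδ : 0 ≤ δ) : (A + δ • 1).PosDef :=
  hA.add_posSemidef (PosSemidef.one.smul hδ)

lemma trace_inv_mul_self_pos [Nonempty ι] (hA : A.PosDef) : 0 < (A⁻¹ * A⁻¹).trace := by
  have hpos := PosDef.conjTranspose_mul_self A⁻¹ (mulVec_injective_iff_isUnit.2 hA.inv.isUnit)
  rw [hA.inv.isHermitian.eq] at hpos
  exact hpos.trace_pos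

omit [DecidableEq ι] in
lemma trace_mul_mul_nonneg {B : Matrix ι ι ℝ} (hA : A.PosDef) (hB : B.PosDef) :
    0 ≤ (A * B * A).trace := by
  have hpos := hB.posSemidef.conjTranspose_mul_mul_same A
  rw [hA.isHermitian.eq] at hpos
  exact hpos.trace_nonneg

lemma inv_sub_inv_add_smul_one (hA : A.PosDef) (hδ : 0 ≤ δ) :
    A⁻¹ - (A + δ • 1)⁻¹ = δ • (A⁻¹ * (A + δ • 1)⁻¹) ∧
      A⁻¹ - (A + δ • 1)⁻¹ = δ • ((A + δ • 1)⁻¹ * A⁻¹) := by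
  have hB := posDef_add_smul_one hA hδ
  constructor
  · rw [inv_sub_inv (iff_of_true hA.isUnit hB.isUnit)]
    simp
  · rw [← neg_sub, inv_sub_inv (iff_of_true hB.isUnit hA.isUnit)]
    simp

lemma trace_inv_sub_trace_inv_add_smul_one (hA : A.PosDef) (hδ : 0 ≤ δ) :
    δ * ((A + δ • 1)⁻¹ * (A + δ • 1)⁻¹).trace ≤ A⁻¹.trace - (A + δ • 1)⁻¹.trace ∧
      A⁻¹.trace - (A + δ • 1)⁻¹.trace ≤ δ * (A⁻¹ * A⁻¹).trace := by
  obtain ⟨hleft, hright⟩ := inv_sub_inv_add_smul_one hA hδ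
  have hB := (posDef_add_smul_one hA hδ).inv
  set B := (A + δ • 1)⁻¹
  have htrace : A⁻¹.trace - B.trace = δ * (A⁻¹ * B).trace := by
    rw [← trace_sub, hleft, trace_smul, smul_eq_mul]
  have hlower : (A⁻¹ * B).trace - (B * B).trace = δ * (B * A⁻¹ * B).trace := by
    rw [← trace_sub, ← Matrix.sub_mul, hright, Matrix.smul_mul, trace_smul, smul_eq_mul]
  have hupper : (A⁻¹ * A⁻¹).trace - (A⁻¹ * B).trace = δ * (A⁻¹ * B * A⁻¹).trace := by
    rw [← trace_sub, ← Matrix.mul_sub, hright, Matrix.mul_smul, trace_smul, smul_eq_mul,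
      Matrix.mul_assoc]
  rw [htrace]
  constructor
  · exact mul_le_mul_of_nonneg_left
      (by nlinarith [mul_nonneg hδ (trace_mul_mul_nonneg hB hA.inv)]) hδ
  · exact mul_le_mul_of_nonneg_left
      (by nlinarith [mul_nonneg hδ (trace_mul_mul_nonneg hA.inv hB)]) hδ

section OrthogonalConjugation

variable {U : Matrix ι ι ℝ} {d : ι → ℝ}

lemma posDef_mul_diagonal_mul_transpose_iff (hU : U * Uᵀ = 1) :
    (U * diagonal d * Uᵀ).PosDef ↔ ∀ i, 0 < d i := by
  have hiff := (IsUnit.of_mul_eq_one _ hU).posDef_star_right_conjugate_iff (x := diagonal d)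
  rwa [star_eq_conjTranspose, conjTranspose_eq_transpose_of_trivial, posDef_diagonal_iff] at hiff

lemma inv_mul_diagonal_mul_transpose (hU : U * Uᵀ = 1) (hd : ∀ i, d i ≠ 0) :
    (U * diagonal d * Uᵀ)⁻¹ = U * diagonal (fun i => (d i)⁻¹) * Uᵀ := by
  apply inv_eq_right_inv
  calc U * diagonal d * Uᵀ * (U * diagonal (fun i => (d i)⁻¹) * Uᵀ)
      = U * (diagonal d * (Uᵀ * U) * diagonal (fun i => (d i)⁻¹)) * Uᵀ := by
        simp only [Matrix.mul_assoc]
    _ = 1 := by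
      rw [mul_eq_one_comm.1 hU, Matrix.mul_one, diagonal_mul_diagonal]
      simp [hd, hU]

lemma trace_mul_diagonal_mul_transpose (hU : U * Uᵀ = 1) :
    (U * diagonal d * Uᵀ).trace = ∑ i, d i := by
  rw [trace_mul_comm, ← Matrix.mul_assoc, mul_eq_one_comm.1 hU, Matrix.one_mul, trace_diagonal]

end OrthogonalConjugation

theorem posDef_sub_smul_one_and_trace_inv_le (hA : A.PosDef) (hδ : 0 < δ)
    (htrace : δ * A⁻¹.trace ≤ 1 / 2) :
    (A - δ • 1).PosDef ∧ (A - δ • 1)⁻¹.trace ≤ 2 * A⁻¹.trace := by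
  obtain ⟨U, d, hU, rfl⟩ := exists_orthogonal_diagonalization (isSymm_of_posDef hA)
  have hpos := (posDef_mul_diagonal_mul_transpose_iff hU).1 hA
  rw [inv_mul_diagonal_mul_transpose hU fun i => (hpos i).ne',
    trace_mul_diagonal_mul_transpose hU] at htrace ⊢
  have htwo_le : ∀ i, 2 * δ ≤ d i := fun i => by
    have hle : δ * (d i)⁻¹ ≤ 1 / 2 := le_trans (mul_le_mul_of_nonneg_left
      (single_le_sum (f := fun i => (d i)⁻¹) (fun j _ => (inv_pos.2 (hpos j)).le) (mem_univ i))
      hδ.le) htrace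
    rw [← div_eq_mul_inv, div_le_iff₀ (hpos i)] at hle
    linarith
  have hsub_pos : ∀ i, 0 < d i - δ := fun i => by linarith [htwo_le i]
  have hsub : U * diagonal d * Uᵀ - δ • 1 = U * diagonal (fun i => d i - δ) * Uᵀ := by
    have hdiag : diagonal (fun i => d i - δ) = diagonal d - δ • (1 : Matrix ι ι ℝ) := by
      rw [smul_one_eq_diagonal, diagonal_sub]
    rw [hdiag, Matrix.mul_sub, Matrix.sub_mul, Matrix.mul_smul, Matrix.smul_mul, Matrix.mul_one,
      hU]
  rw [hsub, posDef_mul_diagonal_mul_transpose_iff hU,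
    inv_mul_diagonal_mul_transpose hU fun i => (hsub_pos i).ne',
    trace_mul_diagonal_mul_transpose hU, mul_sum]
  refine ⟨hsub_pos, sum_le_sum fun i _ => ?_⟩
  rw [← div_eq_mul_inv, inv_eq_one_div, div_le_div_iff₀ (hsub_pos i) (hpos i)]
  linarith [htwo_le i]

end Resolvents

section Barriers

variable {ι : Type*} [Fintype ι] [DecidableEq ι] {A : Matrix ι ι ℝ} {δ t : ℝ}

/-- The upper barrier function of Batson, Spielman and Srivastava: if `B = u - X` and the upper
barrier `u` has just moved by `δ`, the rank-one update `X + t v vᵀ` does not increase the upper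
potential as long as `t * upperCost δ B v < 1`. -/
noncomputable def upperCost (δ : ℝ) (B : Matrix ι ι ℝ) (v : ι → ℝ) : ℝ :=
  quadForm (B⁻¹ * B⁻¹) v / (δ * (B⁻¹ * B⁻¹).trace) + quadForm B⁻¹ v

/-- The lower barrier function of Batson, Spielman and Srivastava: if `B = X - l` and the lower
barrier `l` has just moved by `δ`, the rank-one update `X + t v vᵀ` does not increase the lower
potential as soon as `1 ≤ t * lowerCost δ B v`. -/
noncomputable def lowerCost (δ : ℝ) (B : Matrix ι ι ℝ) (v : ι → ℝ) : ℝ :=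
  quadForm (B⁻¹ * B⁻¹) v / (δ * (B⁻¹ * B⁻¹).trace) - quadForm B⁻¹ v

lemma quadForm_inv_mul_inv_nonneg (hA : A.PosDef) (v : ι → ℝ) : 0 ≤ quadForm (A⁻¹ * A⁻¹) v := by
  rw [quadForm_mul_self (isSymm_of_posDef hA.inv)]
  exact sum_nonneg fun i _ => mul_self_nonneg _

lemma upperCost_nonneg [Nonempty ι] (hA : A.PosDef) (hδ : 0 ≤ δ) (v : ι → ℝ) :
    0 ≤ upperCost δ A v :=
  add_nonneg (div_nonneg (quadForm_inv_mul_inv_nonneg hA v)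
    (mul_nonneg hδ (trace_inv_mul_self_pos hA).le)) (quadForm_nonneg hA.inv v)

lemma upper_barrier_step [Nonempty ι] (hA : A.PosDef) (hδ : 0 < δ) (v : ι → ℝ) (ht₀ : 0 < t)
    (ht : t * upperCost δ (A + δ • 1) v < 1) :
    (A + δ • 1 - t • vecMulVec v v).PosDef ∧
      (A + δ • 1 - t • vecMulVec v v)⁻¹.trace ≤ A⁻¹.trace := by
  have hshift := (trace_inv_sub_trace_inv_add_smul_one hA hδ.le).1
  have hB := posDef_add_smul_one hA hδ.le
  unfold upperCost at ht
  set B := A + δ • 1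
  have hcost : 0 < δ * (B⁻¹ * B⁻¹).trace := mul_pos hδ (trace_inv_mul_self_pos hB)
  have hq := quadForm_inv_mul_inv_nonneg hB v
  have hc : t * quadForm B⁻¹ v < 1 := by nlinarith [mul_nonneg ht₀.le (div_nonneg hq hcost.le)]
  have hgain : t / (1 - t * quadForm B⁻¹ v) * quadForm (B⁻¹ * B⁻¹) v ≤
      δ * (B⁻¹ * B⁻¹).trace := by
    rw [div_mul_eq_mul_div, div_le_iff₀ (by linarith)]
    have : t * (quadForm (B⁻¹ * B⁻¹) v / (δ * (B⁻¹ * B⁻¹).trace)) ≤ 1 - t * quadForm B⁻¹ v := by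
      linarith
    rw [← mul_div_assoc, div_le_iff₀ hcost] at this
    linarith
  refine ⟨posDef_sub_smul_vecMulVec_self hB v ht₀.le hc, ?_⟩
  rw [trace_inv_sub_smul_vecMulVec_self hB v (by linarith)]
  linarith

lemma lower_barrier_step [Nonempty ι] (hA : A.PosDef) (hδ : 0 < δ) (v : ι → ℝ) (ht₀ : 0 < t)
    (ht : 1 ≤ t * lowerCost δ A v) :
    (A + t • vecMulVec v v).PosDef ∧ (A + t • vecMulVec v v)⁻¹.trace ≤ (A + δ • 1)⁻¹.trace := by
  have hshift := (trace_inv_sub_trace_inv_add_smul_one hA hδ.le).2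
  have hcost : 0 < δ * (A⁻¹ * A⁻¹).trace := mul_pos hδ (trace_inv_mul_self_pos hA)
  have hden : 0 < 1 - -t * quadForm A⁻¹ v := by
    nlinarith [mul_nonneg ht₀.le (quadForm_nonneg hA.inv v)]
  have hgain : δ * (A⁻¹ * A⁻¹).trace ≤
      t / (1 - -t * quadForm A⁻¹ v) * quadForm (A⁻¹ * A⁻¹) v := by
    rw [div_mul_eq_mul_div, le_div_iff₀ hden]
    unfold lowerCost at ht
    have : 1 + t * quadForm A⁻¹ v ≤
        t * (quadForm (A⁻¹ * A⁻¹) v / (δ * (A⁻¹ * A⁻¹).trace)) := by linarith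
    rw [← mul_div_assoc, le_div_iff₀ hcost] at this
    linarith
  refine ⟨hA.add_posSemidef ((posSemidef_vecMulVec_self_star v).smul ht₀.le), ?_⟩
  rw [← sub_neg_eq_add A, ← neg_smul, trace_inv_sub_smul_vecMulVec_self hA v hden.ne', neg_div,
    neg_mul]
  linarith

/-- `A` lies strictly between the barriers `l` and `u`, and both barrier potentials, the traces of
the resolvents, are at most `e`. -/
structure IsBetweenBarriers (A : Matrix ι ι ℝ) (l u e : ℝ) : Prop where
  upper : (u • 1 - A).PosDef
  lower : (A - l • 1).PosDef
  upper_trace : (u • 1 - A)⁻¹.trace ≤ e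
  lower_trace : (A - l • 1)⁻¹.trace ≤ e

lemma isBetweenBarriers_zero [Nonempty ι] {e : ℝ} (he : 0 < e) :
    IsBetweenBarriers (0 : Matrix ι ι ℝ) (-(Fintype.card ι / e)) (Fintype.card ι / e) e := by
  have hn : (0 : ℝ) < Fintype.card ι := by exact_mod_cast Fintype.card_pos
  set u : ℝ := Fintype.card ι / e with hu_def
  have hu : 0 < u := by positivity
  have hpos : (u • (1 : Matrix ι ι ℝ)).PosDef := PosDef.one.smul hu
  have htrace : (u • (1 : Matrix ι ι ℝ))⁻¹.trace ≤ e := by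
    have hinv : (u • (1 : Matrix ι ι ℝ))⁻¹ = u⁻¹ • (1 : Matrix ι ι ℝ) := inv_eq_right_inv (by
      rw [Matrix.smul_mul, Matrix.one_mul, smul_smul, mul_inv_cancel₀ hu.ne', one_smul])
    rw [hinv, trace_smul, trace_one, smul_eq_mul, hu_def, inv_div, div_mul_cancel₀ _ hn.ne']
  have hlower : (0 : Matrix ι ι ℝ) - (-u) • 1 = u • 1 := by simp
  exact ⟨by rwa [sub_zero], by rwa [hlower], by rwa [sub_zero], by rwa [hlower]⟩

section Isotropic

variable {P : Type*} [Fintype P] {v : P → ι → ℝ} {l u θ : ℝ}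

lemma sum_quadForm_of_isotropic (hv : ∑ p, vecMulVec (v p) (v p) = 1) (B : Matrix ι ι ℝ) :
    ∑ p, quadForm B (v p) = B.trace := by
  calc ∑ p, quadForm B (v p) = (B * ∑ p, vecMulVec (v p) (v p)).trace := by
        rw [Matrix.mul_sum, trace_sum]
        exact sum_congr rfl fun p _ => by
          rw [mul_vecMulVec, trace_vecMulVec, dotProduct_comm, quadForm]
    _ = B.trace := by rw [hv, Matrix.mul_one]

lemma sum_upperCost_of_isotropic [Nonempty ι] (hv : ∑ p, vecMulVec (v p) (v p) = 1)
    (hA : A.PosDef) : ∑ p, upperCost δ A (v p) = 1 / δ + A⁻¹.trace := by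
  simp only [upperCost, sum_add_distrib, ← sum_div, sum_quadForm_of_isotropic hv]
  rw [div_mul_cancel_right₀ (trace_inv_mul_self_pos hA).ne', one_div]

lemma sum_lowerCost_of_isotropic [Nonempty ι] (hv : ∑ p, vecMulVec (v p) (v p) = 1)
    (hA : A.PosDef) : ∑ p, lowerCost δ A (v p) = 1 / δ - A⁻¹.trace := by
  simp only [lowerCost, sum_sub_distrib, ← sum_div, sum_quadForm_of_isotropic hv]
  rw [div_mul_cancel_right₀ (trace_inv_mul_self_pos hA).ne', one_div]

lemma exists_upperCost_lt_lowerCost [Nonempty ι] (hv : ∑ p, vecMulVec (v p) (v p) = 1)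
    {L R : Matrix ι ι ℝ} (hL : L.PosDef) (hR : R.PosDef) {δ' : ℝ}
    (h : 1 / δ + L⁻¹.trace < 1 / δ' - R⁻¹.trace) :
    ∃ p, upperCost δ L (v p) < lowerCost δ' R (v p) := by
  rw [← sum_upperCost_of_isotropic hv hL, ← sum_lowerCost_of_isotropic hv hR] at h
  obtain ⟨p, -, hp⟩ := exists_lt_of_sum_lt h
  exact ⟨p, hp⟩

lemma IsBetweenBarriers.exists_step [Nonempty ι] (hv : ∑ p, vecMulVec (v p) (v p) = 1)
    (hθ₀ : 0 < θ) (hθ₁ : θ ≤ 1) (h : IsBetweenBarriers A l u (θ / 8)) :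
    ∃ (p : P) (t : ℝ), 0 < t ∧
      IsBetweenBarriers (A + t • vecMulVec (v p) (v p)) (l + 1) (u + (1 + θ)) (θ / 8) := by
  have hδ : 0 < 1 + θ := by linarith
  obtain ⟨hR, hRtrace⟩ := posDef_sub_smul_one_and_trace_inv_le h.lower one_pos
    (by linarith [h.lower_trace])
  have hL := posDef_add_smul_one h.upper hδ.le
  have hLtrace : (u • 1 - A + (1 + θ) • 1)⁻¹.trace ≤ (u • 1 - A)⁻¹.trace := by
    have := (trace_inv_sub_trace_inv_add_smul_one h.upper hδ.le).1
    nlinarith [mul_pos hδ (trace_inv_mul_self_pos hL)]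
  obtain ⟨p, hp⟩ : ∃ p, upperCost (1 + θ) (u • 1 - A + (1 + θ) • 1) (v p) <
      lowerCost 1 (A - l • 1 - (1 : ℝ) • 1) (v p) := by
    refine exists_upperCost_lt_lowerCost hv hL hR ?_
    have hgap : 1 / (1 + θ) + θ / 8 < 1 - θ / 4 := by
      rw [div_add' _ _ _ hδ.ne', div_lt_iff₀ hδ]
      nlinarith
    linarith [h.lower_trace, h.upper_trace]
  set g := lowerCost 1 (A - l • 1 - (1 : ℝ) • 1) (v p)
  have hg : 0 < g := (upperCost_nonneg hL hδ.le _).trans_lt hp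
  have hupper := upper_barrier_step h.upper hδ (v p) (inv_pos.2 hg) ((inv_mul_lt_one₀ hg).2 hp)
  have hlower := lower_barrier_step hR one_pos (v p) (inv_pos.2 hg) (inv_mul_cancel₀ hg.ne').ge
  have hupper_eq : (u + (1 + θ)) • (1 : Matrix ι ι ℝ) - (A + g⁻¹ • vecMulVec (v p) (v p)) =
      u • 1 - A + (1 + θ) • 1 - g⁻¹ • vecMulVec (v p) (v p) := by rw [add_smul]; abel
  have hlower_eq : A + g⁻¹ • vecMulVec (v p) (v p) - (l + 1) • 1 =
      A - l • 1 - (1 : ℝ) • 1 + g⁻¹ • vecMulVec (v p) (v p) := by rw [add_smul]; abel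
  rw [sub_add_cancel] at hlower
  exact ⟨p, g⁻¹, inv_pos.2 hg, hupper_eq ▸ hupper.1, hlower_eq ▸ hlower.1,
    hupper_eq ▸ hupper.2.trans h.upper_trace, hlower_eq ▸ hlower.2.trans h.lower_trace⟩

lemma IsBetweenBarriers.exists_iterate [Nonempty ι] (hv : ∑ p, vecMulVec (v p) (v p) = 1)
    (hθ₀ : 0 < θ) (hθ₁ : θ ≤ 1) (h : IsBetweenBarriers (0 : Matrix ι ι ℝ) l u (θ / 8)) (k : ℕ) :
    ∃ s : P → ℝ, (∀ p, 0 ≤ s p) ∧ #{p | s p ≠ 0} ≤ k ∧ IsBetweenBarriers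
      (∑ p, s p • vecMulVec (v p) (v p)) (l + k) (u + k * (1 + θ)) (θ / 8) := by
  classical
  induction k with
  | zero => exact ⟨0, fun _ => le_rfl, by simp, by simpa using h⟩
  | succ k ih =>
    obtain ⟨s, hs, hcard, hbetween⟩ := ih
    obtain ⟨p, t, ht, hstep⟩ := hbetween.exists_step hv hθ₀ hθ₁
    refine ⟨s + Pi.single p t,
      fun q => add_nonneg (hs q) (Pi.single_nonneg (α := fun _ => ℝ).2 ht.le q), ?_, ?_⟩
    · have hsubset : ({q | (s + Pi.single p t : P → ℝ) q ≠ 0} : Finset P) ⊆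
          insert p ({q | s q ≠ 0} : Finset P) := fun q hq => by
        by_cases hqp : q = p
        · simp [hqp]
        · simpa [hqp] using hq
      exact (card_le_card hsubset).trans ((card_insert_le _ _).trans (by omega))
    · have hsum : ∑ q, (s + Pi.single p t : P → ℝ) q • vecMulVec (v q) (v q) =
          ∑ q, s q • vecMulVec (v q) (v q) + t • vecMulVec (v p) (v p) := by
        simp [add_smul, sum_add_distrib, Pi.single_apply, ite_smul]
      rw [hsum]
      convert hstep using 1 <;> push_cast <;> ring

theorem exists_sparse_weights_of_isotropic [Nonempty ι] (hv : ∑ p, vecMulVec (v p) (v p) = 1)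
    {N : ℕ} (hN : 0 < N) :
    ∃ s : P → ℝ, (∀ p, 0 ≤ s p) ∧ #{p | s p ≠ 0} ≤ 16 * Fintype.card ι * N ^ 2 ∧
      ∀ x : ι → ℝ, x ⬝ᵥ x ≤ ∑ p, s p * (v p ⬝ᵥ x) ^ 2 ∧
        ∑ p, s p * (v p ⬝ᵥ x) ^ 2 ≤ (1 + 4 / N) * (x ⬝ᵥ x) := by
  have hN₁ : (1 : ℝ) ≤ N := by exact_mod_cast hN
  have hn : (0 : ℝ) < Fintype.card ι := by exact_mod_cast Fintype.card_pos
  obtain ⟨s, hs, hcard, hbetween⟩ :=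
    (isBetweenBarriers_zero (ι := ι) (e := 1 / N / 8) (by positivity)).exists_iterate hv
      (by positivity) ((div_le_one (by linarith)).2 hN₁) (16 * Fintype.card ι * N ^ 2)
  set n : ℝ := (Fintype.card ι : ℝ) with hn_def
  -- The barriers start at `∓ 8 n N`; after `16 n N ^ 2` steps their ratio is at most `1 + 4 / N`.
  set l := 8 * n * N * (2 * N - 1) with hl_def
  have hl : -(n / (1 / N / 8)) + (16 * Fintype.card ι * N ^ 2 : ℕ) = l := by
    push_cast; rw [hl_def, ← hn_def]; field_simp; ring
  have hu : n / (1 / N / 8) + (16 * Fintype.card ι * N ^ 2 : ℕ) * (1 + 1 / N) =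
      8 * n * N * (2 * N + 3) := by
    push_cast; rw [← hn_def]; field_simp; ring
  have hl_pos : 0 < l := mul_pos (by positivity) (by linarith)
  have hratio : 8 * n * N * (2 * N + 3) ≤ (1 + 4 / N) * l := by
    have : (1 + 4 / N) * l = 8 * n * ((N + 4) * (2 * N - 1)) := by rw [hl_def]; field_simp
    rw [this, mul_assoc (8 * n)]
    exact mul_le_mul_of_nonneg_left (by nlinarith) (by positivity)
  rw [hl, hu] at hbetween
  refine ⟨fun p => l⁻¹ * s p, fun p => mul_nonneg (inv_pos.2 hl_pos).le (hs p), ?_, fun x => ?_⟩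
  · simpa [hl_pos.ne'] using hcard
  · have hlower := quadForm_nonneg hbetween.lower x
    have hupper := quadForm_nonneg hbetween.upper x
    simp only [quadForm_sub, quadForm_sum, quadForm_smul, quadForm_vecMulVec_self,
      quadForm_one] at hlower hupper
    have hxx : 0 ≤ x ⬝ᵥ x := sum_nonneg fun i _ => mul_self_nonneg _
    simp only [mul_assoc, ← mul_sum]
    rw [inv_mul_eq_div, le_div_iff₀ hl_pos, div_le_iff₀ hl_pos]
    exact ⟨by linarith, by nlinarith [mul_le_mul_of_nonneg_right hratio hxx]⟩

end Isotropic

omit [DecidableEq ι] in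
theorem exists_sparse_weights {P : Type*} [Fintype P] (hA : A.PosDef) {a : P → ι → ℝ}
    (ha : ∀ x, quadForm A x = ∑ p, (a p ⬝ᵥ x) ^ 2) {N : ℕ} (hN : 0 < N) :
    ∃ s : P → ℝ, (∀ p, 0 ≤ s p) ∧ #{p | s p ≠ 0} ≤ 16 * Fintype.card ι * N ^ 2 ∧
      ∀ x : ι → ℝ, quadForm A x ≤ ∑ p, s p * (a p ⬝ᵥ x) ^ 2 ∧
        ∑ p, s p * (a p ⬝ᵥ x) ^ 2 ≤ (1 + 4 / N) * quadForm A x := by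
  classical
  rcases isEmpty_or_nonempty ι with hι | hι
  · exact ⟨0, by simp, by simp, fun x => by simp [quadForm]⟩
  obtain ⟨T, hT, rfl⟩ := exists_eq_transpose_mul_self hA
  -- In the coordinates `y = T x` the squares decompose the identity.
  have hva : ∀ p x, (a p ᵥ* T⁻¹) ⬝ᵥ (T *ᵥ x) = a p ⬝ᵥ x := fun p x => by
    rw [← dotProduct_mulVec, mulVec_mulVec, nonsing_inv_mul _ hT, one_mulVec]
  have hisotropic : ∑ p, vecMulVec (a p ᵥ* T⁻¹) (a p ᵥ* T⁻¹) = 1 := by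
    refine eq_of_quadForm_eq ?_ isSymm_one fun y => ?_
    · simp only [Matrix.IsSymm, transpose_sum, transpose_vecMulVec]
    · obtain ⟨x, rfl⟩ : ∃ x, T *ᵥ x = y :=
        ⟨T⁻¹ *ᵥ y, by rw [mulVec_mulVec, mul_nonsing_inv _ hT, one_mulVec]⟩
      simp only [quadForm_sum, quadForm_vecMulVec_self, hva, ← ha, quadForm_one,
        quadForm_transpose_mul_self]
  obtain ⟨s, hs, hcard, hbound⟩ := exists_sparse_weights_of_isotropic hisotropic hN
  refine ⟨s, hs, hcard, fun x => ?_⟩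
  simpa only [hva, ← quadForm_transpose_mul_self] using hbound (T *ᵥ x)

end Barriers

section Reweighting

variable {ι : Type*} [Fintype ι] [DecidableEq ι] {A : Matrix ι ι ℝ} (s : ι × ι → ℝ)

/-- The matrix obtained from `A` by scaling the sum of row `i` by `s (i, i)`, and the off-diagonal
entry at `(i, j)` by the mean of `s (i, j)` and `s (j, i)`, which keeps a symmetric `A`
symmetric. -/
noncomputable def reweight (A : Matrix ι ι ℝ) (s : ι × ι → ℝ) : Matrix ι ι ℝ := fun i j =>
  if i = j then s (i, i) * ∑ k, A i k - ∑ k ∈ univ.erase i, A i k * ((s (i, k) + s (k, i)) / 2)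
  else A i j * ((s (i, j) + s (j, i)) / 2)

variable {s} in
lemma reweight_apply_of_ne {i j : ι} (hij : i ≠ j) :
    reweight A s i j = A i j * ((s (i, j) + s (j, i)) / 2) :=
  if_neg hij

lemma reweight_isSymm (hA : A.IsSymm) : (reweight A s).IsSymm := by
  ext i j
  by_cases hij : i = j
  · rw [hij, transpose_apply]
  · rw [transpose_apply, reweight_apply_of_ne hij, reweight_apply_of_ne (Ne.symm hij),
      hA.apply i j, add_comm]

lemma reweight_rowSum (i : ι) : ∑ j, reweight A s i j = s (i, i) * ∑ k, A i k := by
  have hoff : ∑ j ∈ univ.erase i, reweight A s i j =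
      ∑ k ∈ univ.erase i, A i k * ((s (i, k) + s (k, i)) / 2) :=
    sum_congr rfl fun j hj => reweight_apply_of_ne (ne_of_mem_erase hj).symm
  rw [← add_sum_erase univ _ (mem_univ i), hoff]
  simp [reweight]

lemma reweight_one : reweight A 1 = A := by
  ext i j
  by_cases hij : i = j
  · subst hij
    simp only [reweight, if_true, Pi.one_apply, one_mul]
    rw [← add_sum_erase univ _ (mem_univ i)]
    simp
  · simp [reweight_apply_of_ne hij]

lemma quadForm_reweight (hA : A.IsSymm) (x : ι → ℝ) :
    quadForm (reweight A s) x = ∑ i, s (i, i) * (∑ k, A i k) * x i ^ 2 +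
      ∑ i, ∑ j, s (i, j) * ((-A i j) / 2 * (x i - x j) ^ 2) := by
  rw [quadForm_eq_laplacian (reweight_isSymm s hA)]
  simp only [reweight_rowSum]
  congr 1
  have hmean : ∀ i j, -reweight A s i j / 2 * (x i - x j) ^ 2 =
      s (i, j) * ((-A i j) / 2 * (x i - x j) ^ 2) / 2 +
        s (j, i) * ((-A j i) / 2 * (x j - x i) ^ 2) / 2 := fun i j => by
    by_cases hij : i = j
    · simp [hij]
    · rw [hA.apply i j, reweight_apply_of_ne hij]
      ring
  simp only [hmean, sum_add_distrib]
  rw [sum_comm (f := fun i j => s (j, i) * ((-A j i) / 2 * (x j - x i) ^ 2) / 2)]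
  simp only [← sum_div]
  ring

/-- The rank-one summands of `A` in its Laplacian decomposition: the square of the vector indexed
by `(i, i)` is the row sum times `(x i) ^ 2`, that of the vector indexed by `(i, j)` is half of
the edge term `- A i j * (x i - x j) ^ 2`. -/
noncomputable def laplacianVector (A : Matrix ι ι ℝ) (p : ι × ι) : ι → ℝ :=
  if p.1 = p.2 then √(∑ k, A p.1 k) • Pi.single p.1 1
  else √((-A p.1 p.2) / 2) • (Pi.single p.1 1 - Pi.single p.2 1)

lemma sum_mul_sq_laplacianVector (hA : A.IsSymm) (hoff : ∀ i j, i ≠ j → A i j ≤ 0)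
    (hrow : ∀ i, 0 ≤ ∑ j, A i j) (x : ι → ℝ) :
    ∑ p, s p * (laplacianVector A p ⬝ᵥ x) ^ 2 = quadForm (reweight A s) x := by
  have hdiag : ∀ i, (laplacianVector A (i, i) ⬝ᵥ x) ^ 2 = (∑ k, A i k) * x i ^ 2 := fun i => by
    simp [laplacianVector, mul_pow, Real.sq_sqrt (hrow i)]
  have hedge : ∀ i j, i ≠ j →
      (laplacianVector A (i, j) ⬝ᵥ x) ^ 2 = -A i j / 2 * (x i - x j) ^ 2 := fun i j hij => by
    have hnonneg : 0 ≤ -A i j / 2 := by linarith [hoff i j hij]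
    simp only [laplacianVector, hij, if_false, smul_dotProduct, sub_dotProduct, single_dotProduct,
      one_mul, smul_eq_mul, mul_pow, Real.sq_sqrt hnonneg]
  rw [quadForm_reweight s hA, Fintype.sum_prod_type, ← sum_add_distrib]
  refine sum_congr rfl fun i _ => ?_
  rw [← add_sum_erase univ _ (mem_univ i),
    ← add_sum_erase univ (fun j => s (i, j) * (-A i j / 2 * (x i - x j) ^ 2)) (mem_univ i),
    hdiag, sub_self, zero_pow two_ne_zero, mul_zero, mul_zero, zero_add, mul_assoc]
  exact congrArg _ (sum_congr rfl fun j hj => by rw [hedge i j (ne_of_mem_erase hj).symm])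

end Reweighting

section Sparsification

variable {ι : Type} [Fintype ι] [DecidableEq ι] {A : Matrix ι ι ℝ}

lemma nnz_reweight_le (A : Matrix ι ι ℝ) (s : ι × ι → ℝ) :
    nnz (reweight A s) ≤ Fintype.card ι + 2 * #{p | s p ≠ 0} := by
  set S : Finset (ι × ι) := {p | s p ≠ 0}
  have hsubset : ({p : ι × ι | reweight A s p.1 p.2 ≠ 0} : Finset _) ⊆
      univ.image (fun i => (i, i)) ∪ (S ∪ S.image Prod.swap) := by
    rintro ⟨i, j⟩ hp
    by_cases hij : i = j
    · simp [hij]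
    · have hne : s (i, j) ≠ 0 ∨ s (j, i) ≠ 0 := by
        by_contra! hzero
        simp [reweight_apply_of_ne hij, hzero] at hp
      simpa [hij, S] using hne
  have hdiag : #(univ.image fun i : ι => (i, i)) ≤ Fintype.card ι := card_image_le
  have hswap : #(S.image Prod.swap) ≤ #S := card_image_le
  have hunion := card_union_le (univ.image fun i : ι => (i, i)) (S ∪ S.image Prod.swap)
  have hunion' := card_union_le S (S.image Prod.swap)
  have hcard : nnz (reweight A s) ≤ _ := card_le_card hsubset
  omega

lemma IsSDDM.reweight {s : ι × ι → ℝ} (hA : IsSDDM A) (hs : ∀ p, 0 ≤ s p)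
    (hpos : (reweight A s).PosDef) : IsSDDM (reweight A s) := by
  refine isSDDM_of_posDef hpos (fun i j hij => ?_) fun i => ?_
  · rw [reweight_apply_of_ne hij]
    exact mul_nonpos_of_nonpos_of_nonneg (hA.offDiag_nonpos i j hij)
      (div_nonneg (add_nonneg (hs _) (hs _)) two_pos.le)
  · rw [reweight_rowSum]
    exact mul_nonneg (hs _) (hA.rowSum_nonneg i)

theorem IsSDDM.exists_sparsifier (hA : IsSDDM A) {N : ℕ} (hN : 0 < N) :
    ∃ B : Matrix ι ι ℝ, IsSDDM B ∧
      (∀ x, quadForm A x ≤ quadForm B x ∧ quadForm B x ≤ (1 + 4 / N) * quadForm A x) ∧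
      nnz B ≤ Fintype.card ι + 2 * (16 * Fintype.card ι * N ^ 2) := by
  have hsum := fun s => sum_mul_sq_laplacianVector s hA.symm hA.offDiag_nonpos hA.rowSum_nonneg
  obtain ⟨s, hs, hcard, hbound⟩ := exists_sparse_weights hA.posDef (a := laplacianVector A)
    (fun x => by simpa [reweight_one] using (hsum 1 x).symm) hN
  simp only [hsum] at hbound
  have hpos : (SparseChol.reweight A s).PosDef := posDef_iff_quadForm.2
    ⟨reweight_isSymm s hA.symm, fun x hx => (quadForm_pos hA.posDef hx).trans_le (hbound x).1⟩
  exact ⟨_, hA.reweight hs hpos, hbound, (nnz_reweight_le A s).trans (by omega)⟩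

lemma ceil_four_div_le {ε : ℝ} (hε₀ : 0 < ε) (hε₁ : ε ≤ 1) : (⌈4 / ε⌉₊ : ℝ) ≤ 5 / ε := by
  have hceil := (Nat.ceil_lt_add_one (a := 4 / ε) (by positivity)).le
  have hone : 1 ≤ 1 / ε := by rwa [one_le_div hε₀]
  have hsum : 5 / ε = 4 / ε + 1 / ε := by ring
  linarith

theorem IsSDDM.exists_sparse_approx (hA : IsSDDM A) {ε : ℝ} (hε₀ : 0 < ε) (hε₁ : ε ≤ 1) :
    ∃ B : Matrix ι ι ℝ, IsSDDM B ∧ Approx ε B A ∧ (nnz B : ℝ) ≤ 801 * Fintype.card ι / ε ^ 2 := by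
  have hN : 0 < ⌈4 / ε⌉₊ := Nat.ceil_pos.2 (by positivity)
  obtain ⟨B, hB, hform, hnnz⟩ := hA.exists_sparsifier hN
  refine ⟨B, hB, (approx_iff_quadForm hB.symm hA.symm).2 fun x => ?_, ?_⟩
  · have hx := quadForm_nonneg hA.posDef x
    have hratio : (4 : ℝ) / ⌈4 / ε⌉₊ ≤ ε := by
      rw [div_le_iff₀ (Nat.cast_pos.2 hN), ← div_le_iff₀' hε₀]
      exact Nat.le_ceil _
    exact ⟨(hform x).2.trans (mul_le_mul_of_nonneg_right
        (by linarith [Real.add_one_le_exp ε]) hx),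
      (mul_le_of_le_one_left hx (Real.exp_le_one_iff.2 (by linarith))).trans (hform x).1⟩
  · have hsq : (⌈4 / ε⌉₊ : ℝ) ^ 2 ≤ (5 / ε) ^ 2 :=
      pow_le_pow_left₀ (Nat.cast_nonneg _) (ceil_four_div_le hε₀ hε₁) 2
    have hone : (1 : ℝ) ≤ 1 / ε ^ 2 := by
      rw [one_le_div (by positivity)]
      exact pow_le_one₀ hε₀.le hε₁
    calc (nnz B : ℝ)
        ≤ Fintype.card ι + 2 * (16 * Fintype.card ι * (⌈4 / ε⌉₊ : ℝ) ^ 2) := by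
          exact_mod_cast hnnz
      _ ≤ Fintype.card ι * (1 / ε ^ 2) + 2 * (16 * Fintype.card ι * (5 / ε) ^ 2) := by
          gcongr
          exact le_mul_of_one_le_right (Nat.cast_nonneg _) hone
      _ = 801 * Fintype.card ι / ε ^ 2 := by ring

end Sparsification

/-! ### Large strongly diagonally dominant blocks -/

section Coloring

variable {ι : Type*} [Fintype ι] [DecidableEq ι]

lemma sum_sum_erase_eq (h : ι → ι → ℝ) (i : ι) :
    ∑ a, ∑ b ∈ univ.erase a, h a b = ∑ b ∈ univ.erase i, h i b + ∑ a ∈ univ.erase i, h a i +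
      ∑ a ∈ univ.erase i, ∑ b ∈ (univ.erase a).erase i, h a b := by
  rw [← add_sum_erase univ (fun a => ∑ b ∈ univ.erase a, h a b) (mem_univ i), add_assoc,
    add_right_inj, ← sum_add_distrib]
  exact sum_congr rfl fun a ha =>
    (add_sum_erase (univ.erase a) (h a) (mem_erase.2 ⟨(ne_of_mem_erase ha).symm, mem_univ i⟩)).symm

theorem exists_coloring {C : Type*} [Fintype C] [DecidableEq C] [Nonempty C] {w : ι → ι → ℝ}
    (hw : ∀ i j, w i j = w j i) : ∃ f : ι → C, ∀ i,
      Fintype.card C * ∑ j ∈ univ.erase i, (if f i = f j then w i j else 0) ≤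
        ∑ j ∈ univ.erase i, w i j := by
  -- Minimize the total weight of the monochromatic pairs: recolouring `i` does not decrease it.
  set mono : (ι → C) → ι → ι → ℝ := fun f i j => if f i = f j then w i j else 0 with hmono
  obtain ⟨f, hf⟩ := Finite.exists_min fun f : ι → C => ∑ i, ∑ j ∈ univ.erase i, mono f i j
  refine ⟨f, fun i => ?_⟩
  have hsplit : ∀ g : ι → C, ∑ a, ∑ b ∈ univ.erase a, mono g a b =
      2 * ∑ b ∈ univ.erase i, mono g i b +
        ∑ a ∈ univ.erase i, ∑ b ∈ (univ.erase a).erase i, mono g a b := fun g => by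
    have hcomm : ∀ a, mono g a i = mono g i a := fun a => by simp only [hmono, eq_comm, hw a i]
    simp only [sum_sum_erase_eq _ i, hcomm, two_mul]
  have hmin : ∀ c, ∑ j ∈ univ.erase i, mono f i j ≤
      ∑ j ∈ univ.erase i, if c = f j then w i j else 0 := fun c => by
    have hrecolor := hf (Function.update f i c)
    have hother : ∑ a ∈ univ.erase i, ∑ b ∈ (univ.erase a).erase i,
        mono (Function.update f i c) a b =
        ∑ a ∈ univ.erase i, ∑ b ∈ (univ.erase a).erase i, mono f a b :=
      sum_congr rfl fun a ha => sum_congr rfl fun b hb => by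
        simp only [hmono, Function.update_of_ne (ne_of_mem_erase ha),
          Function.update_of_ne (ne_of_mem_erase hb)]
    have hown : ∑ j ∈ univ.erase i, mono (Function.update f i c) i j =
        ∑ j ∈ univ.erase i, if c = f j then w i j else 0 :=
      sum_congr rfl fun j hj => by
        simp only [hmono, Function.update_self, Function.update_of_ne (ne_of_mem_erase hj)]
    rw [hsplit, hsplit, hother, hown] at hrecolor
    linarith
  have haverage := sum_le_sum fun c (_ : c ∈ (univ : Finset C)) => hmin c
  rw [sum_const, card_univ, nsmul_eq_mul, sum_comm] at haverage
  exact haverage.trans_eq (sum_congr rfl fun j _ => by simp)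

end Coloring

theorem IsSDDM.exists_large_block {ι : Type} [Fintype ι] [DecidableEq ι] {A : Matrix ι ι ℝ}
    (hA : IsSDDM A) : ∃ F : Finset ι, Fintype.card ι ≤ 5 * #F ∧
      ∀ i ∈ F, 5 * ∑ j ∈ F.erase i, |A i j| ≤ A i i := by
  obtain ⟨f, hf⟩ := exists_coloring (C := Fin 5) (w := fun i j => |A i j|)
    fun i j => by rw [hA.symm.apply]
  obtain ⟨c, -, hc⟩ := exists_le_card_fiber_of_nsmul_le_card_of_maps_to
    (fun i (_ : i ∈ univ) => mem_univ (f i)) univ_nonempty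
    (b := (Fintype.card ι / 5 : ℚ)) (by simp [mul_div_cancel₀])
  rw [div_le_iff₀' (by norm_num)] at hc
  refine ⟨({i | f i = c} : Finset ι), by exact_mod_cast hc, fun i hi => ?_⟩
  obtain rfl : f i = c := (mem_filter.1 hi).2
  have hblock : ({j | f j = f i} : Finset ι).erase i = {j ∈ univ.erase i | f i = f j} := by
    ext j
    simp [eq_comm, and_comm]
  rw [hblock, sum_filter]
  simpa only [Fintype.card_fin, Nat.cast_ofNat] using (hf i).trans (hA.dominant i)

/-! ### Schur complements -/

section FromBlocks

variable {ι κ : Type*} [Fintype ι] [DecidableEq ι] {A : Matrix ι ι ℝ} {B : Matrix ι κ ℝ}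
  {D : Matrix κ κ ℝ}

lemma quadForm_fromBlocks [Fintype κ] (hA : A.IsSymm) (hdet : IsUnit A.det)
    (B : Matrix ι κ ℝ) (D : Matrix κ κ ℝ) (x : ι → ℝ) (y : κ → ℝ) :
    quadForm (fromBlocks A B Bᵀ D) (Sum.elim x y) =
      quadForm A (x + A⁻¹ *ᵥ (B *ᵥ y)) + quadForm (D - Bᵀ * A⁻¹ * B) y := by
  have : Invertible A := invertibleOfIsUnitDet A hdet
  have hcomplete := schur_complement_eq₁₁ B D x y (isHermitian_iff_isSymm.2 hA)
  simp only [star_trivial, conjTranspose_eq_transpose_of_trivial, ← dotProduct_mulVec]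
    at hcomplete
  simpa only [quadForm, mulVec_mulVec] using hcomplete

omit [Fintype ι] [DecidableEq ι] in
lemma posDef_of_fromBlocks (h : (fromBlocks A B Bᵀ D).PosDef) : A.PosDef :=
  h.submatrix (e := Sum.inl) Sum.inl_injective

lemma posDef_schur_of_fromBlocks [Finite κ] (h : (fromBlocks A B Bᵀ D).PosDef) :
    (D - Bᵀ * A⁻¹ * B).PosDef := by
  have := Fintype.ofFinite κ
  have hA := posDef_of_fromBlocks h
  have : Invertible A := hA.isUnit.invertible
  have hsymm : (D - Bᵀ * A⁻¹ * B).IsSymm := by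
    rw [← conjTranspose_eq_transpose_of_trivial, ← isHermitian_iff_isSymm,
      ← IsHermitian.fromBlocks₁₁ B D hA.isHermitian, conjTranspose_eq_transpose_of_trivial]
    exact h.isHermitian
  refine posDef_iff_quadForm.2 ⟨hsymm, fun y hy => ?_⟩
  have hcomplete := quadForm_fromBlocks (isSymm_of_posDef hA) (isUnit_det_of_posDef hA) B D
    (-(A⁻¹ *ᵥ (B *ᵥ y))) y
  rw [neg_add_cancel, quadForm_zero, zero_add] at hcomplete
  rw [← hcomplete]
  exact quadForm_pos h fun hzero => hy (by simpa using congrArg (· ∘ Sum.inr) hzero)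

lemma inv_mul_apply_nonpos (hA : A.PosDef) (hoff : ∀ i j, i ≠ j → A i j ≤ 0)
    (hB : ∀ i j, B i j ≤ 0) (i : ι) (j : κ) : (A⁻¹ * B) i j ≤ 0 := by
  have hcol : A *ᵥ (fun k => -(A⁻¹ * B) k j) = fun k => -B k j := by
    funext l
    have : (A *ᵥ fun k => -(A⁻¹ * B) k j) l = -(A * (A⁻¹ * B)) l j := by
      simp [mulVec, dotProduct, Matrix.mul_apply]
    rw [this, ← Matrix.mul_assoc, mul_nonsing_inv _ (isUnit_det_of_posDef hA), Matrix.one_mul]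
  have := nonneg_of_mulVec_nonneg hA hoff (x := fun k => -(A⁻¹ * B) k j)
    (fun l => by rw [hcol]; exact neg_nonneg.2 (hB l j)) i
  linarith

lemma neg_one_le_inv_mulVec [Fintype κ] (hA : A.PosDef) (hoff : ∀ i j, i ≠ j → A i j ≤ 0)
    (hrow : ∀ i, 0 ≤ ∑ j, A i j + ∑ j, B i j) (i : ι) : -1 ≤ (A⁻¹ *ᵥ (B *ᵥ 1)) i := by
  have := nonneg_of_mulVec_nonneg hA hoff (x := A⁻¹ *ᵥ (B *ᵥ 1) + 1) (fun l => by
    rw [mulVec_add, mulVec_mulVec, mul_nonsing_inv _ (isUnit_det_of_posDef hA), one_mulVec]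
    simpa [mulVec, dotProduct, add_comm] using hrow l) i
  simp only [Pi.add_apply, Pi.one_apply] at this
  linarith

lemma schur_offDiag_nonpos (hA : A.PosDef) (hoff : ∀ i j, i ≠ j → A i j ≤ 0)
    (hB : ∀ i j, B i j ≤ 0) {i j : κ} (hD : D i j ≤ 0) : (D - Bᵀ * A⁻¹ * B) i j ≤ 0 := by
  have hcorrection : 0 ≤ (Bᵀ * A⁻¹ * B) i j := by
    rw [Matrix.mul_assoc, Matrix.mul_apply]
    exact sum_nonneg fun k _ =>
      mul_nonneg_of_nonpos_of_nonpos (hB k i) (inv_mul_apply_nonpos hA hoff hB k j)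
  rw [Matrix.sub_apply]
  linarith

lemma schur_rowSum_nonneg [Fintype κ] (hA : A.PosDef) (hoff : ∀ i j, i ≠ j → A i j ≤ 0)
    (hB : ∀ i j, B i j ≤ 0) (hrow : ∀ i, 0 ≤ ∑ j, A i j + ∑ j, B i j) {i : κ}
    (hD : 0 ≤ ∑ k, B k i + ∑ j, D i j) : 0 ≤ ∑ j, (D - Bᵀ * A⁻¹ * B) i j := by
  have hcorrection : ∑ j, (Bᵀ * A⁻¹ * B) i j ≤ ∑ k, -B k i := by
    calc ∑ j, (Bᵀ * A⁻¹ * B) i j = ∑ k, B k i * (A⁻¹ *ᵥ (B *ᵥ 1)) k := by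
          have : ∑ j, (Bᵀ * A⁻¹ * B) i j = (Bᵀ *ᵥ (A⁻¹ *ᵥ (B *ᵥ 1))) i := by
            rw [mulVec_mulVec, mulVec_mulVec]
            simp [mulVec, dotProduct]
          rw [this]
          simp only [mulVec, dotProduct, transpose_apply]
      _ ≤ ∑ k, -B k i := sum_le_sum fun k _ => by
          nlinarith [hB k i, neg_one_le_inv_mulVec hA hoff hrow k]
  rw [sum_neg_distrib] at hcorrection
  simp only [Matrix.sub_apply, sum_sub_distrib]
  linarith

end FromBlocks

theorem isSDDM_schur_of_fromBlocks {ι κ : Type} [Fintype ι] [DecidableEq ι] [Fintype κ]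
    [DecidableEq κ] {A : Matrix ι ι ℝ} {B : Matrix ι κ ℝ} {D : Matrix κ κ ℝ}
    (h : IsSDDM (fromBlocks A B Bᵀ D)) : IsSDDM (D - Bᵀ * A⁻¹ * B) := by
  have hA := posDef_of_fromBlocks h.posDef
  have hoff : ∀ i j, i ≠ j → A i j ≤ 0 := fun i j hij =>
    h.offDiag_nonpos (Sum.inl i) (Sum.inl j) (by simpa using hij)
  have hB : ∀ i j, B i j ≤ 0 := fun i j => h.offDiag_nonpos (Sum.inl i) (Sum.inr j) (by simp)
  have hrow : ∀ i, 0 ≤ ∑ j, A i j + ∑ j, B i j := fun i => by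
    simpa [Fintype.sum_sum_type] using h.rowSum_nonneg (Sum.inl i)
  refine isSDDM_of_posDef (posDef_schur_of_fromBlocks h.posDef) (fun i j hij => ?_) fun i => ?_
  · exact schur_offDiag_nonpos hA hoff hB
      (h.offDiag_nonpos (Sum.inr i) (Sum.inr j) (by simpa using hij))
  · exact schur_rowSum_nonneg hA hoff hB hrow
      (by simpa [Fintype.sum_sum_type] using h.rowSum_nonneg (Sum.inr i))

section Split

variable {ι : Type} [DecidableEq ι] {V : Finset ι} {M : Matrix V V ℝ}

/-- The splitting of the rows in `V` into those in `F` and those in `V \ F`, through which the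
blocks of a matrix of a chain become those of `Matrix.fromBlocks`. -/
def splitEquiv (V F : Finset ι) : {v : ↥V // (v : ι) ∈ F} ⊕ ↥(V \ F) ≃ ↥V where
  toFun := Sum.elim (fine V F) (coarse V F)
  invFun v := if h : (v : ι) ∈ F then Sum.inl ⟨v, h⟩ else Sum.inr ⟨v, mem_sdiff.2 ⟨v.2, h⟩⟩
  left_inv := by
    rintro (v | v)
    · simp [fine, v.2]
    · simp [coarse, (mem_sdiff.1 v.2).2]
  right_inv v := by
    by_cases h : (v : ι) ∈ F <;> simp [h, fine, coarse]

lemma submatrix_splitEquiv (hM : M.IsSymm) (F : Finset ι) :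
    M.submatrix (splitEquiv V F) (splitEquiv V F) =
      fromBlocks (blockFF M F) (M.submatrix (fine V F) (coarse V F))
        (M.submatrix (fine V F) (coarse V F))ᵀ (M.submatrix (coarse V F) (coarse V F)) := by
  ext (i | i) (j | j)
  · rfl
  · rfl
  · exact hM.apply _ _
  · rfl

lemma schur_eq (hM : M.IsSymm) (F : Finset ι) :
    schur M F = M.submatrix (coarse V F) (coarse V F) -
      (M.submatrix (fine V F) (coarse V F))ᵀ * (blockFF M F)⁻¹ *
        M.submatrix (fine V F) (coarse V F) := by
  rw [schur, transpose_submatrix, hM.eq]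

theorem IsSDDM.schur (hM : IsSDDM M) (F : Finset ι) : IsSDDM (schur M F) := by
  rw [schur_eq hM.symm]
  apply isSDDM_schur_of_fromBlocks
  rw [← submatrix_splitEquiv hM.symm]
  exact hM.submatrix_equiv _

lemma IsSDDM.exists_stronglyDD (hM : IsSDDM M) :
    ∃ F ⊆ V, #V ≤ 5 * #F ∧ IsStronglyDD 4 (blockFF M F) := by
  obtain ⟨F, hcard, hdominant⟩ := hM.exists_large_block
  set G := F.map (Function.Embedding.subtype (· ∈ V)) with hG
  have hmem : ∀ v : ↥V, (v : ι) ∈ G ↔ v ∈ F := by simp [hG]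
  refine ⟨G, fun i hi => ?_, by simpa [hG] using hcard, hM.symm.submatrix _, ?_⟩
  · obtain ⟨v, -, rfl⟩ := mem_map.1 hi
    exact v.2
  · rintro ⟨i, hi⟩
    have hsum : ∑ v ∈ univ.erase ⟨i, hi⟩, |blockFF M G ⟨i, hi⟩ v| = ∑ j ∈ F.erase i, |M i j| :=
      sum_bij (fun v _ => v.1)
        (fun v hv => mem_erase.2 ⟨fun h => ne_of_mem_erase hv (Subtype.ext h), (hmem v).1 v.2⟩)
        (fun v _ w _ h => Subtype.ext h)
        (fun v hv => ⟨⟨v, (hmem v).2 (mem_of_mem_erase hv)⟩, mem_erase.2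
          ⟨fun h => ne_of_mem_erase hv (congrArg Subtype.val h), mem_univ _⟩, rfl⟩)
        fun v _ => rfl
    rw [hsum, show (1 + 4 : ℝ) = 5 by norm_num]
    exact hdominant i ((hmem i).1 hi)

end Split

/-! ### Existence of good chains -/

lemma nnz_submatrix_equiv {ι κ : Type} [Fintype ι] [Fintype κ] (A : Matrix ι ι ℝ) (e : κ ≃ ι) :
    nnz (A.submatrix e e) = nnz A :=
  card_equiv (e.prodCongr e) fun p => by simp only [mem_filter, mem_univ, true_and]; rfl

/-- The error parameters of the chain to be constructed. Their reciprocals grow polynomially while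
the sizes decay geometrically, and their sum telescopes. -/
noncomputable def chainError (i : ℕ) : ℝ := 1 / (2 * (i + 1) * (i + 2))

lemma chainError_inv (i : ℕ) : (chainError i)⁻¹ = 2 * (i + 1) * (i + 2) := by simp [chainError]

lemma chainError_pos (i : ℕ) : 0 < chainError i := by unfold chainError; positivity

lemma chainError_le (i : ℕ) : chainError i ≤ 1 / 4 := by
  have : (0 : ℝ) ≤ i := Nat.cast_nonneg i
  exact one_div_le_one_div_of_le (by norm_num) (by nlinarith)

lemma sum_chainError (d : ℕ) : ∑ i ∈ range d, chainError i = 1 / 2 - 1 / (2 * (d + 1)) := by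
  induction d with
  | zero => simp
  | succ d ih =>
    rw [sum_range_succ, ih, chainError]
    push_cast
    field_simp
    ring

lemma one_le_logb_chainError_inv (i : ℕ) : 1 ≤ Real.logb 4 (chainError i)⁻¹ := by
  rw [Real.le_logb_iff_rpow_le (by norm_num) (inv_pos.2 (chainError_pos i)), Real.rpow_one,
    chainError_inv]
  have : (0 : ℝ) ≤ i := Nat.cast_nonneg i
  nlinarith

lemma logb_four_le_log {x : ℝ} (hx : 1 ≤ x) : Real.logb 4 x ≤ Real.log x := by
  have hlog : (1 : ℝ) ≤ Real.log 4 := by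
    rw [Real.le_log_iff_exp_le (by norm_num)]
    linarith [Real.exp_one_lt_d9]
  exact div_le_self (Real.log_nonneg hx) hlog

lemma logb_chainError_inv_le (i : ℕ) :
    Real.logb 4 (chainError i)⁻¹ ≤ Real.log (2 * (i + 1) * (i + 2)) := by
  rw [chainError_inv]
  have : (0 : ℝ) ≤ i := Nat.cast_nonneg i
  exact logb_four_le_log (by nlinarith)

section Elimination

variable {n : ℕ} {A : Matrix (Fin n) (Fin n) ℝ}

/-- The principal submatrix with rows in `V`. The matrices of a chain under construction are
obtained by restriction from matrices indexed by `Fin n`, so that their type does not depend on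
the sets already eliminated. -/
def restrict (N : Matrix (Fin n) (Fin n) ℝ) (V : Finset (Fin n)) : Matrix V V ℝ :=
  N.submatrix Subtype.val Subtype.val

lemma exists_restrict_eq {V : Finset (Fin n)} (B : Matrix V V ℝ) :
    ∃ N : Matrix (Fin n) (Fin n) ℝ, restrict N V = B :=
  ⟨fun i j => if h : i ∈ V ∧ j ∈ V then B ⟨i, h.1⟩ ⟨j, h.2⟩ else 0, by
    ext i j
    exact dif_pos ⟨i.2, j.2⟩⟩

/-- A stage in the construction of a chain: a set of rows and a matrix that is SDDM on them. -/
structure ChainState (n : ℕ) where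
  vertices : Finset (Fin n)
  matrix : Matrix (Fin n) (Fin n) ℝ
  sddm : IsSDDM (restrict matrix vertices)

/-- The state `t` arises from the state `s` by eliminating `F` and sparsifying the Schur
complement up to the error `ε`. -/
structure ChainState.IsNext (ε : ℝ) (F : Finset (Fin n)) (s t : ChainState n) : Prop where
  subset : F ⊆ s.vertices
  vertices_eq : t.vertices = s.vertices \ F
  card_le : #s.vertices ≤ 5 * #F
  stronglyDD : IsStronglyDD 4 (blockFF (restrict s.matrix s.vertices) F)
  approx : Approx ε (restrict t.matrix (s.vertices \ F)) (schur (restrict s.matrix s.vertices) F)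
  nnz_le : (nnz (restrict t.matrix t.vertices) : ℝ) ≤ 801 * #t.vertices / ε ^ 2

lemma ChainState.exists_isNext (s : ChainState n) {ε : ℝ} (hε₀ : 0 < ε) (hε₁ : ε ≤ 1) :
    ∃ (F : Finset (Fin n)) (t : ChainState n), IsNext ε F s t := by
  obtain ⟨F, hF, hcard, hdominant⟩ := s.sddm.exists_stronglyDD
  obtain ⟨B, hB, happrox, hnnz⟩ := (s.sddm.schur F).exists_sparse_approx hε₀ hε₁
  obtain ⟨N, hN⟩ := exists_restrict_eq B
  exact ⟨F, ⟨s.vertices \ F, N, by rwa [hN]⟩, hF, rfl, hcard, hdominant,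
    by simpa only [hN] using happrox, by simpa only [hN, Fintype.card_coe] using hnnz⟩

/-- A sequence of states that begins with a sparsification of `A`, and in which state `i + 1`
arises from state `i` by eliminating `F i`. -/
structure IsEliminationSequence (A : Matrix (Fin n) (Fin n) ℝ) (state : ℕ → ChainState n)
    (F : ℕ → Finset (Fin n)) : Prop where
  vertices_zero : (state 0).vertices = univ
  approx_zero : Approx (chainError 0) (state 0).matrix A
  nnz_zero_le : (nnz (restrict (state 0).matrix (state 0).vertices) : ℝ) ≤
    801 * #(state 0).vertices / chainError 0 ^ 2
  isNext : ∀ i, (state i).IsNext (chainError (i + 1)) (F i) (state (i + 1))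

theorem IsSDDM.exists_isEliminationSequence (hA : IsSDDM A) :
    ∃ state F, IsEliminationSequence A state F := by
  have hε₁ : ∀ i, chainError i ≤ 1 := fun i => (chainError_le i).trans (by norm_num)
  obtain ⟨B, hB, happrox, hnnz⟩ := hA.exists_sparse_approx (chainError_pos 0) (hε₁ 0)
  set e : ↥(univ : Finset (Fin n)) ≃ Fin n := Equiv.subtypeUnivEquiv mem_univ
  choose F next hnext using fun (i : ℕ) (s : ChainState n) =>
    s.exists_isNext (chainError_pos (i + 1)) (hε₁ (i + 1))
  set state : ℕ → ChainState n := fun i => Nat.rec ⟨univ, B, hB.submatrix_equiv e⟩ next i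
  refine ⟨state, fun i => F i (state i), rfl, happrox, ?_, fun i => hnext i (state i)⟩
  change (nnz (B.submatrix e e) : ℝ) ≤ 801 * #(univ : Finset (Fin n)) / chainError 0 ^ 2
  rwa [nnz_submatrix_equiv]

/-- The shape of the chain formed by the first `d` states. State `i` becomes `M⁽ⁱ⁺¹⁾`. -/
@[simps]
noncomputable def eliminationShape (F : ℕ → Finset (Fin n)) (d : ℕ) : ChainShape n where
  d := d
  F i := F (i - 1)
  α _ := 4
  ε := chainError

namespace IsEliminationSequence

variable {state : ℕ → ChainState n} {F : ℕ → Finset (Fin n)}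

lemma card_vertices_le (h : IsEliminationSequence A state F) (i : ℕ) :
    (#(state i).vertices : ℝ) ≤ (4 / 5 : ℝ) ^ i * n := by
  induction i with
  | zero => simp [h.vertices_zero]
  | succ i ih =>
    have hsubset := (h.isNext i).subset
    have hcard : (#(state i).vertices : ℝ) ≤ 5 * #(F i) := by exact_mod_cast (h.isNext i).card_le
    rw [(h.isNext i).vertices_eq, card_sdiff_of_subset hsubset,
      Nat.cast_sub (card_le_card hsubset), pow_succ]
    linarith

lemma nnz_le (h : IsEliminationSequence A state F) (i : ℕ) :
    (nnz (restrict (state i).matrix (state i).vertices) : ℝ) ≤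
      801 * ((4 / 5 : ℝ) ^ i * n) / chainError i ^ 2 := by
  have hcard := h.card_vertices_le i
  have hpos := chainError_pos i
  have hnnz : (nnz (restrict (state i).matrix (state i).vertices) : ℝ) ≤
      801 * #(state i).vertices / chainError i ^ 2 := by
    cases i with
    | zero => exact h.nnz_zero_le
    | succ i => exact (h.isNext i).nnz_le
  exact hnnz.trans (by gcongr)

lemma vertices_eliminationShape (h : IsEliminationSequence A state F) (d i : ℕ) :
    (eliminationShape F d).vertices (i + 1) = (state i).vertices := by
  induction i with
  | zero => exact h.vertices_zero.symm
  | succ i ih =>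
    rw [(h.isNext i).vertices_eq, ← ih]
    rfl

theorem exists_chain (h : IsEliminationSequence A state F) (hA : IsSDDM A) {d s : ℕ}
    (hs : (4 / 5 : ℝ) ^ d * n ≤ s) : ∃ M : ChainMatrices (eliminationShape F (d + 1)),
      IsVertexSparsifierChain s A (eliminationShape F (d + 1)) M ∧
      ∀ i, (nnz (M (i + 1)) : ℝ) ≤ 801 * ((4 / 5 : ℝ) ^ i * n) / chainError i ^ 2 := by
  have hvertices := h.vertices_eliminationShape (d + 1)
  refine ⟨fun i => restrict (state (i - 1)).matrix _, ?_, fun i => ?_⟩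
  · constructor
    case sddm_input => exact hA
    case one_le_d => exact Nat.le_add_left 1 d
    case four_le_α => exact fun _ _ _ => le_rfl
    case ε_pos => exact fun i _ => chainError_pos i
    case ε_le => exact fun i _ => (chainError_le i).trans (by norm_num)
    case approx_input => exact h.approx_zero
    case sddm =>
      intro i hi _
      obtain ⟨i, rfl⟩ := Nat.exists_eq_add_of_le' hi
      rw [hvertices]
      exact (state i).sddm
    case F_subset =>
      intro i hi _
      obtain ⟨i, rfl⟩ := Nat.exists_eq_add_of_le' hi
      rw [hvertices]
      exact (h.isNext i).subset
    case approx_schur =>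
      intro i _
      change Approx (chainError (i + 1)) (restrict (state (i + 1)).matrix
        ((eliminationShape F (d + 1)).vertices (i + 1) \ F i))
        (schur (restrict (state i).matrix ((eliminationShape F (d + 1)).vertices (i + 1))) (F i))
      rw [hvertices]
      exact (h.isNext i).approx
    case stronglyDD =>
      intro i hi _
      obtain ⟨i, rfl⟩ := Nat.exists_eq_add_of_le' hi
      change IsStronglyDD 4 (blockFF (restrict (state i).matrix
        ((eliminationShape F (d + 1)).vertices (i + 1))) (F i))
      rw [hvertices]
      exact (h.isNext i).stronglyDD
    case size_last =>
      rw [eliminationShape_d, hvertices]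
      exact_mod_cast (h.card_vertices_le d).trans hs
  · change (nnz (restrict (state i).matrix
      ((eliminationShape F (d + 1)).vertices (i + 1))) : ℝ) ≤ _
    rw [hvertices]
    exact h.nnz_le i

end IsEliminationSequence

end Elimination

section ChainBounds

/-- The number of eliminations after which at most one row is left, as each of them removes a
fifth of the rows. -/
noncomputable def chainSteps (n : ℕ) : ℕ := ⌈Real.log n / Real.log (5 / 4)⌉₊

lemma pow_chainSteps_mul_le_one (n : ℕ) : (4 / 5 : ℝ) ^ chainSteps n * n ≤ 1 := by
  rcases Nat.eq_zero_or_pos n with rfl | hn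
  · simp
  have hn' : (0 : ℝ) < n := by exact_mod_cast hn
  have hlog : Real.log n ≤ Real.log ((5 / 4 : ℝ) ^ chainSteps n) := by
    rw [Real.log_pow, ← div_le_iff₀ (Real.log_pos (by norm_num))]
    exact Nat.le_ceil _
  calc (4 / 5 : ℝ) ^ chainSteps n * n
      ≤ (4 / 5 : ℝ) ^ chainSteps n * (5 / 4 : ℝ) ^ chainSteps n := by
        gcongr
        exact (Real.log_le_log_iff hn' (by positivity)).1 hlog
    _ = 1 := by rw [← mul_pow]; norm_num

lemma half_le_log_natCast {n : ℕ} (hn : 2 ≤ n) : 1 / 2 ≤ Real.log n := by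
  have : Real.log 2 ≤ Real.log n := Real.log_le_log two_pos (by exact_mod_cast hn)
  linarith [Real.log_two_gt_d9]

lemma chainSteps_le {n : ℕ} (hn : 2 ≤ n) : (chainSteps n : ℝ) ≤ 7 * Real.log n := by
  have hL := half_le_log_natCast hn
  have hbase : (1 / 5 : ℝ) ≤ Real.log (5 / 4) := by
    have := Real.one_sub_inv_le_log_of_pos (x := 5 / 4) (by norm_num)
    norm_num at this ⊢
    linarith
  have hdiv : Real.log n / Real.log (5 / 4) ≤ 5 * Real.log n := by
    rw [div_le_iff₀ (by linarith)]
    nlinarith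
  have hceil := (Nat.ceil_lt_add_one (a := Real.log n / Real.log (5 / 4))
    (div_nonneg (by linarith) (by linarith))).le
  rw [chainSteps]
  linarith

lemma log_two_mul_le {k L : ℝ} (hk : 0 ≤ k) (hL : 1 / 2 ≤ L) (hkL : k ≤ 7 * L) :
    Real.log (2 * (k + 1) * (k + 2)) ≤ (Real.log 198 + 2) * lg L := by
  have hlog : 0 ≤ Real.log 198 := Real.log_nonneg (by norm_num)
  have hone : 1 ≤ lg L := le_max_left _ _
  have hle : Real.log L ≤ lg L := le_max_right _ _
  calc Real.log (2 * (k + 1) * (k + 2)) ≤ Real.log (198 * L ^ 2) :=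
        Real.log_le_log (by positivity) (by nlinarith)
    _ = Real.log 198 + 2 * Real.log L := by
        rw [Real.log_mul (by norm_num) (by positivity), Real.log_pow]
        norm_num
    _ ≤ (Real.log 198 + 2) * lg L := by nlinarith

lemma chainSteps_mul_log_le (n : ℕ) :
    chainSteps n * (Real.log n * Real.log (2 * (chainSteps n + 1) * (chainSteps n + 2))) ≤
      7 * (Real.log 198 + 2) * (lg n ^ 2 * lg (Real.log n)) := by
  have hlg : 1 ≤ lg (Real.log n) := le_max_left _ _
  have hlog : 0 ≤ Real.log 198 := Real.log_nonneg (by norm_num)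
  rcases Nat.lt_or_ge n 2 with hn | hn
  · have hzero : Real.log n = 0 := by interval_cases n <;> simp
    rw [hzero, zero_mul, mul_zero]
    rw [hzero] at hlg
    positivity
  · have hL := half_le_log_natCast hn
    have hlgn : Real.log n ≤ lg n := le_max_right _ _
    have hlogn : 0 ≤ Real.log n := Real.log_natCast_nonneg n
    have hsteps : 0 ≤ Real.log (2 * ((chainSteps n : ℝ) + 1) * (chainSteps n + 2)) :=
      Real.log_nonneg (by nlinarith [Nat.cast_nonneg (α := ℝ) (chainSteps n)])
    have hlgn_nonneg : 0 ≤ lg n := hlogn.trans hlgn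
    calc chainSteps n * (Real.log n * Real.log (2 * (chainSteps n + 1) * (chainSteps n + 2)))
        ≤ (7 * lg n) * (lg n * ((Real.log 198 + 2) * lg (Real.log n))) := by
          gcongr
          · linarith [chainSteps_le hn]
          · exact log_two_mul_le (Nat.cast_nonneg _) hL (chainSteps_le hn)
      _ = 7 * (Real.log 198 + 2) * (lg n ^ 2 * lg (Real.log n)) := by ring

lemma summable_geometric_mul_cube :
    Summable fun i : ℕ => (4 / 5 : ℝ) ^ i * (2 * (i + 2) * (i + 3)) ^ 3 := by
  have hsum := (summable_nat_add_iff 3).2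
    (summable_pow_mul_geometric_of_norm_lt_one 6 (r := (4 / 5 : ℝ)) (by norm_num))
  refine Summable.of_nonneg_of_le (fun i => by positivity) (fun i => ?_)
    (hsum.mul_left (8 * (5 / 4) ^ 3))
  calc (4 / 5 : ℝ) ^ i * (2 * (i + 2) * (i + 3)) ^ 3
      ≤ (4 / 5 : ℝ) ^ i * (2 * (i + 3) * (i + 3)) ^ 3 := by gcongr; norm_num
    _ = 8 * (5 / 4) ^ 3 * (((i + 3 : ℕ) : ℝ) ^ 6 * (4 / 5) ^ (i + 3)) := by push_cast; ring

variable {n : ℕ} {σ : ChainShape n}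

lemma chainWork_le {M : ChainMatrices σ} (hα : ∀ i, σ.α i = 4) (hε : σ.ε = chainError)
    (hnnz : ∀ i, (nnz (M (i + 1)) : ℝ) ≤ 801 * ((4 / 5 : ℝ) ^ i * n) / chainError i ^ 2) :
    chainWork σ M ≤ 801 * (∑' i : ℕ, (4 / 5 : ℝ) ^ i * (2 * (i + 2) * (i + 3)) ^ 3) * n := by
  have hterm : ∀ i : ℕ, (nnz (M (i + 1)) : ℝ) * Real.logb 4 (chainError (i + 1))⁻¹ ≤
      801 * ((4 / 5 : ℝ) ^ i * (2 * (i + 2) * (i + 3)) ^ 3) * n := fun i => by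
    have hnonneg : 0 ≤ Real.logb 4 (chainError (i + 1))⁻¹ :=
      zero_le_one.trans (one_le_logb_chainError_inv _)
    have hlog : Real.logb 4 (chainError (i + 1))⁻¹ ≤ 2 * (i + 2) * (i + 3) :=
      (logb_chainError_inv_le _).trans
        ((Real.log_le_self (by positivity)).trans_eq (by push_cast; ring))
    calc (nnz (M (i + 1)) : ℝ) * Real.logb 4 (chainError (i + 1))⁻¹
        ≤ 801 * ((4 / 5 : ℝ) ^ i * n) / chainError i ^ 2 * (2 * (i + 2) * (i + 3)) :=
          mul_le_mul (hnnz i) hlog hnonneg ((Nat.cast_nonneg _).trans (hnnz i))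
      _ = 801 * ((4 / 5 : ℝ) ^ i * n) *
            ((2 * (i + 1) * (i + 2)) ^ 2 * (2 * (i + 2) * (i + 3))) := by
          rw [div_eq_mul_inv, ← inv_pow, chainError_inv]
          ring
      _ ≤ 801 * ((4 / 5 : ℝ) ^ i * n) *
            ((2 * (i + 2) * (i + 3)) ^ 2 * (2 * (i + 2) * (i + 3))) := by
          gcongr <;> norm_num
      _ = 801 * ((4 / 5 : ℝ) ^ i * (2 * (i + 2) * (i + 3)) ^ 3) * n := by ring
  rw [chainWork, sum_Ico_eq_sum_range]
  refine (sum_le_sum (g := fun i : ℕ =>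
    801 * ((4 / 5 : ℝ) ^ i * (2 * (i + 2) * (i + 3)) ^ 3) * n) fun i _ => ?_).trans ?_
  · rw [hα, hε, add_comm 1 i]
    exact hterm i
  rw [← sum_mul, ← mul_sum]
  gcongr
  exact summable_geometric_mul_cube.sum_le_tsum _ fun i _ => by positivity

lemma chainDepth_le (hd : σ.d = chainSteps n + 1) (hα : ∀ i, σ.α i = 4) (hε : σ.ε = chainError) :
    chainDepth σ ≤ 7 * (Real.log 198 + 2) * (lg n ^ 2 * lg (Real.log n)) := by
  refine le_trans ?_ (chainSteps_mul_log_le n)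
  rw [chainDepth, hd]
  simp only [hα, hε]
  refine (sum_le_card_nsmul _ _
    (Real.log n * Real.log (2 * (chainSteps n + 1) * (chainSteps n + 2))) fun i hi => ?_).trans_eq
    (by simp)
  have hi' : (i : ℝ) ≤ chainSteps n := by exact_mod_cast Nat.lt_succ_iff.1 (mem_Ico.1 hi).2
  exact mul_le_mul_of_nonneg_left ((logb_chainError_inv_le i).trans
    (Real.log_le_log (by positivity) (by gcongr))) (Real.log_natCast_nonneg n)

end ChainBounds

theorem exists_good_chain : ∃ (s : ℕ) (κ c₁ c₂ : ℝ), 0 < κ ∧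
    ∀ (n : ℕ) (A : Matrix (Fin n) (Fin n) ℝ), IsSDDM A →
      ∃ (σ : ChainShape n) (M : ChainMatrices σ),
        IsVertexSparsifierChainWith 1 (c₁ * (lg n ^ 2 * lg (Real.log n))) (c₂ * n) s A σ M ∧
        ∀ i, 1 ≤ i → i < σ.d → κ ≤ Real.logb (σ.α i) (σ.ε i)⁻¹ := by
  refine ⟨1, 1, 7 * (Real.log 198 + 2),
    801 * ∑' i : ℕ, (4 / 5 : ℝ) ^ i * (2 * (i + 2) * (i + 3)) ^ 3, one_pos, fun n A hA => ?_⟩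
  obtain ⟨state, F, hseq⟩ := hA.exists_isEliminationSequence
  obtain ⟨M, hchain, hnnz⟩ := hseq.exists_chain (s := 1) hA
    (by exact_mod_cast pow_chainSteps_mul_le_one n)
  refine ⟨_, M, ⟨hchain, ?_, chainWork_le (fun _ => rfl) rfl hnnz,
    chainDepth_le rfl (fun _ => rfl) rfl⟩, fun i _ _ => one_le_logb_chainError_inv i⟩
  simp only [eliminationShape_ε, sum_chainError]
  have : 0 ≤ 1 / (2 * (((eliminationShape F (chainSteps n + 1)).d : ℝ) + 1)) := by positivity
  linarith

/-! ### Building circuits -/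

section Circuits

variable {I : Type} {Ω : Type*} (inp : Ω → I → ℝ)

/-- Some operand of depth at most `D` has the value `f ω` for every instance `ω`. The circuits to
be built work for a set `Ω` of instances at once, `inp ω` being the inputs of the instance `ω`. -/
def Gates.IsAvailable {k : ℕ} (g : Gates I k) (D : ℕ) (f : Ω → ℝ) : Prop :=
  ∃ o : Operand I k, (∀ ω, o.eval (inp ω) (g.eval (inp ω)) = f ω) ∧ o.depth g.depths ≤ D

/-- The gates `g'` can replace the gates `g`, at the cost of at most `w` additional gates, none of
which has depth more than `B` unless a gate of `g` has. -/
structure Gates.IsExtension {k k' : ℕ} (g : Gates I k) (g' : Gates I k') (w B : ℕ) : Prop where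
  size_le : k' ≤ k + w
  defined : (∀ ω, g.Defined (inp ω)) → ∀ ω, g'.Defined (inp ω)
  isAvailable : ∀ {D f}, g.IsAvailable inp D f → g'.IsAvailable inp D f
  depths_le : ∀ D, B ≤ D → (∀ j, g.depths j ≤ D) → ∀ j, g'.depths j ≤ D

/-- From the functions in `S` those in `T` can be computed by `w` gates in additional depth
`δ`. -/
def ComputableFrom (w δ : ℕ) (S T : Set (Ω → ℝ)) : Prop :=
  ∀ (k : ℕ) (g : Gates I k) (D : ℕ), (∀ f ∈ S, g.IsAvailable inp D f) →
    ∃ (k' : ℕ) (g' : Gates I k'),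
      g.IsExtension inp g' w (D + δ) ∧ ∀ f ∈ T, g'.IsAvailable inp (D + δ) f

/-- The inputs and the rational constants, which are available without any gates. -/
def freeFunctions : Set (Ω → ℝ) :=
  Set.range (fun i ω => inp ω i) ∪ Set.range fun (q : ℚ) _ => (q : ℝ)

lemma input_mem_freeFunctions (i : I) : (fun ω => inp ω i) ∈ freeFunctions inp := Or.inl ⟨i, rfl⟩

lemma ratCast_mem_freeFunctions (q : ℚ) : (fun _ => (q : ℝ)) ∈ freeFunctions inp :=
  Or.inr ⟨q, rfl⟩

lemma zero_mem_freeFunctions : (fun _ => (0 : ℝ)) ∈ freeFunctions inp := by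
  simpa using ratCast_mem_freeFunctions inp 0

lemma one_mem_freeFunctions : (fun _ => (1 : ℝ)) ∈ freeFunctions inp := by
  simpa using ratCast_mem_freeFunctions inp 1

variable {inp}

namespace Gates

variable {k k₁ k₂ w w₁ w₂ B B' D D' : ℕ} {g : Gates I k} {g₁ : Gates I k₁} {g₂ : Gates I k₂}
  {f : Ω → ℝ}

lemma IsAvailable.mono (h : g.IsAvailable inp D f) (hD : D ≤ D') : g.IsAvailable inp D' f := by
  obtain ⟨o, hvalue, hdepth⟩ := h
  exact ⟨o, hvalue, hdepth.trans hD⟩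

lemma isAvailable_of_mem_freeFunctions (g : Gates I k) (D : ℕ) (h : f ∈ freeFunctions inp) :
    g.IsAvailable inp D f := by
  rcases h with ⟨i, rfl⟩ | ⟨q, rfl⟩
  · exact ⟨.input i, fun _ => rfl, Nat.zero_le _⟩
  · exact ⟨.const q, fun _ => rfl, Nat.zero_le _⟩

lemma IsExtension.refl (g : Gates I k) (w B : ℕ) : g.IsExtension inp g w B :=
  ⟨Nat.le_add_right k w, id, id, fun _ _ => id⟩

lemma IsExtension.mono {w' : ℕ} (h : g.IsExtension inp g₁ w B) (hw : w ≤ w') (hB : B ≤ B') :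
    g.IsExtension inp g₁ w' B' :=
  ⟨h.size_le.trans (by omega), h.defined, h.isAvailable, fun D hD => h.depths_le D (hB.trans hD)⟩

lemma IsExtension.trans (h₁ : g.IsExtension inp g₁ w₁ B) (h₂ : g₁.IsExtension inp g₂ w₂ B) :
    g.IsExtension inp g₂ (w₁ + w₂) B where
  size_le := by linarith [h₁.size_le, h₂.size_le]
  defined hg := h₂.defined (h₁.defined hg)
  isAvailable hf := h₂.isAvailable (h₁.isAvailable hf)
  depths_le D hD hg := h₂.depths_le D hD (h₁.depths_le D hD hg)

end Gates

namespace ComputableFrom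

variable {w w' δ δ' : ℕ} {S S' T T' U : Set (Ω → ℝ)}

lemma mono (h : ComputableFrom inp w δ S T) (hw : w ≤ w') (hδ : δ ≤ δ') (hS : S ⊆ S')
    (hT : T' ⊆ T) : ComputableFrom inp w' δ' S' T' := by
  intro k g D hg
  obtain ⟨k', g', hext, hT'⟩ := h k g D fun f hf => hg f (hS hf)
  exact ⟨k', g', hext.mono hw (by omega), fun f hf => (hT' f (hT hf)).mono (by omega)⟩

lemma mono_cost (h : ComputableFrom inp w δ S T) (hw : w ≤ w') (hδ : δ ≤ δ') :
    ComputableFrom inp w' δ' S T :=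
  h.mono hw hδ subset_rfl subset_rfl

lemma of_subset (h : T ⊆ S) (w δ : ℕ) : ComputableFrom inp w δ S T := fun _ g D hg =>
  ⟨_, g, .refl g w _, fun f hf => (hg f (h hf)).mono (Nat.le_add_right D δ)⟩

lemma trans (h : ComputableFrom inp w δ S T) (h' : ComputableFrom inp w' δ' (S ∪ T) U) :
    ComputableFrom inp (w + w') (δ + δ') S U := by
  intro k g D hg
  obtain ⟨k₁, g₁, hext₁, hT⟩ := h k g D hg
  obtain ⟨k₂, g₂, hext₂, hU⟩ := h' k₁ g₁ (D + δ) (by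
    rintro f (hf | hf)
    · exact (hext₁.isAvailable (hg f hf)).mono (Nat.le_add_right D δ)
    · exact hT f hf)
  rw [add_assoc] at hext₂ hU
  exact ⟨k₂, g₂, (hext₁.mono le_rfl (by omega)).trans hext₂, hU⟩

lemma union (h : ComputableFrom inp w δ S T) (h' : ComputableFrom inp w' δ S T') :
    ComputableFrom inp (w + w') δ S (T ∪ T') := by
  intro k g D hg
  obtain ⟨k₁, g₁, hext₁, hT⟩ := h k g D hg
  obtain ⟨k₂, g₂, hext₂, hT'⟩ := h' k₁ g₁ D fun f hf => hext₁.isAvailable (hg f hf)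
  refine ⟨k₂, g₂, hext₁.trans hext₂, ?_⟩
  rintro f (hf | hf)
  · exact hext₂.isAvailable (hT f hf)
  · exact hT' f hf

lemma biUnion {J : Type*} (s : Finset J) {w : J → ℕ} {T : J → Set (Ω → ℝ)}
    (h : ∀ j ∈ s, ComputableFrom inp (w j) δ S (T j)) :
    ComputableFrom inp (∑ j ∈ s, w j) δ S (⋃ j ∈ s, T j) := by
  classical
  induction s using Finset.induction_on with
  | empty => exact of_subset (by simp) _ _
  | insert a s ha ih =>
    rw [sum_insert ha, set_biUnion_insert]
    exact (h a (mem_insert_self a s)).union (ih fun j hj => h j (mem_insert_of_mem hj))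

lemma range {J : Type*} [Fintype J] {w : J → ℕ} {f : J → Ω → ℝ}
    (h : ∀ j, ComputableFrom inp (w j) δ S {f j}) :
    ComputableFrom inp (∑ j, w j) δ S (Set.range f) := by
  refine (biUnion univ fun j _ => h j).mono le_rfl le_rfl subset_rfl ?_
  rintro _ ⟨j, rfl⟩
  simp

theorem exists_circuit {O : Type} {f : O → Ω → ℝ}
    (h : ComputableFrom inp w δ (freeFunctions inp) (Set.range f)) :
    ∃ c : Circuit I O, c.work ≤ w ∧ c.depth ≤ δ ∧
      ∀ ω, c.gates.Defined (inp ω) ∧ c.eval (inp ω) = fun o => f o ω := by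
  obtain ⟨k, g, hext, hT⟩ := h 0 .nil 0 fun f hf => Gates.isAvailable_of_mem_freeFunctions _ _ hf
  choose o ho _ using fun j => hT (f j) ⟨j, rfl⟩
  exact ⟨⟨k, g, o⟩, hext.size_le.trans_eq (zero_add w),
    Finset.sup_le fun j _ => hext.depths_le δ (by omega) (fun j => j.elim0) j,
    fun ω => ⟨hext.defined (fun _ => trivial) ω, funext fun j => ho j ω⟩⟩

end ComputableFrom

lemma Gates.isAvailable_snoc {k D : ℕ} {g : Gates I k} {f : Ω → ℝ} (op : ArithOp)
    (a b : Operand I k) (h : g.IsAvailable inp D f) : (g.snoc op a b).IsAvailable inp D f := by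
  obtain ⟨o, hvalue, hdepth⟩ := h
  cases o with
  | input i => exact ⟨.input i, hvalue, hdepth⟩
  | const q => exact ⟨.const q, hvalue, hdepth⟩
  | gate j =>
    refine ⟨.gate j.castSucc, fun ω => ?_, ?_⟩
    · rw [← hvalue ω]
      simp [Operand.eval, Gates.eval]
    · simpa [Operand.depth, Gates.depths] using hdepth

lemma computableFrom_op (op : ArithOp) {S : Set (Ω → ℝ)} {a b : Ω → ℝ} (ha : a ∈ S) (hb : b ∈ S)
    (hdiv : op = ArithOp.div → ∀ ω, b ω ≠ 0) :
    ComputableFrom inp 1 1 S {fun ω => op.eval (a ω) (b ω)} := by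
  intro k g D hg
  obtain ⟨o, ho, ho'⟩ := hg a ha
  obtain ⟨p, hp, hp'⟩ := hg b hb
  refine ⟨k + 1, g.snoc op o p, ⟨le_rfl, fun hg ω => ⟨hg ω, fun h => ?_⟩,
    Gates.isAvailable_snoc op o p, fun B hB hgB j => ?_⟩, ?_⟩
  · rw [hp]
    exact hdiv h ω
  · refine Fin.lastCases ?_ (fun j => ?_) j
    · simp only [Gates.depths, Fin.snoc_last]
      omega
    · simpa [Gates.depths] using hgB j
  · rintro f rfl
    refine ⟨.gate (Fin.last k), fun ω => ?_, ?_⟩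
    · change (g.snoc op o p).eval (inp ω) (Fin.last k) = _
      simp only [Gates.eval, Fin.snoc_last, ho, hp]
    · change (g.snoc op o p).depths (Fin.last k) ≤ _
      simp only [Gates.depths, Fin.snoc_last]
      omega

section Sums

variable {J : Type*} {S : Set (Ω → ℝ)} {a b : Ω → ℝ}

lemma computableFrom_add (ha : a ∈ S) (hb : b ∈ S) :
    ComputableFrom inp 1 1 S {fun ω => a ω + b ω} := computableFrom_op .add ha hb nofun

lemma computableFrom_sub (ha : a ∈ S) (hb : b ∈ S) :
    ComputableFrom inp 1 1 S {fun ω => a ω - b ω} := computableFrom_op .sub ha hb nofun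

lemma computableFrom_mul (ha : a ∈ S) (hb : b ∈ S) :
    ComputableFrom inp 1 1 S {fun ω => a ω * b ω} := computableFrom_op .mul ha hb nofun

lemma computableFrom_div (ha : a ∈ S) (hb : b ∈ S) (h : ∀ ω, b ω ≠ 0) :
    ComputableFrom inp 1 1 S {fun ω => a ω / b ω} := computableFrom_op .div ha hb fun _ => h

-- The summation proceeds along a balanced binary tree.
lemma computableFrom_sum (hS : freeFunctions inp ⊆ S) {f : J → Ω → ℝ} (r : ℕ) (s : Finset J)
    (hs : ∀ j ∈ s, f j ∈ S) (hcard : #s ≤ 2 ^ r) :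
    ComputableFrom inp (#s - 1) r S {fun ω => ∑ j ∈ s, f j ω} := by
  classical
  induction r generalizing s with
  | zero =>
    refine .of_subset (Set.singleton_subset_iff.2 ?_) _ _
    rcases s.eq_empty_or_nonempty with rfl | hne
    · simpa using hS (zero_mem_freeFunctions inp)
    · obtain ⟨j, rfl⟩ := card_eq_one.1 (le_antisymm hcard hne.card_pos)
      simpa using hs j
  | succ r ih =>
    by_cases hone : #s ≤ 1
    · exact (ih s hs (hone.trans Nat.one_le_two_pow)).mono_cost le_rfl (Nat.le_succ r)
    obtain ⟨t, hts, ht⟩ := exists_subset_card_eq (s := s) (n := #s / 2) (by omega)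
    rw [pow_succ] at hcard
    have hsdiff : #(s \ t) = #s - #s / 2 := by rw [card_sdiff_of_subset hts, ht]
    have hhalves := (ih t (fun j hj => hs j (hts hj)) (by omega)).union
      (ih (s \ t) (fun j hj => hs j (mem_sdiff.1 hj).1) (by omega))
    refine (hhalves.trans (computableFrom_add (a := fun ω => ∑ j ∈ t, f j ω)
      (b := fun ω => ∑ j ∈ s \ t, f j ω) (Or.inr (Or.inl rfl)) (Or.inr (Or.inr rfl)))).mono
      (by omega) le_rfl subset_rfl (Set.singleton_subset_iff.2 ?_)
    funext ω
    rw [add_comm, sum_sdiff hts]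

lemma computableFrom_prod (hS : freeFunctions inp ⊆ S) {f : J → Ω → ℝ} (s : Finset J)
    (hs : ∀ j ∈ s, f j ∈ S) : ComputableFrom inp #s #s S {fun ω => ∏ j ∈ s, f j ω} := by
  classical
  induction s using Finset.induction_on with
  | empty => exact .of_subset (by simpa using hS (one_mem_freeFunctions inp)) _ _
  | insert a s ha ih =>
    rw [card_insert_of_notMem ha]
    simp only [prod_insert ha]
    exact (ih fun j hj => hs j (mem_insert_of_mem hj)).trans
      (computableFrom_mul (Or.inl (hs a (mem_insert_self a s))) (Or.inr rfl))

end Sums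

section Vectors

variable {J : Type*} [Fintype J] {S : Set (Ω → ℝ)} {x y : J → Ω → ℝ}

lemma computableFrom_vec_add (hx : Set.range x ⊆ S) (hy : Set.range y ⊆ S) :
    ComputableFrom inp (Fintype.card J) 1 S (Set.range fun j ω => x j ω + y j ω) := by
  simpa using ComputableFrom.range fun j => computableFrom_add (hx ⟨j, rfl⟩) (hy ⟨j, rfl⟩)

lemma computableFrom_vec_sub (hx : Set.range x ⊆ S) (hy : Set.range y ⊆ S) :
    ComputableFrom inp (Fintype.card J) 1 S (Set.range fun j ω => x j ω - y j ω) := by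
  simpa using ComputableFrom.range fun j => computableFrom_sub (hx ⟨j, rfl⟩) (hy ⟨j, rfl⟩)

lemma computableFrom_vec_div (hx : Set.range x ⊆ S) (hy : Set.range y ⊆ S)
    (h : ∀ j ω, y j ω ≠ 0) :
    ComputableFrom inp (Fintype.card J) 1 S (Set.range fun j ω => x j ω / y j ω) := by
  simpa using ComputableFrom.range fun j =>
    computableFrom_div (hx ⟨j, rfl⟩) (hy ⟨j, rfl⟩) (h j)

lemma computableFrom_vec_smul (hS : freeFunctions inp ⊆ S) (q : ℚ) (hx : Set.range x ⊆ S) :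
    ComputableFrom inp (Fintype.card J) 1 S (Set.range fun j ω => (q : ℝ) * x j ω) := by
  simpa using ComputableFrom.range fun j =>
    computableFrom_mul (hS (ratCast_mem_freeFunctions inp q)) (hx ⟨j, rfl⟩)

end Vectors

section Matrices

variable {J K : Type*} [Finite J] [Fintype K] {S : Set (Ω → ℝ)} {M : Ω → Matrix J K ℝ}
  {P : Finset (J × K)} {r : ℕ}

lemma computableFrom_rowSum (hS : freeFunctions inp ⊆ S)
    (hP : ∀ p ∈ P, (fun ω => M ω p.1 p.2) ∈ S) (hP₀ : ∀ ω j k, (j, k) ∉ P → M ω j k = 0)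
    (hr : Fintype.card K ≤ 2 ^ r) :
    ComputableFrom inp #P r S (Set.range fun j ω => ∑ k, M ω j k) := by
  classical
  have := Fintype.ofFinite J
  have hrow : ∀ j, ComputableFrom inp #{p ∈ P | p.1 = j} r S {fun ω => ∑ k, M ω j k} := fun j => by
    set s : Finset K := {k | (j, k) ∈ P} with hs
    have hmem : ∀ k, k ∈ s ↔ (j, k) ∈ P := by simp [hs]
    have hcard : #s ≤ #{p ∈ P | p.1 = j} :=
      card_le_card_of_injOn (Prod.mk j) (fun k hk => by simpa [hmem] using hk)
        (Prod.mk_right_injective j).injOn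
    have hsum := computableFrom_sum hS (f := fun k ω => M ω j k) r s
      (fun k hk => hP (j, k) ((hmem k).1 hk)) ((card_le_univ s).trans hr)
    refine hsum.mono (by omega) le_rfl subset_rfl (Set.singleton_subset_iff.2 ?_)
    funext ω
    exact (sum_subset (subset_univ s) fun k _ hk => hP₀ ω j k (mt (hmem k).2 hk)).symm
  rw [card_eq_sum_card_fiberwise fun p _ => mem_univ p.1]
  exact .range hrow

lemma computableFrom_mulVec (hS : freeFunctions inp ⊆ S)
    (hP : ∀ p ∈ P, (fun ω => M ω p.1 p.2) ∈ S) (hP₀ : ∀ ω j k, (j, k) ∉ P → M ω j k = 0)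
    (hr : Fintype.card K ≤ 2 ^ r) {x : K → Ω → ℝ} (hx : Set.range x ⊆ S) :
    ComputableFrom inp (2 * #P) (r + 1) S
      (Set.range fun j ω => (M ω *ᵥ fun k => x k ω) j) := by
  have hproducts : ComputableFrom inp #P 1 S (⋃ p ∈ P, {fun ω => M ω p.1 p.2 * x p.2 ω}) := by
    rw [card_eq_sum_ones]
    exact .biUnion P fun p hp => computableFrom_mul (hP p hp) (hx ⟨p.2, rfl⟩)
  have hsums : ComputableFrom inp #P r (S ∪ ⋃ p ∈ P, {fun ω => M ω p.1 p.2 * x p.2 ω})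
      (Set.range fun j ω => ∑ k, M ω j k * x k ω) :=
    computableFrom_rowSum (M := fun ω j k => M ω j k * x k ω) (hS.trans Set.subset_union_left)
      (fun p hp => Or.inr (Set.mem_iUnion₂.2 ⟨p, hp, rfl⟩))
      (fun ω j k h => by rw [hP₀ ω j k h, zero_mul]) hr
  exact (hproducts.trans hsums).mono_cost (two_mul #P).ge (add_comm 1 r).le

end Matrices

section Cramer

variable {V : Type*} [Fintype V] [DecidableEq V] {S : Set (Ω → ℝ)} {M : Ω → Matrix V V ℝ} {s : ℕ}

lemma computableFrom_det (hS : freeFunctions inp ⊆ S) (hM : ∀ u v, (fun ω => M ω u v) ∈ S)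
    (hs : Fintype.card V ≤ s) :
    ComputableFrom inp (s.factorial * (s + 2)) (s + 1 + s.factorial) S {fun ω => (M ω).det} := by
  have hfactorial : Fintype.card (Equiv.Perm V) ≤ s.factorial := by
    rw [Fintype.card_perm]
    exact Nat.factorial_le hs
  have hterm : ∀ σ : Equiv.Perm V, ComputableFrom inp (s + 1) (s + 1) S
      {fun ω => ((Equiv.Perm.sign σ : ℤ) : ℝ) * ∏ i, M ω (σ i) i} := fun σ =>
    ((computableFrom_prod hS (f := fun i ω => M ω (σ i) i) univ fun i _ => hM _ _).trans
      (computableFrom_mul (a := fun _ => ((Equiv.Perm.sign σ : ℤ) : ℝ))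
        (Or.inl (hS (by simpa using ratCast_mem_freeFunctions inp ((Equiv.Perm.sign σ : ℤ) : ℚ))))
        (Or.inr rfl))).mono_cost (by simpa using hs) (by simpa using hs)
  have hsum := computableFrom_sum (hS.trans Set.subset_union_left)
    (f := fun σ ω => ((Equiv.Perm.sign σ : ℤ) : ℝ) * ∏ i, M ω (σ i) i) s.factorial univ
    (S := S ∪ Set.range fun (σ : Equiv.Perm V) ω =>
      ((Equiv.Perm.sign σ : ℤ) : ℝ) * ∏ i, M ω (σ i) i)
    (fun σ _ => Or.inr ⟨σ, rfl⟩) (by rw [card_univ]; exact hfactorial.trans Nat.lt_two_pow_self.le)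
  refine ((ComputableFrom.range hterm).trans hsum).mono ?_ le_rfl subset_rfl
    (Set.singleton_subset_iff.2 (funext fun ω => det_apply' (M ω)))
  rw [sum_const, card_univ, smul_eq_mul, Nat.mul_succ _ (s + 1)]
  exact add_le_add (Nat.mul_le_mul_right _ hfactorial) ((Nat.sub_le _ _).trans hfactorial)

lemma inv_mulVec_eq_cramer {A : Matrix V V ℝ} (h : IsUnit A.det) (b : V → ℝ) :
    A⁻¹ *ᵥ b = fun v => (A.updateCol v b).det / A.det := by
  funext v
  rw [eq_div_iff h.ne_zero, mul_comm, ← cramer_apply, ← det_smul_inv_mulVec_eq_cramer A b h,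
    Pi.smul_apply, smul_eq_mul]

lemma computableFrom_inv_mulVec (hS : freeFunctions inp ⊆ S)
    (hM : ∀ u v, (fun ω => M ω u v) ∈ S) (hdet : ∀ ω, IsUnit (M ω).det) {b : V → Ω → ℝ}
    (hb : Set.range b ⊆ S) (hs : Fintype.card V ≤ s) :
    ComputableFrom inp ((s + 1) * (s.factorial * (s + 2)) + s) (s + 1 + s.factorial + 1) S
      (Set.range fun v ω => ((M ω)⁻¹ *ᵥ fun u => b u ω) v) := by
  have hcramer : ∀ v, ComputableFrom inp (s.factorial * (s + 2)) (s + 1 + s.factorial) S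
      {fun ω => ((M ω).updateCol v fun u => b u ω).det} := fun v => by
    refine computableFrom_det hS (fun u w => ?_) hs
    by_cases hw : w = v
    · subst hw
      simpa using hb ⟨u, rfl⟩
    · simpa [hw] using hM u w
  have hquotients := ((ComputableFrom.range hcramer).union (computableFrom_det hS hM hs)).trans
    (computableFrom_vec_div (x := fun v ω => ((M ω).updateCol v fun u => b u ω).det)
      (y := fun _ ω => (M ω).det) (fun f hf => Or.inr (Or.inl hf))
      (by rintro _ ⟨v, rfl⟩; exact Or.inr (Or.inr rfl)) fun _ ω => (hdet ω).ne_zero)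
  refine hquotients.mono ?_ le_rfl subset_rfl (subset_of_eq (congrArg Set.range ?_))
  · rw [sum_const, card_univ, smul_eq_mul, ← Nat.succ_mul]
    exact add_le_add (Nat.mul_le_mul_right _ (Nat.succ_le_succ hs)) hs
  · funext v ω
    rw [inv_mulVec_eq_cramer (hdet ω)]

end Cramer

end Circuits

lemma Gates.depths_le {I : Type} {k : ℕ} (g : Gates I k) (j : Fin k) : g.depths j ≤ k := by
  induction g with
  | nil => exact j.elim0
  | @snoc k c op a b ih =>
    have hoperand : ∀ o : Operand I k, o.depth c.depths ≤ k := fun o => by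
      cases o with
      | input i => exact Nat.zero_le _
      | const q => exact Nat.zero_le _
      | gate j => exact ih j
    refine Fin.lastCases ?_ (fun j => ?_) j
    · simp only [Gates.depths, Fin.snoc_last]
      exact Nat.succ_le_succ (max_le (hoperand a) (hoperand b))
    · simp only [Gates.depths, Fin.snoc_castSucc]
      exact (ih j).trans (Nat.le_succ k)

lemma Circuit.depth_le_work {I O : Type} (c : Circuit I O) : c.depth ≤ c.work :=
  Finset.sup_le fun j _ => c.gates.depths_le j

/-! ### Jacobi iteration -/

section SimultaneousDiagonalization

variable {ι : Type*} [Fintype ι] [DecidableEq ι] {T : Matrix ι ι ℝ}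

lemma quadForm_transpose_mul_diagonal_mul (T : Matrix ι ι ℝ) (d y : ι → ℝ) :
    quadForm (Tᵀ * diagonal d * T) y = ∑ i, d i * (T *ᵥ y) i ^ 2 := by
  rw [quadForm_transpose_mul_mul, quadForm_diagonal]

lemma exists_quadForm_eq_eigenvalue (hT : IsUnit T.det) (i : ι) :
    ∃ y, quadForm (Tᵀ * T) y = 1 ∧ ∀ d, quadForm (Tᵀ * diagonal d * T) y = d i := by
  have heigenvector : T *ᵥ (T⁻¹ *ᵥ Pi.single i 1) = Pi.single i 1 := by
    rw [mulVec_mulVec, mul_nonsing_inv _ hT, one_mulVec]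
  refine ⟨T⁻¹ *ᵥ Pi.single i 1, ?_, fun d => ?_⟩
  · rw [quadForm_transpose_mul_self, heigenvector]
    simp
  · rw [quadForm_transpose_mul_diagonal_mul, heigenvector]
    simp [Pi.single_apply]

lemma transpose_mulVec_injective (hT : IsUnit T.det) : Function.Injective (Tᵀ *ᵥ ·) :=
  mulVec_injective_of_isUnit ((isUnit_iff_isUnit_det _).2 (isUnit_det_transpose T hT))

end SimultaneousDiagonalization

section Jacobi

variable {ι : Type*} [Fintype ι]

/-- The `k`-th iterate, started at `0`, of the Jacobi iteration `y ↦ y + X⁻¹ (b - A y)`, where `X`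
is the diagonal matrix with the entries `x`. -/
noncomputable def jacobi (A : Matrix ι ι ℝ) (x b : ι → ℝ) : ℕ → ι → ℝ
  | 0 => 0
  | k + 1 => fun i => jacobi A x b k i + (b i - (A *ᵥ jacobi A x b k) i) / x i

lemma inv_geom_sum_neg_bounds {l β : ℝ} (h₀ : 0 ≤ l) (hl : l ≤ β) (hβ : β ≤ 1 / 2) {k : ℕ}
    (hk : Even k) (hk₂ : 2 ≤ k) :
    0 < ∑ j ∈ range k, (-l) ^ j ∧ 1 + l ≤ (∑ j ∈ range k, (-l) ^ j)⁻¹ ∧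
      (∑ j ∈ range k, (-l) ^ j)⁻¹ ≤ 1 + l + 2 * β ^ (k - 1) * l := by
  have hsum : ∑ j ∈ range k, (-l) ^ j = (1 - l ^ k) / (1 + l) := by
    rw [eq_div_iff (by linarith), ← hk.neg_pow l, ← mul_neg_geom_sum, sub_neg_eq_add, mul_comm]
  have hpow_nonneg : 0 ≤ l ^ k := pow_nonneg h₀ k
  have hpow_le : l ^ k ≤ 1 / 4 := by
    calc l ^ k ≤ l ^ 2 := pow_le_pow_of_le_one h₀ (by linarith) hk₂
      _ ≤ (1 / 2) ^ 2 := by gcongr; linarith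
      _ = 1 / 4 := by norm_num
  have hpow_le' : l ^ k ≤ β ^ (k - 1) * l := by
    calc l ^ k = l ^ (k - 1) * l := by rw [← pow_succ, Nat.sub_add_cancel (by omega)]
      _ ≤ β ^ (k - 1) * l := by gcongr
  have hpos : 0 < 1 - l ^ k := by linarith
  rw [hsum, inv_div]
  refine ⟨div_pos hpos (by linarith), ?_, ?_⟩
  · rw [le_div_iff₀ hpos]
    nlinarith
  · rw [div_le_iff₀ hpos]
    nlinarith [mul_nonneg (hpow_nonneg.trans hpow_le') (by linarith : 0 ≤ 1 / 2 - l ^ k)]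

variable [DecidableEq ι] {x : ι → ℝ} {L : Matrix ι ι ℝ}

-- In a basis of eigenvectors, the iteration sums a geometric series.
lemma mulVec_jacobi {T : Matrix ι ι ℝ} {l : ι → ℝ} (hx : ∀ i, x i ≠ 0) (hT : IsUnit T.det)
    (hX : diagonal x = Tᵀ * T) (hL : L = Tᵀ * diagonal l * T) (c : ι → ℝ) (k : ℕ) :
    T *ᵥ jacobi (diagonal x + L) x (Tᵀ *ᵥ c) k =
      fun i => (∑ j ∈ range k, (-l i) ^ j) * c i := by
  induction k with
  | zero => ext i; simp [jacobi]
  | succ k ih =>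
    set y := jacobi (diagonal x + L) x (Tᵀ *ᵥ c) k
    set u : ι → ℝ := fun i => ((Tᵀ *ᵥ c) i - ((diagonal x + L) *ᵥ y) i) / x i with hu
    have hstep : jacobi (diagonal x + L) x (Tᵀ *ᵥ c) (k + 1) = y + u := rfl
    have hXu : diagonal x *ᵥ u = Tᵀ *ᵥ c - (diagonal x + L) *ᵥ y := by
      ext i
      rw [mulVec_diagonal, hu, Pi.sub_apply, mul_div_cancel₀ _ (hx i)]
    have hTu : T *ᵥ u = c - (T *ᵥ y + diagonal l *ᵥ (T *ᵥ y)) := by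
      apply transpose_mulVec_injective hT
      simp only [mulVec_sub, mulVec_add, mulVec_mulVec, ← Matrix.mul_assoc]
      rw [← hX, ← hL, hXu, add_mulVec]
    rw [hstep, mulVec_add, hTu, ih]
    ext i
    simp only [Pi.add_apply, Pi.sub_apply, mulVec_diagonal, geom_sum_succ]
    ring

lemma jacobi_eq_inv_mulVec {T : Matrix ι ι ℝ} {l : ι → ℝ} {k : ℕ} (hx : ∀ i, x i ≠ 0)
    (hT : IsUnit T.det) (hX : diagonal x = Tᵀ * T) (hL : L = Tᵀ * diagonal l * T)
    (hk : ∀ i, ∑ j ∈ range k, (-l i) ^ j ≠ 0) (b : ι → ℝ) :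
    jacobi (diagonal x + L) x b k =
      (Tᵀ * diagonal (fun i => (∑ j ∈ range k, (-l i) ^ j)⁻¹) * T)⁻¹ *ᵥ b := by
  set Y := Tᵀ * diagonal (fun i => (∑ j ∈ range k, (-l i) ^ j)⁻¹) * T with hY
  have hYdet : IsUnit Y.det := by
    simp [hY, isUnit_iff_ne_zero, hT.ne_zero, prod_ne_zero_iff, hk]
  obtain ⟨c, rfl⟩ : ∃ c, Tᵀ *ᵥ c = b := ⟨Tᵀ⁻¹ *ᵥ b, by
    rw [mulVec_mulVec, mul_nonsing_inv _ (isUnit_det_transpose T hT), one_mulVec]⟩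
  have hsolves : Y *ᵥ jacobi (diagonal x + L) x (Tᵀ *ᵥ c) k = Tᵀ *ᵥ c := by
    rw [hY, ← mulVec_mulVec, ← mulVec_mulVec, mulVec_jacobi hx hT hX hL]
    congr 1
    ext i
    rw [mulVec_diagonal, inv_mul_cancel_left₀ (hk i)]
  rw [← hsolves, mulVec_mulVec, nonsing_inv_mul _ hYdet, one_mulVec, hsolves]

theorem exists_jacobi_operator {β : ℝ} {k : ℕ} (hx : ∀ i, 0 < x i) (hL : L.IsSymm)
    (hL₀ : ∀ y, 0 ≤ quadForm L y) (hLβ : ∀ y, quadForm L y ≤ β * quadForm (diagonal x) y)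
    (hβ : β ≤ 1 / 2) (hk : Even k) (hk₂ : 2 ≤ k) :
    ∃ Y : Matrix ι ι ℝ, Y.PosDef ∧ (∀ y, quadForm (diagonal x + L) y ≤ quadForm Y y) ∧
      (∀ y, quadForm Y y ≤ quadForm (diagonal x + L) y + 2 * β ^ (k - 1) * quadForm L y) ∧
      ∀ b, jacobi (diagonal x + L) x b k = Y⁻¹ *ᵥ b := by
  obtain ⟨T, l, hT, hX, hLT⟩ :=
    exists_simultaneous_diagonalization (posDef_diagonal_iff.2 hx) hL
  have hl : ∀ i, 0 ≤ l i ∧ l i ≤ β := fun i => by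
    obtain ⟨y, hXy, hLy⟩ := exists_quadForm_eq_eigenvalue hT i
    have h₀ := hL₀ y
    have hβ := hLβ y
    rw [hX, hXy, hLT, hLy, mul_one] at hβ
    rw [hLT, hLy] at h₀
    exact ⟨h₀, hβ⟩
  have hbounds := fun i => inv_geom_sum_neg_bounds (hl i).1 (hl i).2 hβ hk hk₂
  set Y : Matrix ι ι ℝ := Tᵀ * diagonal (fun i => (∑ j ∈ range k, (-l i) ^ j)⁻¹) * T with hY
  have hsum : ∀ y, quadForm (diagonal x + L) y = ∑ i, (1 + l i) * (T *ᵥ y) i ^ 2 := fun y => by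
    rw [quadForm_add, hX, hLT, quadForm_transpose_mul_self, quadForm_transpose_mul_diagonal_mul]
    simp only [dotProduct, ← sq, add_mul, one_mul, sum_add_distrib]
  have hlower : ∀ y, quadForm (diagonal x + L) y ≤ quadForm Y y := fun y => by
    rw [hsum, hY, quadForm_transpose_mul_diagonal_mul]
    gcongr with i
    exact (hbounds i).2.1
  refine ⟨Y, posDef_iff_quadForm.2 ⟨?_, fun y hy => ?_⟩, hlower, fun y => ?_,
    fun b => jacobi_eq_inv_mulVec (fun i => (hx i).ne') hT hX hLT (fun i => (hbounds i).1.ne') b⟩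
  · simp [Matrix.IsSymm, hY, Matrix.mul_assoc]
  · refine lt_of_lt_of_le ?_ (hlower y)
    rw [quadForm_add]
    linarith [quadForm_pos (posDef_diagonal_iff.2 hx) hy, hL₀ y]
  · rw [hsum, hY, hLT]
    simp only [quadForm_transpose_mul_diagonal_mul, mul_sum, ← sum_add_distrib, ← mul_assoc,
      ← add_mul]
    gcongr with i
    exact (hbounds i).2.2

end Jacobi

/-! ### Approximate block elimination -/

section Comparison

variable {ι κ : Type*} [Fintype ι] [Fintype κ]
  {A Y : Matrix ι ι ℝ} {B : Matrix ι κ ℝ} {D S₁ S₂ : Matrix κ κ ℝ} {c : ℝ}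

lemma quadForm_fromBlocks_eq_add_sub (A Y : Matrix ι ι ℝ) (B : Matrix ι κ ℝ) (D : Matrix κ κ ℝ)
    (x : ι → ℝ) (y : κ → ℝ) :
    quadForm (fromBlocks Y B Bᵀ D) (Sum.elim x y) =
      quadForm (fromBlocks A B Bᵀ D) (Sum.elim x y) + (quadForm Y x - quadForm A x) := by
  have hsplit : fromBlocks Y B Bᵀ D = fromBlocks A B Bᵀ D + fromBlocks (Y - A) 0 0 0 := by
    simp [fromBlocks_add]
  rw [hsplit, quadForm_add, ← quadForm_sub]
  simp [quadForm, fromBlocks_mulVec]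

variable [DecidableEq ι]

-- The Schur complement is what remains of the quadratic form after minimization over `x`.
lemma quadForm_schur_le_fromBlocks (hA : A.PosDef) (B : Matrix ι κ ℝ) (D : Matrix κ κ ℝ)
    (x : ι → ℝ) (y : κ → ℝ) :
    quadForm (D - Bᵀ * A⁻¹ * B) y ≤ quadForm (fromBlocks A B Bᵀ D) (Sum.elim x y) := by
  rw [quadForm_fromBlocks (isSymm_of_posDef hA) (isUnit_det_of_posDef hA)]
  exact le_add_of_nonneg_left (quadForm_nonneg hA _)

lemma quadForm_schur_mono (hA : A.PosDef) (hY : Y.PosDef)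
    (h : ∀ x y, quadForm (fromBlocks A B Bᵀ D) (Sum.elim x y) ≤
      c * quadForm (fromBlocks Y B Bᵀ D) (Sum.elim x y)) (y : κ → ℝ) :
    quadForm (D - Bᵀ * A⁻¹ * B) y ≤ c * quadForm (D - Bᵀ * Y⁻¹ * B) y := by
  have hminimizer := (quadForm_schur_le_fromBlocks hA B D _ y).trans (h (-(Y⁻¹ *ᵥ (B *ᵥ y))) y)
  rwa [quadForm_fromBlocks (isSymm_of_posDef hY) (isUnit_det_of_posDef hY), neg_add_cancel,
    quadForm_zero, zero_add] at hminimizer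

lemma quadForm_fromBlocks_le_of_schur_le (hY : Y.PosDef) (hc : 1 ≤ c)
    (h : ∀ y, quadForm S₁ y ≤ c * quadForm S₂ y) (x : ι → ℝ) (y : κ → ℝ) :
    quadForm (fromBlocks Y B Bᵀ (S₁ + Bᵀ * Y⁻¹ * B)) (Sum.elim x y) ≤
      c * quadForm (fromBlocks Y B Bᵀ (S₂ + Bᵀ * Y⁻¹ * B)) (Sum.elim x y) := by
  have hYsymm := isSymm_of_posDef hY
  have hYdet := isUnit_det_of_posDef hY
  rw [quadForm_fromBlocks hYsymm hYdet, quadForm_fromBlocks hYsymm hYdet, add_sub_cancel_right,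
    add_sub_cancel_right, mul_add]
  exact add_le_add (le_mul_of_one_le_left (quadForm_nonneg hY _) hc) (h y)

end Comparison

section ApproxFromBlocks

lemma posDef_of_approx {ι : Type} [Fintype ι] {ε : ℝ} {A B : Matrix ι ι ℝ} (hB : B.PosDef)
    (h : Approx ε A B) : A.PosDef := by
  have := (hB.smul (Real.exp_pos (-ε))).add_posSemidef h.2
  rwa [add_sub_cancel] at this

variable {ι κ : Type} [Fintype ι] [DecidableEq ι] [Fintype κ] {A Y : Matrix ι ι ℝ}
  {B : Matrix ι κ ℝ} {D S : Matrix κ κ ℝ} {ε η : ℝ}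

theorem approx_fromBlocks (hK : (fromBlocks A B Bᵀ D).PosDef) (hY : Y.PosDef)
    (hAY : ∀ x, quadForm A x ≤ quadForm Y x)
    (hYA : ∀ x y, quadForm Y x ≤
      quadForm A x + ε * quadForm (fromBlocks A B Bᵀ D) (Sum.elim x y))
    (hS : Approx η S (D - Bᵀ * A⁻¹ * B)) (hε : 0 ≤ ε) (hη : 0 ≤ η) :
    Approx (η + ε) (fromBlocks Y B Bᵀ (S + Bᵀ * Y⁻¹ * B)) (fromBlocks A B Bᵀ D) := by
  have hA := posDef_of_fromBlocks hK
  have hschur := posDef_schur_of_fromBlocks hK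
  have hSpos := posDef_of_approx hschur hS
  set R := D - Bᵀ * Y⁻¹ * B with hR
  have hRD : R + Bᵀ * Y⁻¹ * B = D := sub_add_cancel _ _
  have hupper : ∀ x y, quadForm (fromBlocks Y B Bᵀ D) (Sum.elim x y) ≤
      Real.exp ε * quadForm (fromBlocks A B Bᵀ D) (Sum.elim x y) := fun x y => by
    rw [quadForm_fromBlocks_eq_add_sub A Y]
    nlinarith [hYA x y, Real.add_one_le_exp ε, quadForm_nonneg hK (Sum.elim x y)]
  have hlower : ∀ x y, quadForm (fromBlocks A B Bᵀ D) (Sum.elim x y) ≤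
      quadForm (fromBlocks Y B Bᵀ D) (Sum.elim x y) := fun x y => by
    rw [quadForm_fromBlocks_eq_add_sub A Y]
    linarith [hAY x]
  rw [approx_iff_quadForm (isSymm_of_posDef hSpos) (isSymm_of_posDef hschur)] at hS
  have hSR : ∀ y, quadForm S y ≤ Real.exp η * quadForm R y := fun y =>
    (hS y).1.trans (mul_le_mul_of_nonneg_left
      (by simpa using quadForm_schur_mono hA hY (c := 1) (by simpa using hlower) y)
      (Real.exp_pos η).le)
  have hRS : ∀ y, quadForm R y ≤ Real.exp (η + ε) * quadForm S y := fun y => by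
    have hle := (hS y).2
    rw [Real.exp_neg, inv_mul_le_iff₀ (Real.exp_pos η)] at hle
    rw [add_comm η, Real.exp_add, mul_assoc]
    exact (quadForm_schur_mono hY hA hupper y).trans
      (mul_le_mul_of_nonneg_left hle (Real.exp_pos ε).le)
  have hsymm : (fromBlocks Y B Bᵀ (S + Bᵀ * Y⁻¹ * B)).IsSymm :=
    (isSymm_of_posDef hY).fromBlocks rfl ((isSymm_of_posDef hSpos).add
      (by simp [Matrix.IsSymm, Matrix.mul_assoc, (isSymm_of_posDef hY.inv).eq]))
  rw [approx_iff_quadForm hsymm (isSymm_of_posDef hK)]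
  intro z
  obtain ⟨x, y, rfl⟩ : ∃ x y, z = Sum.elim x y := ⟨_, _, (Sum.elim_comp_inl_inr z).symm⟩
  have h₁ := quadForm_fromBlocks_le_of_schur_le (B := B) hY (Real.one_le_exp hη) hSR x y
  have h₂ := quadForm_fromBlocks_le_of_schur_le (B := B) hY (Real.one_le_exp (add_nonneg hη hε))
    hRS x y
  rw [hRD] at h₁ h₂
  constructor
  · rw [Real.exp_add, mul_assoc]
    exact h₁.trans (mul_le_mul_of_nonneg_left (hupper x y) (Real.exp_pos η).le)
  · rw [Real.exp_neg, inv_mul_le_iff₀ (Real.exp_pos _)]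
    exact (hlower x y).trans h₂

end ApproxFromBlocks

section BlockElimination

variable {ι κ : Type*} [Fintype ι] [DecidableEq ι] [Fintype κ] [DecidableEq κ]

lemma fromBlocks_mulVec_blockElimination {Y : Matrix ι ι ℝ} {B : Matrix ι κ ℝ} {S : Matrix κ κ ℝ}
    (hY : IsUnit Y.det) (hS : IsUnit S.det) (a : ι → ℝ) (c z : κ → ℝ)
    (hz : z = S⁻¹ *ᵥ (c - Bᵀ *ᵥ (Y⁻¹ *ᵥ a))) :
    fromBlocks Y B Bᵀ (S + Bᵀ * Y⁻¹ * B) *ᵥ Sum.elim (Y⁻¹ *ᵥ (a - B *ᵥ z)) z =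
      Sum.elim a c := by
  have hSz : S *ᵥ z = c - Bᵀ *ᵥ (Y⁻¹ *ᵥ a) := by
    rw [hz, mulVec_mulVec, mul_nonsing_inv _ hS, one_mulVec]
  rw [fromBlocks_mulVec]
  simp only [Sum.elim_comp_inl, Sum.elim_comp_inr]
  congr 1
  · rw [mulVec_mulVec, mul_nonsing_inv _ hY, one_mulVec, sub_add_cancel]
  · rw [mulVec_sub, mulVec_sub, add_mulVec, hSz, ← mulVec_mulVec, ← mulVec_mulVec]
    abel

end BlockElimination

section StronglyDominant

lemma laplacian_le_two_mul_offDiag {ι : Type*} [Fintype ι] [DecidableEq ι] {A : Matrix ι ι ℝ}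
    (hA : A.IsSymm) (y : ι → ℝ) :
    ∑ i, ∑ j, (-A i j) / 2 * (y i - y j) ^ 2 ≤
      2 * ∑ i, (∑ j ∈ univ.erase i, |A i j|) * y i ^ 2 := by
  set w : ι → ι → ℝ := fun i j => if i = j then 0 else |A i j| with hw
  have hwsymm : ∀ i j, w i j = w j i := fun i j => by
    simp only [hw, eq_comm, hA.apply i j]
  have hrow : ∀ i, ∑ j, w i j = ∑ j ∈ univ.erase i, |A i j| := fun i => by
    simp [hw, sum_ite, filter_ne]
  have hterm : ∀ i j, (-A i j) / 2 * (y i - y j) ^ 2 ≤ w i j * y i ^ 2 + w j i * y j ^ 2 := by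
    intro i j
    by_cases h : i = j
    · simp [hw, h]
    · rw [← hwsymm i j]
      simp only [hw, h, if_false]
      nlinarith [neg_abs_le (A i j), abs_nonneg (A i j), sq_nonneg (y i + y j),
        sq_nonneg (y i - y j)]
  calc ∑ i, ∑ j, (-A i j) / 2 * (y i - y j) ^ 2
      ≤ ∑ i, ∑ j, (w i j * y i ^ 2 + w j i * y j ^ 2) :=
        sum_le_sum fun i _ => sum_le_sum fun j _ => hterm i j
    _ = 2 * ∑ i, (∑ j, w i j) * y i ^ 2 := by
        simp only [sum_add_distrib, sum_mul]
        rw [sum_comm (f := fun i j => w j i * y j ^ 2), two_mul]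
    _ = 2 * ∑ i, (∑ j ∈ univ.erase i, |A i j|) * y i ^ 2 := by simp only [hrow]

variable {ι κ : Type} [Fintype ι] [DecidableEq ι] [Fintype κ] [DecidableEq κ] {A : Matrix ι ι ℝ}
  {α : ℝ}

lemma IsStronglyDD.mul_offDiag_le_rowSum (h : IsStronglyDD α A)
    (hoff : ∀ i j, i ≠ j → A i j ≤ 0) (i : ι) :
    α * ∑ j ∈ univ.erase i, |A i j| ≤ ∑ j, A i j := by
  linarith [h.2 i, sum_abs_erase_of_offDiag_nonpos hoff i]

lemma IsStronglyDD.rowSum_pos (h : IsStronglyDD α A) (hA : A.PosDef)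
    (hoff : ∀ i j, i ≠ j → A i j ≤ 0) (hα : 0 < α) (i : ι) : 0 < ∑ j, A i j := by
  have hdominant := h.mul_offDiag_le_rowSum hoff i
  have hsum := sum_abs_erase_of_offDiag_nonpos hoff i
  have hoffDiag : 0 ≤ ∑ j ∈ univ.erase i, |A i j| := sum_nonneg fun j _ => abs_nonneg _
  rcases hoffDiag.eq_or_lt with hzero | hpos
  · linarith [hA.diag_pos (i := i)]
  · exact (mul_pos hα hpos).trans_le hdominant

lemma IsStronglyDD.laplacian_le (h : IsStronglyDD α A) (hoff : ∀ i j, i ≠ j → A i j ≤ 0)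
    (hα : 0 < α) (y : ι → ℝ) :
    ∑ i, ∑ j, (-A i j) / 2 * (y i - y j) ^ 2 ≤ 2 / α * ∑ i, (∑ j, A i j) * y i ^ 2 := by
  refine (laplacian_le_two_mul_offDiag h.1 y).trans ?_
  rw [div_mul_eq_mul_div, le_div_iff₀ hα, mul_assoc, sum_mul]
  refine mul_le_mul_of_nonneg_left (sum_le_sum fun i _ => ?_) two_pos.le
  rw [mul_right_comm, mul_comm _ α]
  exact mul_le_mul_of_nonneg_right (h.mul_offDiag_le_rowSum hoff i) (sq_nonneg _)

lemma IsStronglyDD.exists_jacobi_operator (h : IsStronglyDD α A) (hA : A.PosDef)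
    (hoff : ∀ i j, i ≠ j → A i j ≤ 0) (hα : 4 ≤ α) {k : ℕ} (hk : Even k) (hk₂ : 2 ≤ k) :
    ∃ Y : Matrix ι ι ℝ, Y.PosDef ∧ (∀ y, quadForm A y ≤ quadForm Y y) ∧
      (∀ y, quadForm Y y ≤ quadForm A y +
        2 * (2 / α) ^ (k - 1) * ∑ i, ∑ j, (-A i j) / 2 * (y i - y j) ^ 2) ∧
      ∀ b, jacobi A (fun i => ∑ j, A i j) b k = Y⁻¹ *ᵥ b := by
  set x : ι → ℝ := fun i => ∑ j, A i j with hx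
  have hα₀ : 0 < α := by linarith
  have hL : ∀ y, quadForm (A - diagonal x) y = ∑ i, ∑ j, (-A i j) / 2 * (y i - y j) ^ 2 :=
    fun y => by
      rw [quadForm_sub, quadForm_eq_laplacian h.1, quadForm_diagonal]
      ring
  have hLX : ∀ y, quadForm (A - diagonal x) y ≤ 2 / α * quadForm (diagonal x) y := fun y => by
    rw [hL, quadForm_diagonal]
    exact h.laplacian_le hoff hα₀ y
  have hL₀ : ∀ y, 0 ≤ quadForm (A - diagonal x) y := fun y => by
    rw [hL]
    exact sum_nonneg fun i _ => sum_nonneg fun j _ => laplacian_summand_nonneg hoff y i j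
  have hβ : 2 / α ≤ 1 / 2 := by
    rw [div_le_div_iff₀ hα₀ two_pos]
    linarith
  have hoperator := SparseChol.exists_jacobi_operator (h.rowSum_pos hA hoff hα₀)
    (h.1.sub (isSymm_diagonal x)) hL₀ hLX hβ hk hk₂
  rw [← hx, add_sub_cancel] at hoperator
  simpa only [hL] using hoperator

lemma IsSDDM.laplacian_le_quadForm_fromBlocks {B : Matrix ι κ ℝ} {D : Matrix κ κ ℝ}
    (h : IsSDDM (fromBlocks A B Bᵀ D)) (u : ι → ℝ) (v : κ → ℝ) :
    ∑ i, ∑ j, (-A i j) / 2 * (u i - u j) ^ 2 ≤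
      quadForm (fromBlocks A B Bᵀ D) (Sum.elim u v) := by
  set K := fromBlocks A B Bᵀ D
  set z := Sum.elim u v
  have hrows : 0 ≤ ∑ i, (∑ j, K i j) * z i ^ 2 :=
    sum_nonneg fun i _ => mul_nonneg (h.rowSum_nonneg i) (sq_nonneg _)
  have hsummand := laplacian_summand_nonneg h.offDiag_nonpos z
  rw [quadForm_eq_laplacian h.symm]
  refine le_add_of_nonneg_of_le hrows ?_
  rw [Fintype.sum_sum_type]
  refine le_add_of_le_of_nonneg (sum_le_sum fun i _ => ?_)
    (sum_nonneg fun i _ => sum_nonneg fun j _ => hsummand _ j)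
  rw [Fintype.sum_sum_type]
  exact le_add_of_nonneg_right (sum_nonneg fun j _ => hsummand _ _)

end StronglyDominant

section LevelSolve

variable {ι : Type} [DecidableEq ι] {V F : Finset ι} {M : Matrix V V ℝ}
  {S S' : Matrix ↥(V \ F) ↥(V \ F) ℝ} {k : ℕ}

/-- The approximation of `M_{FF}⁻¹ c` by `k` steps of the Jacobi iteration; the preconditioner is
the diagonal matrix of the row sums of `M_{FF}`. -/
noncomputable def fineSolve (M : Matrix V V ℝ) (F : Finset ι) (k : ℕ)
    (c : {v : ↥V // (v : ι) ∈ F} → ℝ) : {v : ↥V // (v : ι) ∈ F} → ℝ :=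
  jacobi (blockFF M F) (fun i => ∑ j, blockFF M F i j) c k

/-- Approximate block elimination of the rows in `F` from `M x = b`, where `W` is an approximate
inverse of the Schur complement. -/
noncomputable def levelSolve (M : Matrix V V ℝ) (F : Finset ι) (k : ℕ)
    (W : Matrix ↥(V \ F) ↥(V \ F) ℝ) (b : V → ℝ) : V → ℝ :=
  let z := W *ᵥ (b ∘ coarse V F -
    M.submatrix (coarse V F) (fine V F) *ᵥ fineSolve M F k (b ∘ fine V F))
  Sum.elim (fineSolve M F k (b ∘ fine V F - M.submatrix (fine V F) (coarse V F) *ᵥ z)) z ∘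
    (splitEquiv V F).symm

lemma submatrix_mulVec_levelSolve {Y : Matrix {v : ↥V // (v : ι) ∈ F} {v : ↥V // (v : ι) ∈ F} ℝ}
    {B : Matrix {v : ↥V // (v : ι) ∈ F} ↥(V \ F) ℝ} (hM : M.IsSymm)
    (hB : B = M.submatrix (fine V F) (coarse V F)) (hY : IsUnit Y.det) (hS : IsUnit S.det)
    (hsolve : ∀ c, fineSolve M F k c = Y⁻¹ *ᵥ c) (b : V → ℝ) :
    (fromBlocks Y B Bᵀ (S + Bᵀ * Y⁻¹ * B)).submatrix (splitEquiv V F).symm (splitEquiv V F).symm *ᵥ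
      levelSolve M F k S⁻¹ b = b := by
  have hBt : M.submatrix (coarse V F) (fine V F) = Bᵀ := by
    rw [hB, transpose_submatrix, hM.eq]
  rw [submatrix_mulVec_equiv, Equiv.symm_symm, levelSolve, Function.comp_assoc,
    Equiv.symm_comp_self, Function.comp_id, ← hB, hBt, hsolve, hsolve,
    fromBlocks_mulVec_blockElimination hY hS _ (b ∘ coarse V F) _ rfl]
  have hsplit : Sum.elim (b ∘ fine V F) (b ∘ coarse V F) = b ∘ splitEquiv V F := by
    ext (v | v) <;> rfl
  rw [hsplit, Function.comp_assoc, Equiv.self_comp_symm, Function.comp_id]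

theorem exists_level_operator {α ε η : ℝ} (hM : IsSDDM M) (hα : 4 ≤ α)
    (hdd : IsStronglyDD α (blockFF M F)) (hk : Even k) (hk₂ : 2 ≤ k)
    (hkε : 2 * (2 / α) ^ (k - 1) ≤ ε) (hε : 0 ≤ ε) (hη : 0 ≤ η)
    (hSS' : Approx η S S') (hS' : Approx ε S' (schur M F)) :
    ∃ N : Matrix V V ℝ, N.PosDef ∧ Approx (η + 2 * ε) N M ∧
      ∀ b, N⁻¹ *ᵥ b = levelSolve M F k S⁻¹ b := by
  have hSpos := posDef_of_approx (posDef_of_approx (hM.schur F).posDef hS') hSS'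
  have hS := hSS'.trans hS'
  rw [schur_eq hM.symm] at hS
  set e := splitEquiv V F
  set A := blockFF M F
  set B := M.submatrix (fine V F) (coarse V F) with hB
  set K := fromBlocks A B Bᵀ (M.submatrix (coarse V F) (coarse V F)) with hK
  have hMK : M.submatrix e e = K := submatrix_splitEquiv hM.symm F
  have hKsddm : IsSDDM K := hMK ▸ hM.submatrix_equiv e
  have hoff : ∀ i j, i ≠ j → A i j ≤ 0 := fun i j hij =>
    hKsddm.offDiag_nonpos (Sum.inl i) (Sum.inl j) (by simpa using hij)
  obtain ⟨Y, hY, hAY, hYA, hsolve⟩ :=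
    hdd.exists_jacobi_operator (posDef_of_fromBlocks hKsddm.posDef) hoff hα hk hk₂
  have hYK : ∀ x y, quadForm Y x ≤ quadForm A x + ε * quadForm K (Sum.elim x y) := fun x y =>
    (hYA x).trans (add_le_add_right (mul_le_mul hkε (hKsddm.laplacian_le_quadForm_fromBlocks x y)
      (sum_nonneg fun i _ => sum_nonneg fun j _ => laplacian_summand_nonneg hoff x i j) hε) _)
  have happrox := approx_fromBlocks hKsddm.posDef hY hAY hYK hS hε (add_nonneg hη hε)
  set P := fromBlocks Y B Bᵀ (S + Bᵀ * Y⁻¹ * B)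
  have hN : (P.submatrix e.symm e.symm).PosDef :=
    (posDef_of_approx hKsddm.posDef happrox).submatrix e.symm.injective
  refine ⟨P.submatrix e.symm e.symm, hN, ?_, fun b => ?_⟩
  · have := happrox.submatrix e.symm
    rwa [← hK, ← hMK, submatrix_submatrix, e.self_comp_symm, submatrix_id_id,
      add_assoc, ← two_mul] at this
  · conv_lhs => rw [← submatrix_mulVec_levelSolve hM.symm hB (isUnit_det_of_posDef hY)
      (isUnit_det_of_posDef hSpos) hsolve b]
    rw [mulVec_mulVec, nonsing_inv_mul _ (isUnit_det_of_posDef hN), one_mulVec]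

end LevelSolve

/-! ### Iterative refinement -/

section Richardson

variable {ι : Type*} [Fintype ι]

/-- The `t`-th iterate, started at `0`, of the iterative refinement `r ↦ r + (1 / 3) W (b - A r)`,
where `W` is an approximate inverse of `A`. -/
noncomputable def richardson (A W : Matrix ι ι ℝ) (b : ι → ℝ) : ℕ → ι → ℝ
  | 0 => 0
  | t + 1 => fun i =>
      richardson A W b t i + ((1 / 3 : ℚ) : ℝ) * (W *ᵥ fun j => b j - (A *ᵥ richardson A W b t) j) i

variable [DecidableEq ι]

lemma richardson_succ_sub {A : Matrix ι ι ℝ} (hA : IsUnit A.det) (W : Matrix ι ι ℝ) (b : ι → ℝ)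
    (t : ℕ) :
    richardson A W b (t + 1) - A⁻¹ *ᵥ b = (richardson A W b t - A⁻¹ *ᵥ b) -
      (1 / 3 : ℝ) • W *ᵥ (A *ᵥ (richardson A W b t - A⁻¹ *ᵥ b)) := by
  have hresidual : (fun j => b j - (A *ᵥ richardson A W b t) j) =
      -(A *ᵥ (richardson A W b t - A⁻¹ *ᵥ b)) := by
    rw [mulVec_sub, mulVec_mulVec, mul_nonsing_inv _ hA, one_mulVec, neg_sub]
    rfl
  ext j
  simp only [richardson, Pi.sub_apply, Pi.smul_apply, hresidual, mulVec_neg, Pi.neg_apply,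
    smul_eq_mul]
  push_cast
  ring

lemma mulVec_richardson_sub {T : Matrix ι ι ℝ} {l : ι → ℝ} (hT : IsUnit T.det)
    (hl : ∀ i, l i ≠ 0) (b : ι → ℝ) (t : ℕ) (i : ι) :
    (T *ᵥ (richardson (Tᵀ * diagonal l * T) (Tᵀ * T)⁻¹ b t -
        (Tᵀ * diagonal l * T)⁻¹ *ᵥ b)) i =
      -((1 - l i / 3) ^ t * (T *ᵥ ((Tᵀ * diagonal l * T)⁻¹ *ᵥ b)) i) := by
  set A := Tᵀ * diagonal l * T with hA
  have hAdet : IsUnit A.det := by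
    simp [hA, isUnit_iff_ne_zero, hT.ne_zero, prod_ne_zero_iff, hl]
  have hprecond : T * (Tᵀ * T)⁻¹ * A = diagonal l * T := by
    rw [Matrix.mul_inv_rev, mul_nonsing_inv_cancel_left _ _ hT, hA, Matrix.mul_assoc Tᵀ,
      nonsing_inv_mul_cancel_left _ _ (isUnit_det_transpose T hT)]
  induction t generalizing i with
  | zero => simp [richardson, mulVec_neg]
  | succ t ih =>
    rw [richardson_succ_sub hAdet, mulVec_sub, mulVec_smul, mulVec_mulVec, mulVec_mulVec,
      hprecond, ← mulVec_mulVec, Pi.sub_apply, Pi.smul_apply, mulVec_diagonal, ih, smul_eq_mul]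
    ring

end Richardson

section ApproxSolution

variable {ι : Type} [Fintype ι] [DecidableEq ι] {A N : Matrix ι ι ℝ}

lemma eigenvalue_bounds_of_approx {T : Matrix ι ι ℝ} {l : ι → ℝ} (hT : IsUnit T.det)
    (h : Approx 1 (Tᵀ * T) (Tᵀ * diagonal l * T)) (i : ι) : 1 / 3 ≤ l i ∧ l i ≤ 3 := by
  rw [approx_iff_quadForm (by simp [Matrix.IsSymm])
    (by simp [Matrix.IsSymm, Matrix.mul_assoc])] at h
  obtain ⟨y, hN, hA⟩ := exists_quadForm_eq_eigenvalue hT i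
  have hy := h y
  rw [hN, hA, Real.exp_neg, inv_mul_le_iff₀ (Real.exp_pos 1), mul_one] at hy
  have he := Real.exp_one_lt_three
  have hl : 0 < l i := pos_of_mul_pos_right (one_pos.trans_le hy.1) (Real.exp_pos 1).le
  exact ⟨by nlinarith [hy.1], hy.2.trans he.le⟩

theorem isApproxSolution_richardson (hA : A.PosDef) (hN : N.PosDef) (h : Approx 1 N A)
    (b : ι → ℝ) (t : ℕ) :
    IsApproxSolution ((9 / 10) ^ t) A b (richardson A N⁻¹ b t) := by
  obtain ⟨T, l, hT, rfl, rfl⟩ := exists_simultaneous_diagonalization hN (isSymm_of_posDef hA)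
  have hl := eigenvalue_bounds_of_approx hT h
  set A := Tᵀ * diagonal l * T
  have henergy : quadForm A (richardson A (Tᵀ * T)⁻¹ b t - A⁻¹ *ᵥ b) ≤
      ((9 / 10) ^ t) ^ 2 * quadForm A (A⁻¹ *ᵥ b) := by
    rw [quadForm_transpose_mul_diagonal_mul, quadForm_transpose_mul_diagonal_mul, mul_sum]
    refine sum_le_sum fun i _ => ?_
    obtain ⟨hlower, hupper⟩ := hl i
    have hcontract : ((1 - l i / 3) ^ t) ^ 2 ≤ ((9 / 10) ^ t) ^ 2 :=
      pow_le_pow_left₀ (pow_nonneg (by linarith) t)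
        (pow_le_pow_left₀ (by linarith) (by linarith) t) 2
    rw [mulVec_richardson_sub hT (fun i => by linarith [(hl i).1]), neg_sq, mul_pow,
      mul_left_comm]
    gcongr
  calc √(quadForm A (richardson A (Tᵀ * T)⁻¹ b t - A⁻¹ *ᵥ b))
      ≤ √(((9 / 10) ^ t) ^ 2 * quadForm A (A⁻¹ *ᵥ b)) := Real.sqrt_le_sqrt henergy
    _ = (9 / 10) ^ t * √(quadForm A (A⁻¹ *ᵥ b)) := by
      rw [Real.sqrt_mul (by positivity), Real.sqrt_sq (by positivity)]

end ApproxSolution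

/-! ### The circuit of one level -/

/-- The operator `Φ ω`, which may depend on the instance `ω`, can be applied to any given vector by
`w` gates in additional depth `δ` once the functions in `S` are available. -/
def OperatorComputableFrom {I : Type} {Ω J K : Type*} (inp : Ω → I → ℝ) (w δ : ℕ) (S : Set (Ω → ℝ))
    (Φ : Ω → (J → ℝ) → K → ℝ) : Prop :=
  ∀ c : J → Ω → ℝ, ComputableFrom inp w δ (S ∪ Set.range c)
    (Set.range fun k ω => Φ ω (fun j => c j ω) k)

namespace OperatorComputableFrom

variable {I : Type} {Ω J K L : Type*} {inp : Ω → I → ℝ} {w w' δ δ' : ℕ} {S T : Set (Ω → ℝ)}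
  {Φ Ψ : Ω → (J → ℝ) → K → ℝ}

lemma mono_cost (h : OperatorComputableFrom inp w δ S Φ) (hw : w ≤ w') (hδ : δ ≤ δ') :
    OperatorComputableFrom inp w' δ' S Φ := fun c => (h c).mono_cost hw hδ

lemma apply (h : OperatorComputableFrom inp w δ S Φ) {c : J → Ω → ℝ} (hc : Set.range c ⊆ S) :
    ComputableFrom inp w δ S (Set.range fun k ω => Φ ω (fun j => c j ω) k) :=
  (h c).mono le_rfl le_rfl (Set.union_subset subset_rfl hc) subset_rfl

lemma reindex (f : K → J) (δ : ℕ) :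
    OperatorComputableFrom inp 0 δ S fun _ c => c ∘ f := fun c =>
  .of_subset ((Set.range_comp_subset_range f c).trans Set.subset_union_right) 0 δ

lemma of_computableFrom (h : ComputableFrom inp w δ S T)
    (h' : OperatorComputableFrom inp w' δ' (S ∪ T) Φ) :
    OperatorComputableFrom inp (w + w') (δ + δ') S Φ := fun c =>
  (h.mono le_rfl le_rfl Set.subset_union_left subset_rfl).trans
    ((h' c).mono le_rfl le_rfl (Set.union_right_comm S T _).subset subset_rfl)

lemma comp {Θ : Ω → (K → ℝ) → L → ℝ} (h' : OperatorComputableFrom inp w' δ' S Θ)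
    (h : OperatorComputableFrom inp w δ S Φ) :
    OperatorComputableFrom inp (w + w') (δ + δ') S fun ω c => Θ ω (Φ ω c) := fun c =>
  (h c).trans ((h' _).mono le_rfl le_rfl
    (Set.union_subset_union_left _ Set.subset_union_left) subset_rfl)

lemma comp_sumElim {Θ : Ω → (J ⊕ K → ℝ) → L → ℝ} (h' : OperatorComputableFrom inp w' δ' S Θ)
    (h : OperatorComputableFrom inp w δ S Φ) :
    OperatorComputableFrom inp (w + w') (δ + δ') S fun ω c => Θ ω (Sum.elim c (Φ ω c)) := by
  intro c
  have hinputs : S ∪ Set.range (Sum.elim c fun k ω => Φ ω (fun j => c j ω) k) =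
      S ∪ Set.range c ∪ Set.range fun k ω => Φ ω (fun j => c j ω) k := by
    rw [Set.Sum.elim_range, Set.union_assoc]
  have hvalues : ∀ ω, (fun l => Sum.elim c (fun k ω => Φ ω (fun j => c j ω) k) l ω) =
      Sum.elim (fun j => c j ω) (Φ ω fun j => c j ω) := fun ω => by
    ext (j | k) <;> rfl
  have happly := h' (Sum.elim c fun k ω => Φ ω (fun j => c j ω) k)
  simp only [hinputs, hvalues] at happly
  exact (h c).trans happly

lemma sumElim {Θ : Ω → (J → ℝ) → L → ℝ} (h : OperatorComputableFrom inp w δ S Φ)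
    (h' : OperatorComputableFrom inp w' δ S Θ) :
    OperatorComputableFrom inp (w + w') δ S fun ω c => Sum.elim (Φ ω c) (Θ ω c) := by
  intro c
  refine ((h c).union (h' c)).mono le_rfl le_rfl subset_rfl ?_
  rintro _ ⟨k | l, rfl⟩
  exacts [Or.inl ⟨k, rfl⟩, Or.inr ⟨l, rfl⟩]

section Arithmetic

variable [Fintype K]

lemma add (h : OperatorComputableFrom inp w δ S Φ) (h' : OperatorComputableFrom inp w' δ S Ψ) :
    OperatorComputableFrom inp (w + w' + Fintype.card K) (δ + 1) S
      fun ω c => Φ ω c + Ψ ω c := fun c =>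
  ((h c).union (h' c)).trans (computableFrom_vec_add
    (Set.subset_union_left.trans Set.subset_union_right)
    (Set.subset_union_right.trans Set.subset_union_right))

lemma sub (h : OperatorComputableFrom inp w δ S Φ) (h' : OperatorComputableFrom inp w' δ S Ψ) :
    OperatorComputableFrom inp (w + w' + Fintype.card K) (δ + 1) S
      fun ω c => Φ ω c - Ψ ω c := fun c =>
  ((h c).union (h' c)).trans (computableFrom_vec_sub
    (Set.subset_union_left.trans Set.subset_union_right)
    (Set.subset_union_right.trans Set.subset_union_right))

lemma div {x : K → Ω → ℝ} (hx : Set.range x ⊆ S) (hx₀ : ∀ k ω, x k ω ≠ 0)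
    (h : OperatorComputableFrom inp w δ S Φ) :
    OperatorComputableFrom inp (w + Fintype.card K) (δ + 1) S
      fun ω c k => Φ ω c k / x k ω := fun c =>
  (h c).trans (computableFrom_vec_div Set.subset_union_right
    ((hx.trans Set.subset_union_left).trans Set.subset_union_left) hx₀)

lemma smul (hS : freeFunctions inp ⊆ S) (q : ℚ) (h : OperatorComputableFrom inp w δ S Φ) :
    OperatorComputableFrom inp (w + Fintype.card K) (δ + 1) S
      fun ω c k => (q : ℝ) * Φ ω c k := fun c =>
  (h c).trans (computableFrom_vec_smul
    ((hS.trans Set.subset_union_left).trans Set.subset_union_left) q Set.subset_union_right)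

end Arithmetic

lemma zero (hS : freeFunctions inp ⊆ S) (w δ : ℕ) :
    OperatorComputableFrom inp w δ S fun _ (_ : J → ℝ) (_ : K) => 0 := fun c => by
  refine .of_subset ?_ w δ
  rintro _ ⟨k, rfl⟩
  exact Or.inl (hS (zero_mem_freeFunctions inp))

lemma mulVec [Fintype J] [Finite K] (hS : freeFunctions inp ⊆ S) {M : Ω → Matrix K J ℝ}
    {P : Finset (K × J)} (hP : ∀ p ∈ P, (fun ω => M ω p.1 p.2) ∈ S)
    (hP₀ : ∀ ω k j, (k, j) ∉ P → M ω k j = 0) {r : ℕ} (hr : Fintype.card J ≤ 2 ^ r) :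
    OperatorComputableFrom inp (2 * #P) (r + 1) S fun ω c => M ω *ᵥ c := fun _ =>
  computableFrom_mulVec (hS.trans Set.subset_union_left) (fun p hp => Or.inl (hP p hp)) hP₀ hr
    Set.subset_union_right

lemma jacobi [Fintype J] (hS : freeFunctions inp ⊆ S) {B : Ω → Matrix J J ℝ} {P : Finset (J × J)}
    (hP : ∀ p ∈ P, (fun ω => B ω p.1 p.2) ∈ S) (hP₀ : ∀ ω i j, (i, j) ∉ P → B ω i j = 0) {r : ℕ}
    (hr : Fintype.card J ≤ 2 ^ r) {x : J → Ω → ℝ} (hx : Set.range x ⊆ S)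
    (hx₀ : ∀ j ω, x j ω ≠ 0) (k : ℕ) :
    OperatorComputableFrom inp (k * (2 * #P + 3 * Fintype.card J)) (k * (r + 4)) S
      fun ω c => SparseChol.jacobi (B ω) (fun i => x i ω) c k := by
  induction k with
  | zero => exact zero hS _ _
  | succ k ih =>
    have hstep := (reindex Sum.inr _).add (((reindex Sum.inl _).sub
      ((mulVec hS hP hP₀ hr).comp (reindex (Sum.inr : J → J ⊕ J) 0))).div hx hx₀)
    refine (hstep.comp_sumElim ih).mono_cost ?_ ?_
    · ring_nf; omega
    · ring_nf; omega

end OperatorComputableFrom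

section SparseMatrices

lemma card_le_nnz {κ : Type} [Fintype κ] {M : Matrix κ κ ℝ} (hM : M.PosDef) :
    Fintype.card κ ≤ nnz M := by
  rw [← card_univ]
  refine card_le_card_of_injOn (fun i => (i, i)) (fun i _ => ?_) fun i _ j _ h =>
    (Prod.ext_iff.1 h).1
  have : M i i ≠ 0 := hM.diag_pos.ne'
  simpa using this

/-- The nonzero positions of the block of `M` with the rows `f` and the columns `g`. -/
noncomputable def blockSupport {κ κ₁ κ₂ : Type*} [Fintype κ₁] [Fintype κ₂] (M : Matrix κ κ ℝ)
    (f : κ₁ → κ) (g : κ₂ → κ) : Finset (κ₁ × κ₂) := {p | M (f p.1) (g p.2) ≠ 0}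

lemma card_blockSupport_le {κ : Type} {κ₁ κ₂ : Type*} [Fintype κ] [Fintype κ₁] [Fintype κ₂]
    (M : Matrix κ κ ℝ) {f : κ₁ → κ} {g : κ₂ → κ} (hf : f.Injective) (hg : g.Injective) :
    #(blockSupport M f g) ≤ nnz M := by
  refine card_le_card_of_injOn (Prod.map f g) (fun p hp => ?_) (hf.prodMap hg).injOn
  simpa [blockSupport] using hp

lemma fine_injective {ι : Type} (V F : Finset ι) : (fine V F).Injective := Subtype.val_injective

lemma coarse_injective {ι : Type} [DecidableEq ι] (V F : Finset ι) : (coarse V F).Injective :=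
  fun _ _ h => Subtype.ext (congrArg (Subtype.val : ↥V → ι) h)

end SparseMatrices

namespace OperatorComputableFrom

variable {I V : Type} {Ω : Type*} {inp : Ω → I → ℝ} {S : Set (Ω → ℝ)} [Fintype V]
  {M : Ω → Matrix V V ℝ} {M₀ : Matrix V V ℝ} {r w δ : ℕ}

lemma submatrix_mulVec (hS : freeFunctions inp ⊆ S) (hM : ∀ u v, (fun ω => M ω u v) ∈ S)
    (hM₀ : ∀ ω u v, M₀ u v = 0 → M ω u v = 0) (hr : Fintype.card V ≤ 2 ^ r) {J K : Type*}
    [Fintype J] [Finite K] {f : K → V} {g : J → V} (hf : f.Injective) (hg : g.Injective) :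
    OperatorComputableFrom inp (2 * nnz M₀) (r + 1) S
      fun ω c => (M ω).submatrix f g *ᵥ c :=
  have := Fintype.ofFinite K
  (mulVec hS (P := blockSupport M₀ f g) (fun p _ => hM _ _)
    (fun ω k j h => hM₀ ω _ _ (by simpa [blockSupport] using h))
    ((Fintype.card_le_of_injective g hg).trans hr)).mono_cost
    (Nat.mul_le_mul_left 2 (card_blockSupport_le M₀ hf hg)) le_rfl

lemma richardson (hS : freeFunctions inp ⊆ S) (hM : ∀ u v, (fun ω => M ω u v) ∈ S)
    (hM₀ : ∀ ω u v, M₀ u v = 0 → M ω u v = 0) (hcard : Fintype.card V ≤ nnz M₀)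
    (hr : Fintype.card V ≤ 2 ^ r) {W : Ω → Matrix V V ℝ}
    (hW : OperatorComputableFrom inp w δ S fun ω c => W ω *ᵥ c) (t : ℕ) :
    OperatorComputableFrom inp (t * (5 * nnz M₀ + w)) (t * (r + 4 + δ)) S
      fun ω b => SparseChol.richardson (M ω) (W ω) b t := by
  induction t with
  | zero => exact zero hS _ _
  | succ t ih =>
    have hproduct := (submatrix_mulVec hS hM hM₀ hr Function.injective_id
      Function.injective_id).comp (reindex (Sum.inr : V → V ⊕ V) 0)
    have hcorrection := hW.comp ((reindex Sum.inl _).sub hproduct)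
    have hstep := (reindex Sum.inr _).add (hcorrection.smul hS (1 / 3))
    refine (hstep.comp_sumElim ih).mono_cost ?_ ?_
    · rw [Nat.succ_mul t]
      omega
    · rw [Nat.succ_mul t]
      omega

lemma inv_mulVec [DecidableEq V] (hS : freeFunctions inp ⊆ S)
    (hM : ∀ u v, (fun ω => M ω u v) ∈ S) (hdet : ∀ ω, IsUnit (M ω).det) {s : ℕ}
    (hs : Fintype.card V ≤ s) :
    OperatorComputableFrom inp ((s + 1) * (s.factorial * (s + 2)) + s) (s + 1 + s.factorial + 1) S
      fun ω b => (M ω)⁻¹ *ᵥ b := fun _ =>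
  computableFrom_inv_mulVec (hS.trans Set.subset_union_left) (fun u v => Or.inl (hM u v)) hdet
    Set.subset_union_right hs

section Level

variable {ι : Type} {V F : Finset ι} {M : Ω → Matrix V V ℝ} {M₀ : Matrix V V ℝ} {k : ℕ}

lemma fineSolve (hS : freeFunctions inp ⊆ S) (hM : ∀ u v, (fun ω => M ω u v) ∈ S)
    (hM₀ : ∀ ω u v, M₀ u v = 0 → M ω u v = 0) (hcard : Fintype.card V ≤ nnz M₀)
    (hr : Fintype.card V ≤ 2 ^ r) [DecidableEq ι] (hx : ∀ ω i, 0 < ∑ j, blockFF (M ω) F i j) :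
    OperatorComputableFrom inp (nnz M₀ + k * (5 * nnz M₀)) (r + k * (r + 4)) S
      fun ω c => SparseChol.fineSolve (M ω) F k c := by
  set P := blockSupport M₀ (fine V F) (fine V F) with hP
  have hP₀ : ∀ ω i j, (i, j) ∉ P → blockFF (M ω) F i j = 0 := fun ω i j h =>
    hM₀ ω _ _ (by simpa [hP, blockSupport] using h)
  have hF := Fintype.card_le_of_injective _ (fine_injective V F)
  have hrowSums := computableFrom_rowSum hS (M := fun ω => blockFF (M ω) F) (P := P)
    (fun p _ => hM _ _) hP₀ (hF.trans hr)
  have hjacobi := jacobi (hS.trans Set.subset_union_left) (B := fun ω => blockFF (M ω) F) (P := P)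
    (fun p _ => Or.inl (hM _ _)) hP₀ (hF.trans hr) Set.subset_union_right
    (fun i ω => (hx ω i).ne') k
  have hnnz : #P ≤ nnz M₀ := card_blockSupport_le M₀ (fine_injective V F) (fine_injective V F)
  exact (of_computableFrom hrowSums hjacobi).mono_cost
    (add_le_add hnnz (Nat.mul_le_mul_left k (by omega))) le_rfl

variable [DecidableEq ι] {W : Ω → Matrix ↥(V \ F) ↥(V \ F) ℝ}

lemma levelSolve (hS : freeFunctions inp ⊆ S) (hM : ∀ u v, (fun ω => M ω u v) ∈ S)
    (hM₀ : ∀ ω u v, M₀ u v = 0 → M ω u v = 0) (hcard : Fintype.card V ≤ nnz M₀)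
    (hr : Fintype.card V ≤ 2 ^ r) (hx : ∀ ω i, 0 < ∑ j, blockFF (M ω) F i j)
    (hW : OperatorComputableFrom inp w δ S fun ω c => W ω *ᵥ c) (hk : 1 ≤ k) :
    OperatorComputableFrom inp (18 * (k * nnz M₀) + w) (6 * k * (r + 4) + δ) S
      fun ω b => SparseChol.levelSolve (M ω) F k (W ω) b := by
  have hF := Fintype.card_le_of_injective _ (fine_injective V F)
  have hC := Fintype.card_le_of_injective _ (coarse_injective V F)
  have hsolve := fineSolve (k := k) hS hM hM₀ hcard hr hx
  have hcoarse := hW.comp ((reindex (coarse V F) _).sub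
    ((submatrix_mulVec hS hM hM₀ hr (coarse_injective V F) (fine_injective V F)).comp
      (hsolve.comp (reindex (fine V F) 0))))
  have hfine := hsolve.comp ((reindex (Sum.inl ∘ fine V F) _).sub
    ((submatrix_mulVec hS hM hM₀ hr (fine_injective V F) (coarse_injective V F)).comp
      (reindex (Sum.inr : ↥(V \ F) → ↥V ⊕ ↥(V \ F)) 0)))
  have hsolution := (reindex (splitEquiv V F).symm 0).comp (hfine.sumElim (reindex Sum.inr _))
  have hm : nnz M₀ ≤ k * nnz M₀ := Nat.le_mul_of_pos_left _ hk
  have hr' : r + 4 ≤ k * (r + 4) := Nat.le_mul_of_pos_left _ hk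
  refine (hsolution.comp_sumElim hcoarse).mono_cost ?_ ?_
  · rw [mul_left_comm k 5]
    omega
  · rw [mul_assoc 6]
    omega

end Level

end OperatorComputableFrom

/-! ### Applying a chain -/

/-- The number of gates that invert a matrix of dimension at most `s` by Cramer's rule. -/
def cramerWork (s : ℕ) : ℕ := (s + 1) * (s.factorial * (s + 2)) + s

/-- The depth in which a matrix of dimension at most `s` is inverted by Cramer's rule. -/
def cramerDepth (s : ℕ) : ℕ := s + 1 + s.factorial + 1

/-- Each matrix `M ω` has a positive definite `η`-approximation whose inverse can be applied to a
vector by `w` gates in depth `δ`. The circuit is the same for all instances `ω`. -/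
def HasComputablePreconditioner {I V : Type} {Ω : Type*} [Fintype V] [DecidableEq V]
    (inp : Ω → I → ℝ) (η : ℝ) (w δ : ℕ) (M : Ω → Matrix V V ℝ) : Prop :=
  ∃ N : Ω → Matrix V V ℝ, (∀ ω, (N ω).PosDef ∧ Approx η (N ω) (M ω)) ∧
    OperatorComputableFrom inp w δ (freeFunctions inp) fun ω b => (N ω)⁻¹ *ᵥ b

namespace HasComputablePreconditioner

variable {I V : Type} {Ω : Type*} {inp : Ω → I → ℝ} {η ε : ℝ} {w δ : ℕ}

section

variable [Fintype V] [DecidableEq V] {M : Ω → Matrix V V ℝ}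

lemma mono_error (h : HasComputablePreconditioner inp η w δ M) (hM : ∀ ω, (M ω).PosDef)
    (hle : η ≤ ε) : HasComputablePreconditioner inp ε w δ M :=
  let ⟨N, hN, hcomputable⟩ := h
  ⟨N, fun ω => ⟨(hN ω).1, (hN ω).2.mono (hM ω).posSemidef hle⟩, hcomputable⟩

lemma of_posDef (hM : ∀ u v, (fun ω => M ω u v) ∈ freeFunctions inp) (hpos : ∀ ω, (M ω).PosDef)
    {s : ℕ} (hs : Fintype.card V ≤ s) :
    HasComputablePreconditioner inp 0 (cramerWork s) (cramerDepth s) M :=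
  ⟨M, fun ω => ⟨hpos ω, by simp [Approx, PosSemidef.zero]⟩,
    .inv_mulVec subset_rfl hM (fun ω => isUnit_det_of_posDef (hpos ω)) hs⟩

lemma reindex_trans {K : Type} [Fintype K] [DecidableEq K] (e : K ≃ V) {A : Ω → Matrix K K ℝ}
    (h : HasComputablePreconditioner inp η w δ M)
    (hA : ∀ ω, Approx ε ((M ω).submatrix e e) (A ω)) :
    HasComputablePreconditioner inp (η + ε) w δ A := by
  obtain ⟨N, hN, hcomputable⟩ := h
  refine ⟨fun ω => (N ω).submatrix e e, fun ω =>
    ⟨(hN ω).1.submatrix e.injective, ((hN ω).2.submatrix e).trans (hA ω)⟩, ?_⟩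
  have happly : ∀ ω (b : K → ℝ),
      ((N ω).submatrix e e)⁻¹ *ᵥ b = ((N ω)⁻¹ *ᵥ (b ∘ e.symm)) ∘ e := fun ω b => by
    rw [inv_submatrix_equiv, submatrix_mulVec_equiv]
  simp only [happly]
  simpa only [zero_add, add_zero] using
    (OperatorComputableFrom.reindex e 0).comp (hcomputable.comp (.reindex e.symm 0))

lemma exists_circuit {A₀ : Matrix V V ℝ} (h : HasComputablePreconditioner inp 1 w δ M)
    (hM : ∀ u v, (fun ω => M ω u v) ∈ freeFunctions inp) (hpos : ∀ ω, (M ω).PosDef)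
    (hA₀ : ∀ ω u v, A₀ u v = 0 → M ω u v = 0) (hcard : Fintype.card V ≤ nnz A₀) {r : ℕ}
    (hr : Fintype.card V ≤ 2 ^ r) {b : V → Ω → ℝ} (hb : Set.range b ⊆ freeFunctions inp) (t : ℕ) :
    ∃ c : Circuit I V, c.work ≤ t * (5 * nnz A₀ + w) ∧ c.depth ≤ t * (r + 4 + δ) ∧
      ∀ ω, c.gates.Defined (inp ω) ∧
        IsApproxSolution ((9 / 10) ^ t) (M ω) (fun v => b v ω) (c.eval (inp ω)) := by
  obtain ⟨N, hN, hcomputable⟩ := h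
  obtain ⟨c, hwork, hdepth, hc⟩ :=
    ((OperatorComputableFrom.richardson subset_rfl hM hA₀ hcard hr hcomputable t).apply
      hb).exists_circuit
  refine ⟨c, hwork, hdepth, fun ω => ⟨(hc ω).1, ?_⟩⟩
  rw [(hc ω).2]
  exact isApproxSolution_richardson (hpos ω) (hN ω).1 (hN ω).2 _ t

end

lemma of_schur {ι : Type} [DecidableEq ι] {V F : Finset ι} {M : Ω → Matrix V V ℝ}
    {M₀ : Matrix V V ℝ} {S : Ω → Matrix ↥(V \ F) ↥(V \ F) ℝ} {α : ℝ} {k r : ℕ}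
    (h : HasComputablePreconditioner inp η w δ S) (hη : 0 ≤ η)
    (hM : ∀ u v, (fun ω => M ω u v) ∈ freeFunctions inp) (hsddm : ∀ ω, IsSDDM (M ω))
    (hM₀ : ∀ ω u v, M₀ u v = 0 → M ω u v = 0) (hcard : Fintype.card V ≤ nnz M₀)
    (hr : Fintype.card V ≤ 2 ^ r) (hx : ∀ ω i, 0 < ∑ j, blockFF (M ω) F i j) (hα : 4 ≤ α)
    (hdd : ∀ ω, IsStronglyDD α (blockFF (M ω) F)) (hS : ∀ ω, Approx ε (S ω) (schur (M ω) F))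
    (hε : 0 ≤ ε) (hk : Even k) (hk₂ : 2 ≤ k) (hkε : 2 * (2 / α) ^ (k - 1) ≤ ε) :
    HasComputablePreconditioner inp (η + 2 * ε) (18 * (k * nnz M₀) + w) (6 * k * (r + 4) + δ)
      M := by
  obtain ⟨N', hN', hcomputable⟩ := h
  choose N hpos happrox happly using fun ω =>
    exists_level_operator (hsddm ω) hα (hdd ω) hk hk₂ hkε hε hη (hN' ω).2 (hS ω)
  refine ⟨N, fun ω => ⟨hpos ω, happrox ω⟩, ?_⟩
  simp only [happly]
  exact .levelSolve subset_rfl hM hM₀ hcard hr hx hcomputable (one_le_two.trans hk₂)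

end HasComputablePreconditioner

section Solver

variable {n : ℕ}

/-- The inputs on which a solver built for the chain `M` of `A` has to work: a system with a chain
of the same shape and the same sparsity patterns. -/
structure SolverInstance (s : ℕ) (A : Matrix (Fin n) (Fin n) ℝ) (σ : ChainShape n)
    (M : ChainMatrices σ) where
  mat : Matrix (Fin n) (Fin n) ℝ
  chain : ChainMatrices σ
  rhs : Fin n → ℝ
  isChain : IsVertexSparsifierChain s mat σ chain
  pattern : SamePattern mat A
  chainPattern : ∀ i, 1 ≤ i → i ≤ σ.d → SamePattern (chain i) (M i)

variable {s : ℕ} {A : Matrix (Fin n) (Fin n) ℝ} {σ : ChainShape n} {M : ChainMatrices σ}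

/-- The values that a circuit receives on an instance. -/
def SolverInstance.inputs (ω : SolverInstance s A σ M) : SolverInput σ → ℝ :=
  solverInput ω.mat ω.chain ω.rhs

/-- The number `k` of Jacobi iterations is even, so that they underestimate the inverse, and large
enough for the error `ε` when the dominance is `α`. -/
structure IsIterationCount (α ε : ℝ) (k : ℕ) : Prop where
  even : Even k
  two_le : 2 ≤ k
  error : 2 * (2 / α) ^ (k - 1) ≤ ε

lemma IsVertexSparsifierChain.rowSum_pos (h : IsVertexSparsifierChain s A σ M) {i : ℕ}
    (hi : 1 ≤ i) (hd : i < σ.d) (v : {v : ↥(σ.vertices i) // (v : Fin n) ∈ σ.F i}) :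
    0 < ∑ j, blockFF (M i) (σ.F i) v j := by
  have hM := h.sddm i hi hd.le
  have hinj := fine_injective (σ.vertices i) (σ.F i)
  exact (h.stronglyDD i hi hd).rowSum_pos (hM.posDef.submatrix hinj)
    (fun u w huw => hM.offDiag_nonpos _ _ (hinj.ne huw))
    (by linarith [h.four_le_α i hi hd]) v

lemma IsVertexSparsifierChain.hasComputablePreconditioner (h : IsVertexSparsifierChain s A σ M)
    {k : ℕ → ℕ} (hk : ∀ i, 1 ≤ i → i < σ.d → IsIterationCount (σ.α i) (σ.ε i) (k i)) {r : ℕ}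
    (hr : n ≤ 2 ^ r) {i : ℕ} (hi : 1 ≤ i) (hid : i ≤ σ.d) :
    HasComputablePreconditioner (SolverInstance.inputs (s := s) (A := A) (M := M))
      (2 * ∑ l ∈ Ico i σ.d, σ.ε l) (18 * ∑ l ∈ Ico i σ.d, k l * nnz (M l) + cramerWork s)
      (6 * (∑ l ∈ Ico i σ.d, k l) * (r + 4) + cramerDepth s) fun ω => ω.chain i := by
  induction hid using Nat.decreasingInduction with
  | self =>
    simpa using HasComputablePreconditioner.of_posDef
      (M := fun ω : SolverInstance s A σ M => ω.chain σ.d)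
      (fun u v => input_mem_freeFunctions _ (SolverInput.chain σ.d u v))
      (fun ω => (ω.isChain.sddm σ.d hi le_rfl).posDef)
      ((Fintype.card_coe _).trans_le h.size_last)
  | of_succ i hd ih =>
    obtain ⟨i, rfl⟩ := Nat.exists_eq_add_of_le' hi
    have hcard : Fintype.card (σ.vertices (i + 1)) ≤ n := by
      simpa using card_le_univ (σ.vertices (i + 1))
    have hη : 0 ≤ 2 * ∑ l ∈ Ico (i + 2) σ.d, σ.ε l :=
      mul_nonneg two_pos.le (sum_nonneg fun l hl => (h.ε_pos l (mem_Ico.1 hl).2).le)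
    have hlevel := (ih (by omega)).of_schur
      (M := fun ω : SolverInstance s A σ M => ω.chain (i + 1)) hη
      (fun u v => input_mem_freeFunctions _ (SolverInput.chain (i + 1) u v))
      (fun ω => ω.isChain.sddm (i + 1) hi hd.le)
      (fun ω u v => (ω.chainPattern (i + 1) hi hd.le u v).2)
      (card_le_nnz (h.sddm (i + 1) hi hd.le).posDef) (hcard.trans hr)
      (fun ω => ω.isChain.rowSum_pos hi hd) (h.four_le_α (i + 1) hi hd)
      (fun ω => ω.isChain.stronglyDD (i + 1) hi hd) (fun ω => ω.isChain.approx_schur i hd)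
      (h.ε_pos (i + 1) hd).le (hk (i + 1) hi hd).even (hk (i + 1) hi hd).two_le
      (hk (i + 1) hi hd).error
    simp only [sum_eq_sum_Ico_succ_bot hd]
    convert hlevel using 1 <;> ring

lemma IsVertexSparsifierChain.exists_solver (h : IsVertexSparsifierChain s A σ M)
    (herror : 2 * ∑ i ∈ range σ.d, σ.ε i ≤ 1) {k : ℕ → ℕ}
    (hk : ∀ i, 1 ≤ i → i < σ.d → IsIterationCount (σ.α i) (σ.ε i) (k i)) {r : ℕ}
    (hr : n ≤ 2 ^ r) (t : ℕ) :
    ∃ c : Circuit (SolverInput σ) (Fin n),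
      c.work ≤ t * (5 * nnz A + (18 * ∑ l ∈ Ico 1 σ.d, k l * nnz (M l) + cramerWork s)) ∧
      c.depth ≤ t * (r + 4 + (6 * (∑ l ∈ Ico 1 σ.d, k l) * (r + 4) + cramerDepth s)) ∧
      ∀ ω : SolverInstance s A σ M, c.gates.Defined ω.inputs ∧
        IsApproxSolution ((9 / 10) ^ t) ω.mat ω.rhs (c.eval ω.inputs) := by
  have hpos : ∀ ω : SolverInstance s A σ M, ω.mat.PosDef := fun ω => ω.isChain.sddm_input.posDef
  have hd : 0 < σ.d := h.one_le_d
  have hsum : 2 * ∑ l ∈ Ico 1 σ.d, σ.ε l + σ.ε 0 ≤ 1 := by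
    rw [range_eq_Ico, sum_eq_sum_Ico_succ_bot hd, zero_add] at herror
    linarith [h.ε_pos 0 hd]
  have hprecond := ((h.hasComputablePreconditioner hk hr le_rfl hd).reindex_trans
    (Equiv.subtypeUnivEquiv fun v => mem_univ v).symm
    fun ω : SolverInstance s A σ M => ω.isChain.approx_input).mono_error hpos hsum
  exact hprecond.exists_circuit (fun u v => input_mem_freeFunctions _ (SolverInput.system u v)) hpos
    (fun ω u v => (ω.pattern u v).2) (card_le_nnz h.sddm_input.posDef) (by simpa using hr)
    (by rintro _ ⟨v, rfl⟩; exact input_mem_freeFunctions _ (SolverInput.rhs v)) t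

end Solver

/-! ### Work and depth of the solver -/

lemma one_le_lg (x : ℝ) : 1 ≤ lg x := le_max_left _ _

lemma log_le_lg (x : ℝ) : Real.log x ≤ lg x := le_max_right _ _

lemma two_mul_two_div_pow_le {α ε : ℝ} (hα : 4 ≤ α) (hε : 0 < ε) (hε' : ε ≤ 1 / 2) {k : ℕ}
    (hk : 4 * Real.logb α ε⁻¹ ≤ k) : 2 * (2 / α) ^ k ≤ ε := by
  have hα₀ : 0 < α := by linarith
  have hlogα : 0 < Real.log α := Real.log_pos (by linarith)
  have hlogb : Real.logb α ε⁻¹ * Real.log α = -Real.log ε := by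
    rw [Real.logb, div_mul_cancel₀ _ hlogα.ne', Real.log_inv]
  have hlog_half : Real.log (2 / α) ≤ -(Real.log α / 2) := by
    have hlog4 : Real.log 4 = 2 * Real.log 2 := by
      rw [show (4 : ℝ) = 2 ^ 2 by norm_num, Real.log_pow, Nat.cast_ofNat]
    rw [Real.log_div two_ne_zero hα₀.ne']
    linarith [Real.log_le_log four_pos hα]
  have hlog_two : Real.log 2 ≤ -Real.log ε := by
    rw [← Real.log_inv]
    exact Real.log_le_log two_pos ((le_inv_comm₀ two_pos hε).2 (by linarith))
  rw [← Real.log_le_log_iff (by positivity) hε, Real.log_mul two_ne_zero (by positivity),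
    Real.log_pow]
  calc Real.log 2 + k * Real.log (2 / α)
      ≤ -Real.log ε + k * -(Real.log α / 2) := by gcongr
    _ = -Real.log ε - k * (Real.log α / 2) := by ring
    _ ≤ -Real.log ε - 4 * Real.logb α ε⁻¹ * (Real.log α / 2) := by gcongr
    _ = Real.log ε := by linear_combination -2 * hlogb

lemma exists_isIterationCount {α ε κ : ℝ} (hα : 4 ≤ α) (hε : 0 < ε) (hε' : ε ≤ 1 / 2)
    (hκ : 0 < κ) (hκε : κ ≤ Real.logb α ε⁻¹) :
    ∃ k : ℕ, IsIterationCount α ε k ∧ (k : ℝ) ≤ (8 + 4 / κ) * Real.logb α ε⁻¹ := by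
  have hlogb : 0 < Real.logb α ε⁻¹ := hκ.trans_le hκε
  set j := ⌈4 * Real.logb α ε⁻¹⌉₊
  refine ⟨2 * (j + 1), ⟨even_two_mul _, by omega, two_mul_two_div_pow_le hα hε hε' ?_⟩, ?_⟩
  · refine (Nat.le_ceil _).trans ?_
    exact_mod_cast (by omega : j ≤ 2 * (j + 1) - 1)
  · have hceil : (j : ℝ) < 4 * Real.logb α ε⁻¹ + 1 := Nat.ceil_lt_add_one (by positivity)
    have hconst : 4 ≤ 4 / κ * Real.logb α ε⁻¹ := by
      rw [div_mul_eq_mul_div, le_div_iff₀ hκ]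
      linarith
    push_cast
    linarith

lemma exists_nine_tenths_pow_le {ε : ℝ} (hε : 0 < ε) (hε' : ε ≤ 1) :
    ∃ t : ℕ, ((9 : ℝ) / 10) ^ t ≤ ε ∧ (t : ℝ) ≤ 11 * lg (1 / ε) := by
  have hlog : 0 ≤ Real.log (1 / ε) := Real.log_nonneg ((one_le_div hε).2 hε')
  refine ⟨⌈10 * Real.log (1 / ε)⌉₊, ?_, ?_⟩
  · set t := ⌈10 * Real.log (1 / ε)⌉₊
    have hceil : 10 * Real.log (1 / ε) ≤ t := Nat.le_ceil _
    rw [one_div, Real.log_inv] at hceil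
    calc ((9 : ℝ) / 10) ^ t ≤ Real.exp (-(1 / 10)) ^ t := by
          gcongr
          linarith [Real.add_one_le_exp (-(1 / 10 : ℝ))]
      _ = Real.exp (t * -(1 / 10)) := (Real.exp_nat_mul _ _).symm
      _ ≤ Real.exp (Real.log ε) := Real.exp_le_exp.2 (by linarith)
      _ = ε := Real.exp_log hε
  · have hceil := Nat.ceil_lt_add_one (a := 10 * Real.log (1 / ε)) (by positivity)
    linarith [log_le_lg (1 / ε), one_le_lg (1 / ε)]

lemma clog_add_four_le {n : ℕ} (hn : 2 ≤ n) : (Nat.clog 2 n : ℝ) + 4 ≤ 10 * Real.log n := by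
  have hlog : Real.log 2 ≤ Real.log n := Real.log_le_log two_pos (by exact_mod_cast hn)
  have hclog : 0 < Nat.clog 2 n := Nat.clog_pos one_lt_two hn
  have hpow : ((Nat.clog 2 n : ℝ) - 1) * Real.log 2 ≤ Real.log n := by
    rw [← Nat.cast_pred hclog, ← Real.log_pow]
    exact Real.log_le_log (by positivity)
      (by exact_mod_cast (Nat.pow_pred_clog_lt_self one_lt_two hn).le)
  nlinarith [Real.log_two_gt_d9]

lemma IsApproxSolution.mono {ι : Type} [Fintype ι] [DecidableEq ι] {ε ε' : ℝ}
    {A : Matrix ι ι ℝ} {b y : ι → ℝ} (h : IsApproxSolution ε A b y) (hε : ε ≤ ε') :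
    IsApproxSolution ε' A b y :=
  h.trans (mul_le_mul_of_nonneg_right hε (Real.sqrt_nonneg _))

section GoodChain

variable {n s : ℕ} {A : Matrix (Fin n) (Fin n) ℝ} {σ : ChainShape n} {M : ChainMatrices σ}
  {κ c : ℝ} {k : ℕ → ℕ}

lemma IsVertexSparsifierChain.exists_isIterationCount (h : IsVertexSparsifierChain s A σ M)
    (hκ : 0 < κ) (hlow : ∀ i, 1 ≤ i → i < σ.d → κ ≤ Real.logb (σ.α i) (σ.ε i)⁻¹) :
    ∃ k : ℕ → ℕ, ∀ i, 1 ≤ i → i < σ.d → IsIterationCount (σ.α i) (σ.ε i) (k i) ∧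
      (k i : ℝ) ≤ (8 + 4 / κ) * Real.logb (σ.α i) (σ.ε i)⁻¹ := by
  have hlevel : ∀ i, ∃ k : ℕ, 1 ≤ i → i < σ.d → IsIterationCount (σ.α i) (σ.ε i) k ∧
      (k : ℝ) ≤ (8 + 4 / κ) * Real.logb (σ.α i) (σ.ε i)⁻¹ := fun i => by
    by_cases hi : 1 ≤ i ∧ i < σ.d
    · obtain ⟨k, hk⟩ := SparseChol.exists_isIterationCount (h.four_le_α i hi.1 hi.2)
        (h.ε_pos i hi.2) (h.ε_le i hi.2) hκ (hlow i hi.1 hi.2)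
      exact ⟨k, fun _ _ => hk⟩
    · exact ⟨0, fun h₁ h₂ => absurd ⟨h₁, h₂⟩ hi⟩
  exact ⟨fun i => (hlevel i).choose, fun i => (hlevel i).choose_spec⟩

lemma sum_iterations_mul_nnz_le (M : ChainMatrices σ)
    (hk : ∀ i, 1 ≤ i → i < σ.d → (k i : ℝ) ≤ c * Real.logb (σ.α i) (σ.ε i)⁻¹) :
    ∑ i ∈ Ico 1 σ.d, (k i : ℝ) * nnz (M i) ≤ c * chainWork σ M := by
  rw [chainWork, mul_sum]
  refine sum_le_sum fun i hi => ?_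
  obtain ⟨hi, hd⟩ := mem_Ico.1 hi
  calc (k i : ℝ) * nnz (M i) ≤ c * Real.logb (σ.α i) (σ.ε i)⁻¹ * nnz (M i) := by
        gcongr
        exact hk i hi hd
    _ = c * (nnz (M i) * Real.logb (σ.α i) (σ.ε i)⁻¹) := by ring

lemma sum_iterations_mul_log_le
    (hk : ∀ i, 1 ≤ i → i < σ.d → (k i : ℝ) ≤ c * Real.logb (σ.α i) (σ.ε i)⁻¹) :
    (∑ i ∈ Ico 1 σ.d, (k i : ℝ)) * Real.log n ≤ c * chainDepth σ := by
  rw [chainDepth, mul_sum, sum_mul]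
  refine sum_le_sum fun i hi => ?_
  obtain ⟨hi, hd⟩ := mem_Ico.1 hi
  calc (k i : ℝ) * Real.log n ≤ c * Real.logb (σ.α i) (σ.ε i)⁻¹ * Real.log n :=
        mul_le_mul_of_nonneg_right (hk i hi hd) (Real.log_natCast_nonneg n)
    _ = c * (Real.log n * Real.logb (σ.α i) (σ.ε i)⁻¹) := by ring

lemma refinementWork_le {c₂ : ℝ} (hA : A.PosDef) (hn : 1 ≤ n) (hc : 0 ≤ c)
    (hk : ∀ i, 1 ≤ i → i < σ.d → (k i : ℝ) ≤ c * Real.logb (σ.α i) (σ.ε i)⁻¹)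
    (hwork : chainWork σ M ≤ c₂ * n) :
    5 * (nnz A : ℝ) + (18 * ∑ i ∈ Ico 1 σ.d, (k i : ℝ) * nnz (M i) + cramerWork s) ≤
      (5 + (18 * (c * |c₂|) + cramerWork s)) * nnz A := by
  have hnA : (n : ℝ) ≤ nnz A := by
    simpa using (Nat.cast_le (α := ℝ)).2 (card_le_nnz hA)
  have hn₁ : (1 : ℝ) ≤ n := by exact_mod_cast hn
  have hsum : ∑ i ∈ Ico 1 σ.d, (k i : ℝ) * nnz (M i) ≤ c * |c₂| * nnz A :=
    calc ∑ i ∈ Ico 1 σ.d, (k i : ℝ) * nnz (M i) ≤ c * chainWork σ M :=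
          sum_iterations_mul_nnz_le M hk
      _ ≤ c * (|c₂| * nnz A) := by
          gcongr
          exact hwork.trans (by gcongr; exact le_abs_self _)
      _ = c * |c₂| * nnz A := by ring
  have hlast : (cramerWork s : ℝ) ≤ cramerWork s * nnz A :=
    le_mul_of_one_le_right (Nat.cast_nonneg _) (hn₁.trans hnA)
  linarith

lemma refinementDepth_le {c₁ Λ : ℝ} (hn : 2 ≤ n) (hlog : Real.log n ≤ Λ) (hΛ : 1 ≤ Λ)
    (hc : 0 ≤ c) (hk : ∀ i, 1 ≤ i → i < σ.d → (k i : ℝ) ≤ c * Real.logb (σ.α i) (σ.ε i)⁻¹)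
    (hdepth : chainDepth σ ≤ c₁ * Λ) :
    (Nat.clog 2 n : ℝ) + 4 + (6 * (∑ i ∈ Ico 1 σ.d, (k i : ℝ)) * (Nat.clog 2 n + 4) +
      cramerDepth s) ≤ (10 + (60 * (c * |c₁|) + cramerDepth s)) * Λ := by
  have hclog := clog_add_four_le hn
  have hsum : (∑ i ∈ Ico 1 σ.d, (k i : ℝ)) * (Nat.clog 2 n + 4) ≤ 10 * (c * |c₁| * Λ) :=
    calc (∑ i ∈ Ico 1 σ.d, (k i : ℝ)) * (Nat.clog 2 n + 4)
        ≤ (∑ i ∈ Ico 1 σ.d, (k i : ℝ)) * (10 * Real.log n) := by gcongr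
      _ = 10 * ((∑ i ∈ Ico 1 σ.d, (k i : ℝ)) * Real.log n) := by ring
      _ ≤ 10 * (c * chainDepth σ) :=
          mul_le_mul_of_nonneg_left (sum_iterations_mul_log_le hk) (by norm_num)
      _ ≤ 10 * (c * (|c₁| * Λ)) := by
          gcongr
          exact hdepth.trans (by gcongr; exact le_abs_self _)
      _ = 10 * (c * |c₁| * Λ) := by ring
  have hlast : (cramerDepth s : ℝ) ≤ cramerDepth s * Λ :=
    le_mul_of_one_le_right (Nat.cast_nonneg _) hΛ
  linarith

lemma exists_solver_of_dim_zero {I : Type} : ∃ S : Circuit I (Fin 0), S.work = 0 ∧ S.depth = 0 ∧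
    ∀ x, S.gates.Defined x ∧ ∀ (ε : ℝ) (A : Matrix (Fin 0) (Fin 0) ℝ) (b : Fin 0 → ℝ),
      IsApproxSolution ε A b (S.eval x) :=
  ⟨⟨0, .nil, fun v => v.elim0⟩, rfl, rfl, fun _ => ⟨trivial, fun ε A b => by
    simp [IsApproxSolution, energyNorm]⟩⟩

variable {c₁ c₂ : ℝ}

/-- The work of a solver of a good chain per nonzero entry and refinement step. -/
noncomputable def solverWorkFactor (s : ℕ) (κ c₂ : ℝ) : ℝ :=
  5 + (18 * ((8 + 4 / κ) * |c₂|) + cramerWork s)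

/-- The depth of a solver of a good chain per refinement step, in units of
`lg² n · lg (log n)`. -/
noncomputable def solverDepthFactor (s : ℕ) (κ c₁ : ℝ) : ℝ :=
  10 + (60 * ((8 + 4 / κ) * |c₁|) + cramerDepth s)

lemma IsVertexSparsifierChainWith.exists_solver (hn : 1 ≤ n) (hκ : 0 < κ) {Λ ε : ℝ}
    (hlog : Real.log n ≤ Λ) (hΛ : 1 ≤ Λ)
    (h : IsVertexSparsifierChainWith 1 (c₁ * Λ) (c₂ * n) s A σ M)
    (hlow : ∀ i, 1 ≤ i → i < σ.d → κ ≤ Real.logb (σ.α i) (σ.ε i)⁻¹) (hε : 0 < ε) (hε' : ε ≤ 1) :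
    ∃ S : Circuit (SolverInput σ) (Fin n),
      (S.work : ℝ) ≤ 11 * solverWorkFactor s κ c₂ * (nnz A * lg (1 / ε)) ∧
      (2 ≤ n → (S.depth : ℝ) ≤ 11 * solverDepthFactor s κ c₁ * (Λ * lg (1 / ε))) ∧
      ∀ ω : SolverInstance s A σ M, S.gates.Defined ω.inputs ∧
        IsApproxSolution ε ω.mat ω.rhs (S.eval ω.inputs) := by
  obtain ⟨k, hk⟩ := h.chain.exists_isIterationCount hκ hlow
  have hk_le := fun i hi hd => (hk i hi hd).2
  have hc : 0 ≤ 8 + 4 / κ := by positivity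
  obtain ⟨t, ht, htε⟩ := exists_nine_tenths_pow_le hε hε'
  obtain ⟨S, hwork, hdepth, hS⟩ := h.chain.exists_solver h.error
    (fun i hi hd => (hk i hi hd).1) (Nat.le_pow_clog one_lt_two n) t
  have hℓ := one_le_lg (1 / ε)
  refine ⟨S, ?_, fun hn₂ => ?_, fun ω => ⟨(hS ω).1, (hS ω).2.mono ht⟩⟩
  · calc (S.work : ℝ)
        ≤ t * (5 * nnz A + (18 * ∑ i ∈ Ico 1 σ.d, (k i : ℝ) * nnz (M i) + cramerWork s)) := by
          exact_mod_cast hwork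
      _ ≤ 11 * lg (1 / ε) * (solverWorkFactor s κ c₂ * nnz A) :=
          mul_le_mul htε (refinementWork_le h.chain.sddm_input.posDef hn hc hk_le h.work)
            (by positivity) (by linarith)
      _ = _ := by ring
  · calc (S.depth : ℝ)
        ≤ t * (Nat.clog 2 n + 4 + (6 * (∑ i ∈ Ico 1 σ.d, (k i : ℝ)) * (Nat.clog 2 n + 4) +
            cramerDepth s)) := by exact_mod_cast hdepth
      _ ≤ 11 * lg (1 / ε) * (solverDepthFactor s κ c₁ * Λ) :=
          mul_le_mul htε (refinementDepth_le hn₂ hlog hΛ hc hk_le h.depth)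
            (by positivity) (by linarith)
      _ = _ := by ring

end GoodChain

theorem exists_solver_of_good_chain (s : ℕ) (κ c₁ c₂ : ℝ) (hκ : 0 < κ) : ∃ C : ℝ,
    ∀ (n : ℕ) (A : Matrix (Fin n) (Fin n) ℝ) (σ : ChainShape n) (M : ChainMatrices σ),
      IsVertexSparsifierChainWith 1 (c₁ * (lg n ^ 2 * lg (Real.log n))) (c₂ * n) s A σ M →
      (∀ i, 1 ≤ i → i < σ.d → κ ≤ Real.logb (σ.α i) (σ.ε i)⁻¹) →
      ∀ ε : ℝ, 0 < ε → ε ≤ 1 →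
        ∃ S : Circuit (SolverInput σ) (Fin n),
          (S.work : ℝ) ≤ C * (nnz A * lg (1 / ε)) ∧
          (S.depth : ℝ) ≤ C * (lg n ^ 2 * lg (Real.log n) * lg (1 / ε)) ∧
          ∀ ω : SolverInstance s A σ M, S.gates.Defined ω.inputs ∧
            IsApproxSolution ε ω.mat ω.rhs (S.eval ω.inputs) := by
  have ha : 0 < solverWorkFactor s κ c₂ := by rw [solverWorkFactor]; positivity
  have ha' : 0 < solverDepthFactor s κ c₁ := by rw [solverDepthFactor]; positivity
  refine ⟨11 * (solverWorkFactor s κ c₂ + solverDepthFactor s κ c₁),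
    fun n A σ M hM hlow ε hε hε' => ?_⟩
  have hℓ := one_le_lg (1 / ε)
  set Λ := lg n ^ 2 * lg (Real.log n)
  have hlg : lg n ≤ Λ :=
    calc lg n ≤ lg n ^ 2 := le_self_pow₀ (one_le_lg n) two_ne_zero
      _ ≤ Λ := le_mul_of_one_le_right (sq_nonneg _) (one_le_lg _)
  have hΛ : 1 ≤ Λ := (one_le_lg n).trans hlg
  rcases Nat.eq_zero_or_pos n with rfl | hn
  · obtain ⟨S, hwork, hdepth, hS⟩ := exists_solver_of_dim_zero (I := SolverInput σ)
    refine ⟨S, ?_, ?_, fun ω => ⟨(hS _).1, (hS _).2 _ _ _⟩⟩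
    · rw [hwork, Nat.cast_zero]; positivity
    · rw [hdepth, Nat.cast_zero]; positivity
  obtain ⟨S, hwork, hdepth, hS⟩ :=
    hM.exists_solver hn hκ ((log_le_lg n).trans hlg) hΛ hlow hε hε'
  have hwork' : (S.work : ℝ) ≤
      11 * (solverWorkFactor s κ c₂ + solverDepthFactor s κ c₁) * (nnz A * lg (1 / ε)) :=
    hwork.trans (by gcongr; linarith)
  refine ⟨S, hwork', ?_, hS⟩
  rcases (Nat.succ_le_of_lt hn).eq_or_lt with rfl | hn₂
  · -- The factor `log n = 0` makes the depth bound of the chain empty; the work bound replaces it.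
    have hnnz : (nnz A : ℝ) ≤ Λ := hΛ.trans' <| by
      exact_mod_cast (card_le_univ _).trans_eq (by simp)
    calc (S.depth : ℝ) ≤ S.work := by exact_mod_cast S.depth_le_work
      _ ≤ _ := hwork'.trans (by gcongr)
  · exact (hdepth hn₂).trans (by gcongr; linarith)

end SparseChol

theorem mainTheorem2 :
    -- every SDDM matrix has a 1-vertex sparsifier chain of the claimed depth and work
    (∃ (s : ℕ) (κ c₁ c₂ : ℝ), 0 < κ ∧
      ∀ (n : ℕ) (A : Matrix (Fin n) (Fin n) ℝ), SparseChol.IsSDDM A →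
        ∃ (σ : SparseChol.ChainShape n) (M : SparseChol.ChainMatrices σ),
          SparseChol.IsVertexSparsifierChainWith 1
            (c₁ * (SparseChol.lg n ^ 2 * SparseChol.lg (Real.log n))) (c₂ * n) s A σ M ∧
          ∀ i, 1 ≤ i → i < σ.d → κ ≤ Real.logb (σ.α i) (σ.ε i)⁻¹) ∧
    -- given such a chain, approximate solutions can be computed in the claimed work and depth;
    -- the circuit depends only on `ε`, on the shape of the chain and on the positions of the
    -- nonzero entries of the matrices
    (∀ (s : ℕ) (κ c₁ c₂ : ℝ), 0 < κ → ∃ C : ℝ,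
      ∀ (n : ℕ) (A : Matrix (Fin n) (Fin n) ℝ)
        (σ : SparseChol.ChainShape n) (M : SparseChol.ChainMatrices σ),
        SparseChol.IsVertexSparsifierChainWith 1
          (c₁ * (SparseChol.lg n ^ 2 * SparseChol.lg (Real.log n))) (c₂ * n) s A σ M →
        (∀ i, 1 ≤ i → i < σ.d → κ ≤ Real.logb (σ.α i) (σ.ε i)⁻¹) →
        ∀ ε : ℝ, 0 < ε → ε < 1 →
          ∃ S : SparseChol.Circuit (SparseChol.SolverInput σ) (Fin n),
            (S.work : ℝ) ≤ C * (SparseChol.nnz A * SparseChol.lg (1 / ε)) ∧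
            (S.depth : ℝ) ≤ C * (SparseChol.lg n ^ 2 * SparseChol.lg (Real.log n) *
              SparseChol.lg (1 / ε)) ∧
            ∀ (A' : Matrix (Fin n) (Fin n) ℝ) (M' : SparseChol.ChainMatrices σ),
              SparseChol.IsVertexSparsifierChain s A' σ M' →
              SparseChol.SamePattern A' A →
              (∀ i, 1 ≤ i → i ≤ σ.d → SparseChol.SamePattern (M' i) (M i)) →
              ∀ b : Fin n → ℝ,
                S.gates.Defined (SparseChol.solverInput A' M' b) ∧
                SparseChol.IsApproxSolution ε A' b
                  (S.eval (SparseChol.solverInput A' M' b))) := by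
  refine ⟨SparseChol.exists_good_chain, fun s κ c₁ c₂ hκ => ?_⟩
  obtain ⟨C, hC⟩ := SparseChol.exists_solver_of_good_chain s κ c₁ c₂ hκ
  refine ⟨C, fun n A σ M hgood hlow ε hε hε' => ?_⟩
  obtain ⟨S, hwork, hdepth, hS⟩ := hC n A σ M hgood hlow ε hε hε'.le
  exact ⟨S, hwork, hdepth, fun A' M' hchain hA hM b => hS ⟨A', M', b, hchain, hA, hM⟩⟩
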